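/- **Model.** Node 1 and Node 2 have energy buffers of capacities $B_1,B_2\in\mathbb{N}$. At channel use $k$ the state is $U_k=(U_{1,k},U_{2,k})\in\mathcal S=[0,B_1]\times[0,B_2]$; the initial state $U_1=s_0$ is fixed and known. Node $i$ sends $X_{i,k}\in\{0,1\}$, with $X_{i,k}=0$ if $U_{i,k}=0$. For $i\neq j$, Node $j$ receives $Y_{j,k}$ through a binary channel with $\Pr[Y_j=b\mid X_i=a]=P_{ij}^{(ab)}$, and harvests $H_{j,k}\in\{0,1\}$ with $\Pr[H_j=b\mid Y_j=a]=P_{jj}^{(ab)}$; here $P_{ij}^{(01)},P_{ij}^{(10)}\in[0,1]$ are arbitrary flip probabilities, $P_{ij}^{(00)}=1-P_{ij}^{(01)}$, $P_{ij}^{(11)}=1-P_{ij}^{(10)}$ for all $i,j\in\{1,2\}$, and all these random events are independent. Then $U_{i,k+1}=\min(B_i,\;U_{i,k}-X_{i,k}+H_{i,k})$. **Codes.** Node $i$ has a message $M_i$, uniform on $\lceil 2^{nR_i}\rceil$ values, with $M_1,M_2$ independent. In a code of length $n$, Node $i$ chooses $X_{i,k}$ as a function of $M_i$, $Y_i^{k-1}$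 and $U_1^k,U_2^k$, and decodes the message of the other node from $Y_i^n$, $M_i$ and $U_1^n,U_2^n$. A pair $(R_1,R_2)$ with $R_1,R_2\ge 0$ is achievable from $s_0$ if for every $\varepsilon>0$ and all sufficiently large $n$ there is such a code for which the probability that some node decodes wrongly is at most $\varepsilon$. The capacity region $\mathcal C_{s_0}(B_1,B_2)$ is the closure of the set of achievable pairs. **Proposition 3.** Let $p_{i|s}\in[0,1]$, for $i=1,2$ and $s=(u_1,u_2)\in\mathcal S$, be transmission probabilities with $p_{i|(u_1,u_2)}=0$ whenever $u_i=0$. Let $\mathbf P$ be the matrix of transition probabilities of the state (columns: current state, rows: next state) if in state $s$ the two nodes send independent symbols $X_{1|s}\sim\mathrm{Bern}(p_{1|s})$ and $X_{2|s}\sim\mathrm{Bern}(p_{2|s})$. Let $\boldsymbol\pi(1)$ be the unit vector at $s_0$, and assume that the limit $\boldsymbol\pi=\lim_{k\to\infty}\mathbf P^k\boldsymbol\pi(1)$ exists. Then every $(R_1,R_2)$ with $$0\le R_1\le\sum_{s\in\mathcal S}\pi_s\,I(X_{1|s};Y_2),\qquad 0\le R_2\le\sum_{s\in\mathcal S}\pi_s\,I(X_{2|s};Y_1)$$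 belongs to $\mathcal C_{s_0}(B_1,B_2)$, where $Y_j$ is the output of the channel from Node $i$ to Node $j$ with input $X_{i|s}$. Moreover, for $i\ne j$ and every $s\in\mathcal S$, $$I(X_{i|s};Y_j)=H\big((1-p_{i|s})P_{ij}^{(01)}+p_{i|s}P_{ij}^{(11)}\big)-\big[p_{i|s}H(P_{ij}^{(11)})+(1-p_{i|s})H(P_{ij}^{(01)})\big],$$ where $H(p)$ is the entropy in bits of the law $\mathrm{Bern}(p)$ and mutual information is in bits. -/

import Mathlib

open Filter Topology

noncomputable section

namespace EnergyExchange

/-- The two nodes are `0` (Node 1) and `1` (Node 2); `other i` is the node that is not `i`. -/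
def other (i : Fin 2) : Fin 2 := Fin.rev i

/-- The law of a `Bern(p)` bit (`true` is the symbol 1, `false` the symbol 0). -/
def bern (p : ℝ) (x : Bool) : ℝ := if x then p else 1 - p

/-- Two nodes with finite energy buffers that are joined by noisy binary channels.
For `i ≠ j` the pair `(flip01 i j, flip10 i j)` describes the channel from `X_i` to `Y_j`:
the probability that a sent 0 is received as 1 (replenishment on the channel) and that a sent 1
is received as 0 (loss on the channel). For `i = j` it describes the passage from the received
symbol `Y_i` to the harvested energy `H_i` (local replenishment and local loss). -/
structure Model where
  /-- buffer capacities -/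
  B : Fin 2 → ℕ
  flip01 : Fin 2 → Fin 2 → ℝ
  flip10 : Fin 2 → Fin 2 → ℝ
  flip01_nonneg : ∀ i j, 0 ≤ flip01 i j
  flip01_le_one : ∀ i j, flip01 i j ≤ 1
  flip10_nonneg : ∀ i j, 0 ≤ flip10 i j
  flip10_le_one : ∀ i j, flip10 i j ≤ 1

namespace Model

variable (M : Model)

/-- Energy states `(u_1, u_2)` in `[0, B_1] × [0, B_2]`. -/
abbrev State : Type := ∀ i : Fin 2, Fin (M.B i + 1)

/-- `M.P i j a b` is the probability that the input `a` gives the output `b`, on the channel from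
Node `i` to Node `j` if `i ≠ j`, and from `Y_i` to `H_i` if `i = j`. -/
def P (i j : Fin 2) (a b : Bool) : ℝ :=
  if a then bern (1 - M.flip10 i j) b else bern (M.flip01 i j) b

/-- The energy of Node `i` at the next channel use: it has `u` units, sends `x`, harvests `h`,
and cannot store more than `B i`. -/
def nextEnergy (i : Fin 2) (u : ℕ) (x h : Bool) : ℕ :=
  min (M.B i) (u - x.toNat + h.toNat)

/-- Joint probability, at one channel use, of the received symbols `y` and the next state `s'`,
given the current state `s` and the transmitted symbols `x`. All replenishment and loss events
are independent. -/
def kernel (s : M.State) (x y : Fin 2 → Bool) (s' : M.State) : ℝ :=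
  ∏ i, M.P (other i) i (x (other i)) (y i) *
    ∑ h : Bool, M.P i i (y i) h * (if (s' i : ℕ) = M.nextEnergy i (s i) (x i) h then 1 else 0)

/-- A code of block length `n` with `K i` messages at Node `i`, under global energy information.
At channel use `k` Node `i` sends a function of its message, of the symbols it received before,
and of the past and current states of both buffers; it can send a 1 only if it has energy.
Node `i` decodes the message of the other node from all the symbols it received, its own message
and the states at all channel uses. -/
structure Code (n : ℕ) (K : Fin 2 → ℕ) where
  enc : ∀ (i : Fin 2) (k : Fin n), Fin (K i) → (Fin k → Bool) → (Fin (k + 1) → M.State) → Bool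
  enc_empty : ∀ i (k : Fin n) m (y : Fin k → Bool) (s : Fin (k + 1) → M.State),
    (s (Fin.last k) i : ℕ) = 0 → enc i k m y s = false
  dec : ∀ i : Fin 2, (Fin n → Bool) → Fin (K i) → (Fin n → M.State) → Fin (K (other i))

namespace Code

variable {M} {n : ℕ} {K : Fin 2 → ℕ} (c : M.Code n K)

/-- The symbols sent at channel use `k`, given the messages, the received symbols (`y i` is the
sequence received by Node `i`) and the states. -/
def sent (m : ∀ i, Fin (K i)) (y : Fin 2 → Fin n → Bool) (s : Fin (n + 1) → M.State)
    (k : Fin n) (i : Fin 2) : Bool :=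
  c.enc i k (m i) (Fin.take k k.isLt.le (y i)) (Fin.take (k + 1) (by omega) s)

/-- Probability of the received sequences `y` and the states `s`, given the messages `m` and the
initial state `s₀`. The last entry of `s` is the state after the last channel use. -/
def pathProb (s₀ : M.State) (m : ∀ i, Fin (K i)) (y : Fin 2 → Fin n → Bool)
    (s : Fin (n + 1) → M.State) : ℝ :=
  (if s 0 = s₀ then 1 else 0) *
    ∏ k : Fin n, M.kernel (s k.castSucc) (c.sent m y s k) (fun i => y i k) (s k.succ)

/-- Some node does not recover the message of the other one. -/
def IsError (m : ∀ i, Fin (K i)) (y : Fin 2 → Fin n → Bool) (s : Fin (n + 1) → M.State) : Prop :=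
  ∃ i, c.dec i (y i) (m i) (fun k => s k.castSucc) ≠ m (other i)

open Classical in
/-- Probability that some node is in error, for independent uniform messages. -/
def errorProb (s₀ : M.State) : ℝ :=
  (∑ m : ∀ i, Fin (K i), ∑ y : Fin 2 → Fin n → Bool, ∑ s : Fin (n + 1) → M.State,
    c.pathProb s₀ m y s * (if c.IsError m y s then 1 else 0)) / ∏ i, (K i : ℝ)

end Code

/-- The rates `R i` (bits per channel use) are achievable from the initial state `s₀`: for all
large block lengths `n` there are codes with (at least) `2 ^ (n * R i)` messages at Node `i`, with
probability of error tending to zero. -/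
def Achievable (s₀ : M.State) (R : Fin 2 → ℝ) : Prop :=
  (∀ i, 0 ≤ R i) ∧ ∀ ε : ℝ, 0 < ε → ∃ N : ℕ, ∀ n : ℕ, N ≤ n →
    ∃ c : M.Code n (fun i => ⌈(2 : ℝ) ^ ((n : ℝ) * R i)⌉₊), c.errorProb s₀ ≤ ε

/-- The capacity region for the initial state `s₀`. -/
def capacityRegion (s₀ : M.State) : Set (Fin 2 → ℝ) :=
  closure {R | M.Achievable s₀ R}

/-- State-dependent transmission probabilities: Node `i` sends a 1 in state `s` with probability
`p i s`, which is 0 if it has no energy. -/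
structure IsTransmission (p : Fin 2 → M.State → ℝ) : Prop where
  nonneg : ∀ i s, 0 ≤ p i s
  le_one : ∀ i s, p i s ≤ 1
  empty : ∀ i s, (s i : ℕ) = 0 → p i s = 0

/-- Probability that Node `j` harvests `h` if Node `i` sends `x` (cascade of the channel from `i`
to `j` and of the harvesting at `j`). -/
def Q (i j : Fin 2) (x h : Bool) : ℝ := ∑ y : Bool, M.P i j x y * M.P j j y h

/-- Transition matrix of the state if, in state `s`, the nodes send independent bits with laws
`Bern(p i s)`. The column is the initial state, the row is the final state. -/
def transition (p : Fin 2 → M.State → ℝ) : Matrix M.State M.State ℝ := fun s' s =>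
  ∑ x : Fin 2 → Bool, (∏ i, bern (p i s) (x i)) *
    ∏ i, ∑ h : Bool, M.Q (other i) i (x (other i)) h *
      (if (s' i : ℕ) = M.nextEnergy i (s i) (x i) h then 1 else 0)

end Model

/-- Mutual information, in bits, of a pair with joint law `q` on a finite product. -/
def mutualInfo {α β : Type*} [Fintype α] [Fintype β] (q : α → β → ℝ) : ℝ :=
  ∑ a, ∑ b, q a b * Real.logb 2 (q a b / ((∑ b', q a b') * ∑ a', q a' b))

/-- Entropy of `Bern(p)`, in bits. -/
def H (p : ℝ) : ℝ := Real.binEntropy p / Real.log 2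

/-- `I(X_{i|s}; Y_j)`, where `X_{i|s}` has the law `Bern(p i s)` and `Y_j` is the output of the
channel from Node `i` to the other node `j`. -/
def Model.rate (M : Model) (p : Fin 2 → M.State → ℝ) (i : Fin 2) (s : M.State) : ℝ :=
  mutualInfo fun x y : Bool => bern (p i s) x * M.P i (other i) x y

end EnergyExchange

end

/-!
Stationary information rates are achieved by random coding on top of a simulation of the chain.

**Why a plain random code does not suffice.** The chain with transition matrix `P` may be
reducible. Its occupation frequencies are then random, and `π` only gives their expectation, while
a code needs enough information with probability close to one. The remedy is to restart the chain
again and again from a stationary law, so that the averages concentrate, and the point is that the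
energy spent on earlier runs does not prevent this.

**Simulation.** The energy update `u ↦ min B (u - x + h)` is monotone. If the buffers `u` dominate a
virtual state `v`, then the nodes can send symbols with the laws `p i v`, and the virtual state can
be updated by the conditional law, given the observed change of `u`, of what `v` would have become;
this is drawn from common randomness, which is part of the random code. So `v` moves as a chain with
matrix `P`, and domination persists (`Simulation.Dom.nextState`). With a small probability `ε` the
virtual state is drawn anew from the stationary law. If it is not dominated by the buffers, the
nodes send prescribed symbols until it is.

**Drift.** Let `h = I + (1 - ε) Pᵀ h` be the discounted information. The potential `h v`, minus
a multiple of the remaining time of travel, makes the conditional mean of (log-likelihood ratio +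
increment of the potential) at least `∑ π I - O(ε)` in every step (`drift_of_dom`,
`drift_of_not_dom`), because the stationary mean of `ε h` is that of `I`.

**Coding.** Codewords are tables of independent bits, one for each message, time and situation
(`Scheme`, `Table`). By the drift and Chebyshev's inequality the sent message has a large likelihood
ratio (`HasDrift.sum_pathWeight_mul_indicator_le`); every other message has a likelihood ratio of
mean at most one (`sum_pathWeight_mul_score_le_one`). Together these give `achievable_of_hasDrift`.

**Regaining energy.** That domination can be restored depends on the probabilities that a node
harvests a unit when the other one is silent or transmits. Either silence, or transmissions of one
node, fill the buffers of all nodes that transmit under `π` (`Simulation.ofSilence`,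
`Simulation.ofSupply`; nodes without a source of energy do not transmit under `π`, by
`IsStationary.sum_mul_send_le`), or the exchange is lossless. In the lossless case the total energy
cannot grow. The chain preserves it under `π`, and the stationary laws of the different energy
levels are used one after the other, from the highest level to the lowest, each for a fraction of
time equal to its probability (`stageLevel`).
-/

noncomputable section

namespace EnergyExchange

/-! ### Sums over paths of a controlled chain -/

section Paths

/-- Marginalization of a finite product law onto the coordinates `e j`. -/
lemma sum_prod_mul_comp {ι J β : Type*} [Fintype ι] [Fintype J] [Fintype β] [DecidableEq ι]
    [DecidableEq J] [DecidableEq β] (κ : ι → β → ℝ) (hκ : ∀ a, ∑ b, κ a b = 1) (e : J → ι)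
    (he : Function.Injective e) (F : (J → β) → ℝ) :
    ∑ f : ι → β, (∏ a, κ a (f a)) * F (fun j => f (e j)) =
      ∑ b : J → β, (∏ j, κ (e j) (b j)) * F b := by
  have key : ∀ b : J → β, ∑ f : ι → β, (∏ a, κ a (f a)) *
      (if (fun j => f (e j)) = b then 1 else 0) = ∏ j, κ (e j) (b j) := by
    intro b
    have h1 : ∀ f : ι → β, (∏ a, κ a (f a)) * (if (fun j => f (e j)) = b then (1 : ℝ) else 0) =
        ∏ a, (κ a (f a) * ∏ j, if e j = a then (if f a = b j then (1 : ℝ) else 0) else 1) := by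
      intro f
      rw [Finset.prod_mul_distrib]
      congr 1
      rw [Finset.prod_comm]
      have h2 : ∀ j, ∏ a, (if e j = a then (if f a = b j then (1 : ℝ) else 0) else 1) =
          if f (e j) = b j then 1 else 0 := fun j => by
        rw [Finset.prod_ite_eq Finset.univ (e j)]; simp
      simp_rw [h2]
      by_cases hb : (fun j => f (e j)) = b
      · rw [if_pos hb]; symm
        refine Finset.prod_eq_one fun j _ => ?_
        rw [if_pos (congrFun hb j)]
      · rw [if_neg hb]; symm
        obtain ⟨j, hj⟩ := Function.ne_iff.mp hb
        exact Finset.prod_eq_zero (Finset.mem_univ j) (if_neg hj)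
    simp_rw [h1]
    rw [← Fintype.prod_sum (fun a x => κ a x *
      ∏ j, if e j = a then (if x = b j then (1 : ℝ) else 0) else 1)]
    symm
    refine Fintype.prod_of_injective e he _ _ ?_ ?_
    · intro a ha
      refine (Finset.sum_congr rfl fun x _ => ?_).trans (hκ a)
      rw [Finset.prod_eq_one, mul_one]
      intro j _
      rw [if_neg]
      rintro rfl
      exact ha ⟨j, rfl⟩
    · intro j
      have h3 : ∀ x, (∏ j', if e j' = e j then (if x = b j' then (1 : ℝ) else 0) else 1) =
          if x = b j then 1 else 0 := by
        intro x
        simp only [he.eq_iff]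
        rw [Finset.prod_ite_eq' Finset.univ j]; simp
      simp_rw [h3]
      simp
  calc _ = ∑ f : ι → β, ∑ b : J → β, (∏ a, κ a (f a)) *
        (if (fun j => f (e j)) = b then 1 else 0) * F b := by
        refine Finset.sum_congr rfl fun f _ => ?_
        simp
    _ = _ := by
        rw [Finset.sum_comm]
        refine Finset.sum_congr rfl fun b _ => ?_
        rw [← Finset.sum_mul, key]

lemma sum_fin_succ {A : Type*} [Fintype A] {n : ℕ} (F : (Fin (n + 1) → A) → ℝ) :
    ∑ a : Fin (n + 1) → A, F a = ∑ a₀, ∑ a : Fin n → A, F (Fin.cons a₀ a) := by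
  rw [← Fintype.sum_prod_type']
  exact (Fintype.sum_equiv (Fin.consEquiv fun _ => A) _ _ fun x => rfl).symm

variable {A W : Type*}

/-- The states visited from `w` when the noise at time `k` is `a k` and the state moves
by `f k`. -/
def traj {n : ℕ} (f : Fin n → W → A → W) (w : W) (a : Fin n → A) : Fin (n + 1) → W :=
  Fin.induction w fun k w' => f k w' (a k)

@[simp] lemma traj_zero {n : ℕ} (f : Fin n → W → A → W) (w : W) (a : Fin n → A) :
    traj f w a 0 = w := rfl

lemma traj_succ {n : ℕ} (f : Fin n → W → A → W) (w : W) (a : Fin n → A) (k : Fin n) :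
    traj f w a k.succ = f k (traj f w a k.castSucc) (a k) := rfl

lemma traj_cons {n : ℕ} (f : Fin (n + 1) → W → A → W) (w : W) (a₀ : A) (a : Fin n → A)
    (k : Fin (n + 1)) :
    traj f w (Fin.cons a₀ a) k.succ = traj (fun j => f j.succ) (f 0 w a₀) a k := by
  induction k using Fin.induction with
  | zero => rw [traj_succ]; simp
  | succ k ih => rw [traj_succ, traj_succ, ← ih]; simp

/-- Total weight of a path that starts at `w`. -/
def pathWeight {n : ℕ} (f : Fin n → W → A → W) (ω : Fin n → W → A → ℝ) (w : W)
    (a : Fin n → A) : ℝ :=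
  ∏ k, ω k (traj f w a k.castSucc) (a k)

lemma pathWeight_cons {n : ℕ} (f : Fin (n + 1) → W → A → W) (ω : Fin (n + 1) → W → A → ℝ) (w : W)
    (a₀ : A) (a : Fin n → A) :
    pathWeight f ω w (Fin.cons a₀ a) =
      ω 0 w a₀ * pathWeight (fun j => f j.succ) (fun j => ω j.succ) (f 0 w a₀) a := by
  unfold pathWeight
  rw [Fin.prod_univ_succ]
  simp only [Fin.castSucc_zero, traj_zero, Fin.cons_zero, Fin.cons_succ, ← Fin.succ_castSucc,
    traj_cons]

lemma pathWeight_nonneg {n : ℕ} (f : Fin n → W → A → W) (ω : Fin n → W → A → ℝ)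
    (hω : ∀ k w a, 0 ≤ ω k w a) (w : W) (a : Fin n → A) : 0 ≤ pathWeight f ω w a :=
  Finset.prod_nonneg fun _ _ => hω _ _ _

variable [Fintype A]

lemma sum_pathWeight_le_one {n : ℕ} (f : Fin n → W → A → W) (ω : Fin n → W → A → ℝ)
    (hω : ∀ k w a, 0 ≤ ω k w a) (h1 : ∀ k w, ∑ a, ω k w a ≤ 1) (w : W) :
    ∑ a, pathWeight f ω w a ≤ 1 := by
  induction n generalizing w with
  | zero => simp [pathWeight]
  | succ n ih =>
    rw [sum_fin_succ]
    simp_rw [pathWeight_cons, ← Finset.mul_sum]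
    refine le_trans (Finset.sum_le_sum fun a₀ _ => ?_) (h1 0 w)
    exact mul_le_of_le_one_right (hω _ _ _) (ih _ _ (fun k => hω k.succ) (fun k => h1 k.succ) _)

lemma sq_max_add_le (x d : ℝ) : (max 0 (x + d)) ^ 2 ≤ (max 0 x) ^ 2 + 2 * max 0 x * d + d ^ 2 := by
  rcases le_total x 0 with hx | hx <;> rcases le_total (x + d) 0 with hd | hd <;>
    simp only [max_eq_left, max_eq_right, hx, hd] <;> nlinarith [sq_nonneg (x + d)]

/-- Increments with nonpositive conditional means and bounded size: the second moment of the
positive part of their sum grows at most linearly. -/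
lemma sum_pathWeight_mul_sq_le {n : ℕ} (f : Fin n → W → A → W) (ω : Fin n → W → A → ℝ)
    (hω : ∀ k w a, 0 ≤ ω k w a) (h1 : ∀ k w, ∑ a, ω k w a ≤ 1)
    (Inv : Fin (n + 1) → W → Prop)
    (hInv : ∀ k w a, Inv k.castSucc w → 0 < ω k w a → Inv k.succ (f k w a))
    (D : Fin n → W → A → ℝ) (C : ℝ) (hC : ∀ k w a, |D k w a| ≤ C)
    (hD : ∀ k w, Inv k.castSucc w → ∑ a, ω k w a * D k w a ≤ 0)
    (w : W) (hw : Inv 0 w) (x : ℝ) :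
    ∑ a, pathWeight f ω w a * (max 0 (x + ∑ k, D k (traj f w a k.castSucc) (a k))) ^ 2 ≤
      (max 0 x) ^ 2 + n * C ^ 2 := by
  induction n generalizing w x with
  | zero => simp [pathWeight]
  | succ n ih =>
    rw [sum_fin_succ]
    have step : ∀ a₀, ∑ a : Fin n → A, pathWeight f ω w (Fin.cons a₀ a) *
        (max 0 (x + ∑ k, D k (traj f w (Fin.cons a₀ a) k.castSucc)
          ((Fin.cons a₀ a : Fin (n + 1) → A) k))) ^ 2 ≤
        ω 0 w a₀ * ((max 0 (x + D 0 w a₀)) ^ 2 + n * C ^ 2) := by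
      intro a₀
      rcases (hω 0 w a₀).eq_or_lt with h0 | h0
      · simp [pathWeight_cons, ← h0]
      have := ih (fun j => f j.succ) (fun j => ω j.succ) (fun k => hω k.succ) (fun k => h1 k.succ)
        (fun k => Inv k.succ) (fun k w' a h h' => hInv k.succ w' a h h') (fun k => D k.succ)
        (fun k => hC k.succ) (fun k w' h => hD k.succ w' h) (f 0 w a₀) (hInv 0 w a₀ hw h0)
        (x + D 0 w a₀)
      refine le_trans (le_of_eq ?_) (mul_le_mul_of_nonneg_left this h0.le)
      rw [Finset.mul_sum]
      refine Finset.sum_congr rfl fun a _ => ?_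
      rw [pathWeight_cons, Fin.sum_univ_succ]
      simp only [Fin.castSucc_zero, traj_zero, Fin.cons_zero, Fin.cons_succ, ← Fin.succ_castSucc,
        traj_cons]
      ring_nf
    refine le_trans (Finset.sum_le_sum fun a₀ _ => step a₀) ?_
    have hb : ∀ a₀, ω 0 w a₀ * ((max 0 (x + D 0 w a₀)) ^ 2 + n * C ^ 2) ≤
        ω 0 w a₀ * ((max 0 x) ^ 2 + (n + 1) * C ^ 2) + 2 * max 0 x * (ω 0 w a₀ * D 0 w a₀) := by
      intro a₀
      have h2 : (D 0 w a₀) ^ 2 ≤ C ^ 2 := sq_le_sq' (abs_le.mp (hC 0 w a₀)).1 (abs_le.mp (hC 0 w a₀)).2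
      have h3 := sq_max_add_le x (D 0 w a₀)
      have h4 : (max 0 (x + D 0 w a₀)) ^ 2 + n * C ^ 2 ≤
          (max 0 x) ^ 2 + (n + 1) * C ^ 2 + 2 * max 0 x * D 0 w a₀ := by linarith
      nlinarith [mul_le_mul_of_nonneg_left h4 (hω 0 w a₀)]
    refine le_trans (Finset.sum_le_sum fun a₀ _ => hb a₀) ?_
    rw [Finset.sum_add_distrib, ← Finset.sum_mul, ← Finset.mul_sum]
    have h5 := hD 0 w hw
    have h6 : 0 ≤ 2 * max 0 x := by positivity
    have h7 : 0 ≤ (max 0 x) ^ 2 + ((n : ℝ) + 1) * C ^ 2 := by positivity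
    have h8 := mul_le_mul_of_nonneg_right (h1 0 w) h7
    push_cast
    nlinarith [mul_nonneg h6 (sub_nonneg.mpr h5)]

end Paths

/-! ### One channel use -/

@[simp] lemma other_other (i : Fin 2) : other (other i) = i := Fin.rev_rev i

lemma other_ne (i : Fin 2) : other i ≠ i := by fin_cases i <;> decide

lemma eq_or_eq_other (i j : Fin 2) : j = i ∨ j = other i := by
  fin_cases i <;> fin_cases j <;> decide

lemma bern_nonneg {p : ℝ} (h0 : 0 ≤ p) (h1 : p ≤ 1) (x : Bool) : 0 ≤ bern p x := by
  cases x <;> simp [bern, h0, h1]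

lemma sum_bern (p : ℝ) : ∑ x, bern p x = 1 := by simp [bern]

lemma sum_prod_bern (p : Fin 2 → ℝ) : ∑ x : Fin 2 → Bool, ∏ i, bern (p i) (x i) = 1 := by
  rw [← Fintype.prod_sum fun i b => bern (p i) b]
  simp only [sum_bern, Finset.prod_const_one]

/-- In a sum over all pairs of bits, a factor that depends on one of them is averaged alone. -/
lemma sum_prod_mul_apply (g : Fin 2 → Bool → ℝ) (hg : ∀ i, ∑ b, g i b = 1) (i : Fin 2)
    (F : Bool → ℝ) : ∑ x : Fin 2 → Bool, (∏ j, g j (x j)) * F (x i) = ∑ b, g i b * F b := by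
  have h := sum_prod_mul_comp g hg (fun _ : Fin 1 => i) (Function.injective_of_subsingleton _)
    (fun b => F (b 0))
  rw [h, sum_fin_succ]
  simp

namespace Model

variable (M : Model)

lemma P_nonneg (i j : Fin 2) (a b : Bool) : 0 ≤ M.P i j a b := by
  have h1 := M.flip01_nonneg i j
  have h2 := M.flip01_le_one i j
  have h3 := M.flip10_nonneg i j
  have h4 := M.flip10_le_one i j
  cases a
  · exact bern_nonneg h1 h2 b
  · exact bern_nonneg (by linarith) (by linarith) b

lemma sum_P (i j : Fin 2) (a : Bool) : ∑ b, M.P i j a b = 1 := by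
  cases a <;> simp [P, bern]

lemma Q_nonneg (i j : Fin 2) (a b : Bool) : 0 ≤ M.Q i j a b :=
  Finset.sum_nonneg fun _ _ => mul_nonneg (M.P_nonneg _ _ _ _) (M.P_nonneg _ _ _ _)

lemma sum_Q (i j : Fin 2) (a : Bool) : ∑ b, M.Q i j a b = 1 := by
  simp only [Q]
  rw [Finset.sum_comm]
  simp only [← Finset.mul_sum, sum_P, mul_one]

/-- The next state, given the transmitted symbols `x` and the harvested units `h`. -/
def nextState (s : M.State) (x h : Fin 2 → Bool) : M.State :=
  fun i => ⟨M.nextEnergy i (s i) (x i) (h i), Nat.lt_succ_of_le (min_le_left _ _)⟩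

lemma nextState_val (s : M.State) (x h : Fin 2 → Bool) (i : Fin 2) :
    (M.nextState s x h i : ℕ) = min (M.B i) (s i - (x i).toNat + (h i).toNat) := rfl

/-- Probability that the nodes harvest `h` if they send `x`. -/
def harvestProb (x h : Fin 2 → Bool) : ℝ := ∏ i, M.Q (other i) i (x (other i)) (h i)

lemma harvestProb_nonneg (x h : Fin 2 → Bool) : 0 ≤ M.harvestProb x h :=
  Finset.prod_nonneg fun _ _ => M.Q_nonneg _ _ _ _

lemma sum_harvestProb (x : Fin 2 → Bool) : ∑ h, M.harvestProb x h = 1 := by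
  unfold harvestProb
  rw [← Fintype.prod_sum fun i b => M.Q (other i) i (x (other i)) b]
  simp only [sum_Q, Finset.prod_const_one]

lemma prod_indicator_nextState (s s' : M.State) (x h : Fin 2 → Bool) :
    (∏ i, if (s' i : ℕ) = M.nextEnergy i (s i) (x i) (h i) then (1 : ℝ) else 0) =
      if s' = M.nextState s x h then 1 else 0 := by
  by_cases hs : s' = M.nextState s x h
  · rw [if_pos hs]
    refine Finset.prod_eq_one fun i _ => if_pos ?_
    rw [hs]; rfl
  · rw [if_neg hs]
    obtain ⟨i, hi⟩ := Function.ne_iff.mp hs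
    refine Finset.prod_eq_zero (Finset.mem_univ i) (if_neg fun h' => hi (Fin.ext h'))

lemma kernel_eq (s : M.State) (x y : Fin 2 → Bool) (s' : M.State) :
    M.kernel s x y s' = ∑ h : Fin 2 → Bool,
      (∏ i, M.P (other i) i (x (other i)) (y i) * M.P i i (y i) (h i)) *
        if s' = M.nextState s x h then 1 else 0 := by
  unfold kernel
  simp_rw [Finset.mul_sum]
  rw [Fintype.prod_sum]
  refine Finset.sum_congr rfl fun h _ => ?_
  rw [← prod_indicator_nextState, ← Finset.prod_mul_distrib]
  simp_rw [mul_assoc]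

lemma kernel_nonneg (s : M.State) (x y : Fin 2 → Bool) (s' : M.State) :
    0 ≤ M.kernel s x y s' := by
  rw [kernel_eq]
  refine Finset.sum_nonneg fun h _ => mul_nonneg (Finset.prod_nonneg fun i _ =>
    mul_nonneg (M.P_nonneg _ _ _ _) (M.P_nonneg _ _ _ _)) ?_
  split_ifs <;> norm_num

lemma sum_kernel_state (s : M.State) (x y : Fin 2 → Bool) :
    ∑ s', M.kernel s x y s' = ∏ i, M.P (other i) i (x (other i)) (y i) := by
  simp_rw [kernel_eq]
  rw [Finset.sum_comm]
  simp_rw [← Finset.mul_sum, Finset.sum_ite_eq', Finset.mem_univ, if_true, mul_one,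
    Finset.prod_mul_distrib]
  rw [← Finset.mul_sum, ← Fintype.prod_sum fun i b => M.P i i (y i) b]
  simp only [sum_P, Finset.prod_const_one, mul_one]

lemma sum_kernel_output (s : M.State) (x : Fin 2 → Bool) (s' : M.State) :
    ∑ y, M.kernel s x y s' =
      ∑ h, M.harvestProb x h * if s' = M.nextState s x h then 1 else 0 := by
  simp_rw [kernel_eq]
  rw [Finset.sum_comm]
  refine Finset.sum_congr rfl fun h _ => ?_
  rw [← Finset.sum_mul, ← Fintype.prod_sum fun i b =>
    M.P (other i) i (x (other i)) b * M.P i i b (h i)]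
  rfl

lemma transition_eq (p : Fin 2 → M.State → ℝ) (s' s : M.State) :
    M.transition p s' s = ∑ x : Fin 2 → Bool, (∏ i, bern (p i s) (x i)) *
      ∑ h, M.harvestProb x h * if s' = M.nextState s x h then 1 else 0 := by
  unfold transition
  refine Finset.sum_congr rfl fun x _ => ?_
  congr 1
  rw [Fintype.prod_sum]
  refine Finset.sum_congr rfl fun h _ => ?_
  rw [← prod_indicator_nextState, Finset.prod_mul_distrib]
  rfl

/-- Expectation of a function of the symbol of one sender and of what its receiver `j` gets. -/
lemma sum_bern_kernel_apply (p : Fin 2 → ℝ) (s : M.State) (j : Fin 2) (F : Bool → Bool → ℝ) :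
    ∑ x : Fin 2 → Bool, (∏ i, bern (p i) (x i)) *
      ∑ y : Fin 2 → Bool, ∑ s', M.kernel s x y s' * F (x (other j)) (y j) =
    ∑ x, bern (p (other j)) x * ∑ y, M.P (other j) j x y * F x y := by
  have h1 : ∀ x : Fin 2 → Bool, ∑ y : Fin 2 → Bool, ∑ s', M.kernel s x y s' * F (x (other j)) (y j)
      = ∑ y, M.P (other j) j (x (other j)) y * F (x (other j)) y := by
    intro x
    simp_rw [← Finset.sum_mul, sum_kernel_state]
    exact sum_prod_mul_apply (fun i b => M.P (other i) i (x (other i)) b) (fun i => M.sum_P _ _ _) j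
      (F (x (other j)))
  simp_rw [h1]
  exact sum_prod_mul_apply (fun i b => bern (p i) b) (fun i => sum_bern _) (other j)
    (fun b => ∑ y, M.P (other j) j b y * F b y)

end Model

namespace Model

/-! ### Transmission schemes and random tables -/

/-- A randomized scheme of length `n`. Besides the state of the buffers, both nodes know an
auxiliary variable with values in `V`. At time `k` Node `i` sends a 1 with probability
`ρ k s v i`; the next auxiliary variable has the law `κ k s v s'`, where `s'` is the next state of
the buffers, and is drawn from randomness that both nodes share. -/
structure Scheme (M : Model) (n : ℕ) (V : Type) [Fintype V] where
  ρ : Fin n → M.State → V → Fin 2 → ℝ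
  κ : Fin n → M.State → V → M.State → V → ℝ
  ρ_nonneg : ∀ k s v i, 0 ≤ ρ k s v i
  ρ_le_one : ∀ k s v i, ρ k s v i ≤ 1
  ρ_empty : ∀ k s v i, (s i : ℕ) = 0 → ρ k s v i = 0
  κ_nonneg : ∀ k s v s' v', 0 ≤ κ k s v s' v'
  sum_κ : ∀ k s v s', ∑ v', κ k s v s' v' = 1

variable {M : Model}

/-- Entries of the random tables for the codewords: a node with its message, the state of the
buffers and the auxiliary variable. -/
abbrev BitIndex (M : Model) (K : Fin 2 → ℕ) (V : Type) : Type :=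
  (Σ i, Fin (K i)) × M.State × V

/-- The randomness drawn at one channel use: a bit for every node, message and situation, and a
next value of the auxiliary variable for every situation. -/
abbrev Table (M : Model) (K : Fin 2 → ℕ) (V : Type) : Type :=
  (BitIndex M K V → Bool) × (M.State × V × M.State → V)

/-- The bit that Node `i` sends for the message `m`, read from a table. It is replaced by 0 if the
buffer is empty; this has an effect only on tables of probability zero. -/
def sentBit {K : Fin 2 → ℕ} {V : Type} (b : BitIndex M K V → Bool) (i : Fin 2) (m : Fin (K i))
    (s : M.State) (v : V) : Bool :=
  b (⟨i, m⟩, s, v) && decide ((s i : ℕ) ≠ 0)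

namespace Scheme

variable {n : ℕ} {V : Type} [Fintype V] (S : M.Scheme n V) (K : Fin 2 → ℕ)

/-- Probability that the receiver `j` gets `y`, given the situation but not the sent symbol. -/
def outProb (j : Fin 2) (k : Fin n) (s : M.State) (v : V) (y : Bool) : ℝ :=
  ∑ x, bern (S.ρ k s v (other j)) x * M.P (other j) j x y

/-- Likelihood ratio of the symbol `x` for the receiver `j` that got `y`. -/
def ratio (j : Fin 2) (k : Fin n) (s : M.State) (v : V) (x y : Bool) : ℝ :=
  M.P (other j) j x y / S.outProb j k s v y

lemma outProb_nonneg (j : Fin 2) (k : Fin n) (s : M.State) (v : V) (y : Bool) :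
    0 ≤ S.outProb j k s v y :=
  Finset.sum_nonneg fun _ _ => mul_nonneg (bern_nonneg (S.ρ_nonneg _ _ _ _) (S.ρ_le_one _ _ _ _) _)
    (M.P_nonneg _ _ _ _)

lemma ratio_nonneg (j : Fin 2) (k : Fin n) (s : M.State) (v : V) (x y : Bool) :
    0 ≤ S.ratio j k s v x y :=
  div_nonneg (M.P_nonneg _ _ _ _) (S.outProb_nonneg _ _ _ _ _)

lemma sum_bern_mul_ratio_le_one (j : Fin 2) (k : Fin n) (s : M.State) (v : V) (y : Bool) :
    ∑ x, bern (S.ρ k s v (other j)) x * S.ratio j k s v x y ≤ 1 := by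
  simp only [ratio, ← mul_div_assoc]
  rw [← Finset.sum_div]
  exact div_self_le_one _

lemma prod_bern_nonneg (k : Fin n) (s : M.State) (v : V) (x : Fin 2 → Bool) :
    0 ≤ ∏ i, bern (S.ρ k s v i) (x i) :=
  Finset.prod_nonneg fun _ _ => bern_nonneg (S.ρ_nonneg _ _ _ _) (S.ρ_le_one _ _ _ _) _

/-- Expectation of a function of the sent and received symbols, of the next state and of the next
auxiliary variable. -/
def stepMean (k : Fin n) (s : M.State) (v : V)
    (F : (Fin 2 → Bool) → (Fin 2 → Bool) → M.State → V → ℝ) : ℝ :=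
  ∑ x : Fin 2 → Bool, (∏ i, bern (S.ρ k s v i) (x i)) * ∑ y : Fin 2 → Bool, ∑ s',
    M.kernel s x y s' * ∑ v', S.κ k s v s' v' * F x y s' v'

/-- Probability of a table at time `k`; all its entries are independent. -/
def tableProb (k : Fin n) (T : Table M K V) : ℝ :=
  (∏ e, bern (S.ρ k e.2.1 e.2.2 e.1.1) (T.1 e)) * ∏ e, S.κ k e.1 e.2.1 e.2.2 (T.2 e)

lemma tableProb_nonneg (k : Fin n) (T : Table M K V) : 0 ≤ S.tableProb K k T :=
  mul_nonneg (Finset.prod_nonneg fun _ _ =>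
    bern_nonneg (S.ρ_nonneg _ _ _ _) (S.ρ_le_one _ _ _ _) _)
    (Finset.prod_nonneg fun _ _ => S.κ_nonneg _ _ _ _ _)

variable [DecidableEq V]

/-- Marginal law of finitely many entries for bits, seen through `sentBit`, and of one entry for
the auxiliary variable. -/
lemma sum_tableProb_mul {J : Type} [Fintype J] [DecidableEq J] (k : Fin n) (s : M.State) (v : V)
    (e : J → Σ i, Fin (K i)) (he : Function.Injective e) (s' : M.State)
    (F : (J → Bool) → V → ℝ) :
    ∑ T : Table M K V, S.tableProb K k T *
        F (fun j => sentBit T.1 (e j).1 (e j).2 s v) (T.2 (s, v, s')) =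
      ∑ x : J → Bool, (∏ j, bern (S.ρ k s v (e j).1) (x j)) * ∑ v', S.κ k s v s' v' * F x v' := by
  have hθ : ∀ G : V → ℝ, ∑ θ : M.State × V × M.State → V,
      (∏ e, S.κ k e.1 e.2.1 e.2.2 (θ e)) * G (θ (s, v, s')) = ∑ v', S.κ k s v s' v' * G v' := by
    intro G
    have h := sum_prod_mul_comp (fun e : M.State × V × M.State => S.κ k e.1 e.2.1 e.2.2)
      (fun e => S.sum_κ _ _ _ _) (fun _ : Fin 1 => (s, v, s'))
      (Function.injective_of_subsingleton _) (fun b => G (b 0))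
    rw [h, sum_fin_succ]
    simp
  have hmask : ∀ x : J → Bool, ∀ G : (J → Bool) → ℝ,
      (∏ j, bern (S.ρ k s v (e j).1) (x j)) * G (fun j => x j && decide ((s (e j).1 : ℕ) ≠ 0)) =
      (∏ j, bern (S.ρ k s v (e j).1) (x j)) * G x := by
    intro x G
    by_cases hx : ∃ j, x j = true ∧ (s (e j).1 : ℕ) = 0
    · obtain ⟨j, hj, hj0⟩ := hx
      have : ∏ j, bern (S.ρ k s v (e j).1) (x j) = 0 := by
        refine Finset.prod_eq_zero (Finset.mem_univ j) ?_
        rw [S.ρ_empty k s v _ hj0, hj]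
        simp [bern]
      rw [this, zero_mul, zero_mul]
    · push Not at hx
      congr 2
      funext j
      cases hxj : x j
      · simp
      · simpa using hx j hxj
  have hb := sum_prod_mul_comp (fun e : BitIndex M K V => bern (S.ρ k e.2.1 e.2.2 e.1.1))
    (fun e => sum_bern _) (fun j => ((e j, s, v) : BitIndex M K V))
    (fun a b hab => he (Prod.ext_iff.mp hab).1)
    (fun x => ∑ v', S.κ k s v s' v' * F (fun j => x j && decide ((s (e j).1 : ℕ) ≠ 0)) v')
  simp only at hb
  simp_rw [fun x => hmask x fun z => ∑ v', S.κ k s v s' v' * F z v'] at hb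
  rw [← hb, Fintype.sum_prod_type]
  refine Finset.sum_congr rfl fun b _ => ?_
  simp only [tableProb, mul_assoc]
  rw [← Finset.mul_sum, hθ]
  rfl

lemma sum_tableProb (k : Fin n) (s : M.State) (v : V) : ∑ T, S.tableProb K k T = 1 := by
  have h := S.sum_tableProb_mul K k s v (fun a : Fin 0 => a.elim0)
    (Function.injective_of_subsingleton _) s (fun _ _ => 1)
  simpa [S.sum_κ] using h

/-- Law of the symbols that are sent for a pair of messages. -/
lemma sum_tableProb_sent (k : Fin n) (s : M.State) (v : V) (m : ∀ i, Fin (K i)) (s' : M.State)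
    (F : (Fin 2 → Bool) → V → ℝ) :
    ∑ T : Table M K V, S.tableProb K k T *
        F (fun i => sentBit T.1 i (m i) s v) (T.2 (s, v, s')) =
      ∑ x : Fin 2 → Bool, (∏ i, bern (S.ρ k s v i) (x i)) * ∑ v', S.κ k s v s' v' * F x v' :=
  S.sum_tableProb_mul K k s v (fun i => ⟨i, m i⟩) (fun _ _ h => (Sigma.mk.inj_iff.mp h).1) s' F

/-- The bit of a message that was not sent is independent of the transmitted symbols. -/
lemma sum_tableProb_unsent (k : Fin n) (s : M.State) (v : V) (m : ∀ i, Fin (K i)) (i : Fin 2)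
    (m' : Fin (K i)) (hm : m' ≠ m i) (F : (Fin 2 → Bool) → Bool → ℝ) :
    ∑ T : Table M K V, S.tableProb K k T *
        F (fun i => sentBit T.1 i (m i) s v) (sentBit T.1 i m' s v) =
      ∑ x : Fin 2 → Bool, (∏ i, bern (S.ρ k s v i) (x i)) *
        ∑ x', bern (S.ρ k s v i) x' * F x x' := by
  let e : Fin 3 → Σ i, Fin (K i) := Fin.cons ⟨i, m'⟩ fun i => ⟨i, m i⟩
  have he : Function.Injective e := by
    refine Fin.cons_injective_iff.mpr ⟨?_, fun _ _ h => (Sigma.mk.inj_iff.mp h).1⟩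
    rintro ⟨j, hj⟩
    obtain ⟨rfl, h⟩ := Sigma.mk.inj_iff.mp hj
    exact hm (eq_of_heq h).symm
  have h := S.sum_tableProb_mul K k s v e he s (fun x _ => F (fun i => x i.succ) (x 0))
  refine Eq.trans h ?_
  rw [sum_fin_succ, Finset.sum_comm]
  refine Finset.sum_congr rfl fun x _ => ?_
  rw [Finset.mul_sum]
  refine Finset.sum_congr rfl fun x' _ => ?_
  rw [Fin.prod_univ_succ, ← Finset.sum_mul, S.sum_κ, one_mul]
  simp only [Fin.cons_zero, Fin.cons_succ, e]
  ring

/-! ### The joint chain of tables, channel outputs and states -/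

/-- The randomness of one channel use: the table, the received symbols and the next state. -/
abbrev Noise (M : Model) (K : Fin 2 → ℕ) (V : Type) : Type :=
  Table M K V × (Fin 2 → Bool) × M.State

instance : Fintype (Table M K V) := inferInstance

instance : Fintype (Noise M K V) := inferInstance

/-- Evolution of the situation. -/
def move {K : Fin 2 → ℕ} (_k : Fin n) (w : M.State × V) (a : Noise M K V) : M.State × V :=
  (a.2.2, a.1.2 (w.1, w.2, a.2.2))

/-- Probability of the randomness of one channel use, if the messages are `m`. -/
def noiseProb (m : ∀ i, Fin (K i)) (k : Fin n) (w : M.State × V) (a : Noise M K V) : ℝ :=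
  S.tableProb K k a.1 *
    M.kernel w.1 (fun i => sentBit a.1.1 i (m i) w.1 w.2) a.2.1 a.2.2

omit [DecidableEq V] in
lemma noiseProb_nonneg (m : ∀ i, Fin (K i)) (k : Fin n) (w : M.State × V) (a : Noise M K V) :
    0 ≤ S.noiseProb K m k w a :=
  mul_nonneg (S.tableProb_nonneg K _ _) (M.kernel_nonneg _ _ _ _)

lemma sum_noiseProb_mul (m : ∀ i, Fin (K i)) (k : Fin n) (w : M.State × V)
    (F : (Fin 2 → Bool) → (Fin 2 → Bool) → M.State → V → ℝ) :
    ∑ a, S.noiseProb K m k w a *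
        F (fun i => sentBit a.1.1 i (m i) w.1 w.2) a.2.1 a.2.2 (a.1.2 (w.1, w.2, a.2.2)) =
      S.stepMean k w.1 w.2 F := by
  have h1 : ∀ (y : Fin 2 → Bool) (s' : M.State), ∑ T : Table M K V, S.tableProb K k T *
      (M.kernel w.1 (fun i => sentBit T.1 i (m i) w.1 w.2) y s' *
        F (fun i => sentBit T.1 i (m i) w.1 w.2) y s' (T.2 (w.1, w.2, s'))) =
      ∑ x : Fin 2 → Bool, (∏ i, bern (S.ρ k w.1 w.2 i) (x i)) *
        (M.kernel w.1 x y s' * ∑ v', S.κ k w.1 w.2 s' v' * F x y s' v') := by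
    intro y s'
    rw [S.sum_tableProb_sent K k w.1 w.2 m s' (fun x v' => M.kernel w.1 x y s' * F x y s' v')]
    refine Finset.sum_congr rfl fun x _ => ?_
    rw [Finset.mul_sum (a := M.kernel w.1 x y s')]
    congr 1
    exact Finset.sum_congr rfl fun v' _ => by ring
  calc _ = ∑ T : Table M K V, ∑ y : Fin 2 → Bool, ∑ s', S.tableProb K k T *
      (M.kernel w.1 (fun i => sentBit T.1 i (m i) w.1 w.2) y s' *
        F (fun i => sentBit T.1 i (m i) w.1 w.2) y s' (T.2 (w.1, w.2, s'))) := by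
        rw [Fintype.sum_prod_type]
        refine Finset.sum_congr rfl fun T _ => ?_
        rw [Fintype.sum_prod_type]
        simp only [noiseProb, mul_assoc]
    _ = ∑ y : Fin 2 → Bool, ∑ s', ∑ x : Fin 2 → Bool, (∏ i, bern (S.ρ k w.1 w.2 i) (x i)) *
        (M.kernel w.1 x y s' * ∑ v', S.κ k w.1 w.2 s' v' * F x y s' v') := by
        rw [Finset.sum_comm]
        refine Finset.sum_congr rfl fun y _ => ?_
        rw [Finset.sum_comm]
        exact Finset.sum_congr rfl fun s' _ => h1 y s'
    _ = _ := by
        unfold stepMean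
        refine Eq.trans (Finset.sum_congr rfl fun y _ => Finset.sum_comm) ?_
        rw [Finset.sum_comm]
        refine Finset.sum_congr rfl fun x _ => ?_
        rw [Finset.mul_sum]
        exact Finset.sum_congr rfl fun y _ => by rw [Finset.mul_sum]

lemma sum_noiseProb (m : ∀ i, Fin (K i)) (k : Fin n) (w : M.State × V) :
    ∑ a, S.noiseProb K m k w a = 1 := by
  have h := S.sum_noiseProb_mul K m k w fun _ _ _ _ => 1
  simp only [mul_one] at h
  rw [h]
  simp only [stepMean, mul_one, S.sum_κ, sum_kernel_state]
  have : ∀ x : Fin 2 → Bool, ∑ y : Fin 2 → Bool, ∏ i, M.P (other i) i (x (other i)) (y i) = 1 := by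
    intro x
    rw [← Fintype.prod_sum fun i b => M.P (other i) i (x (other i)) b]
    simp only [sum_P, Finset.prod_const_one]
  simp only [this, mul_one, sum_prod_bern]

/-- A message that was not sent has likelihood ratio at most one on average. -/
lemma sum_noiseProb_mul_ratio_le_one (m : ∀ i, Fin (K i)) (j : Fin 2) (m' : Fin (K (other j)))
    (hm : m' ≠ m (other j)) (k : Fin n) (w : M.State × V) :
    ∑ a, S.noiseProb K m k w a *
      S.ratio j k w.1 w.2 (sentBit a.1.1 (other j) m' w.1 w.2) (a.2.1 j) ≤ 1 := by
  have hP : ∀ (x : Fin 2 → Bool) (y : Fin 2 → Bool),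
      0 ≤ ∏ i, M.P (other i) i (x (other i)) (y i) :=
    fun x y => Finset.prod_nonneg fun _ _ => M.P_nonneg _ _ _ _
  calc _ = ∑ T : Table M K V, S.tableProb K k T * ∑ y : Fin 2 → Bool,
        (∏ i, M.P (other i) i (sentBit T.1 (other i) (m (other i)) w.1 w.2) (y i)) *
          S.ratio j k w.1 w.2 (sentBit T.1 (other j) m' w.1 w.2) (y j) := by
        rw [Fintype.sum_prod_type]
        refine Finset.sum_congr rfl fun T _ => ?_
        rw [Fintype.sum_prod_type, Finset.mul_sum]
        refine Finset.sum_congr rfl fun y _ => ?_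
        simp only [noiseProb]
        rw [← Finset.sum_mul, ← Finset.mul_sum, sum_kernel_state, mul_assoc]
    _ = ∑ x : Fin 2 → Bool, (∏ i, bern (S.ρ k w.1 w.2 i) (x i)) *
        ∑ x', bern (S.ρ k w.1 w.2 (other j)) x' * ∑ y : Fin 2 → Bool,
          (∏ i, M.P (other i) i (x (other i)) (y i)) * S.ratio j k w.1 w.2 x' (y j) :=
        S.sum_tableProb_unsent K k w.1 w.2 m (other j) m' hm fun x x' => ∑ y : Fin 2 → Bool,
          (∏ i, M.P (other i) i (x (other i)) (y i)) * S.ratio j k w.1 w.2 x' (y j)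
    _ ≤ ∑ x : Fin 2 → Bool, (∏ i, bern (S.ρ k w.1 w.2 i) (x i)) * ∑ y : Fin 2 → Bool,
          (∏ i, M.P (other i) i (x (other i)) (y i)) * 1 := by
        refine Finset.sum_le_sum fun x _ => mul_le_mul_of_nonneg_left ?_ (S.prod_bern_nonneg _ _ _ _)
        simp only [Finset.mul_sum]
        rw [Finset.sum_comm]
        refine Finset.sum_le_sum fun y _ => ?_
        have := mul_le_mul_of_nonneg_left (S.sum_bern_mul_ratio_le_one j k w.1 w.2 (y j)) (hP x y)
        rw [Finset.mul_sum] at this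
        refine le_trans (le_of_eq (Finset.sum_congr rfl fun x' _ => ?_)) this
        ring
    _ = 1 := by
        have : ∀ x : Fin 2 → Bool,
            ∑ y : Fin 2 → Bool, ∏ i, M.P (other i) i (x (other i)) (y i) = 1 := by
          intro x
          rw [← Fintype.prod_sum fun i b => M.P (other i) i (x (other i)) b]
          simp only [sum_P, Finset.prod_const_one]
        simp only [this, mul_one, sum_prod_bern]

end Scheme
end Model

namespace Model
variable {M : Model}
namespace Scheme

/-! ### The code read from the tables -/

section RandomCode

variable {n : ℕ} {V : Type} {K : Fin 2 → ℕ}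

/-- The auxiliary variables, as a function of the states of the buffers. -/
def aux (t : Fin n → Table M K V) (v₀ : V) (s : Fin (n + 1) → M.State) : Fin (n + 1) → V :=
  Fin.induction v₀ fun k v => (t k).2 (s k.castSucc, v, s k.succ)

lemma aux_succ (t : Fin n → Table M K V) (v₀ : V) (s : Fin (n + 1) → M.State) (k : Fin n) :
    aux t v₀ s k.succ = (t k).2 (s k.castSucc, aux t v₀ s k.castSucc, s k.succ) := rfl

/-- The auxiliary variable depends on present and past states only. -/
lemma aux_congr (t : Fin n → Table M K V) (v₀ : V) {s s' : Fin (n + 1) → M.State}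
    (k : Fin (n + 1)) (h : ∀ j ≤ k, s j = s' j) : aux t v₀ s k = aux t v₀ s' k := by
  induction k using Fin.induction with
  | zero => rfl
  | succ k ih =>
    rw [aux_succ, aux_succ, ih fun j hj => h j (hj.trans k.castSucc_lt_succ.le), h _ le_rfl,
      h _ k.castSucc_lt_succ.le]

/-- Continuation of a sequence of states by a constant sequence. -/
def extend {k : ℕ} (s₀ : M.State) (s : Fin k → M.State) : Fin (n + 1) → M.State :=
  fun j => if h : (j : ℕ) < k then s ⟨j, h⟩ else s₀

variable [Fintype V] (S : M.Scheme n V)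

/-- Likelihood ratio of the message `m'` for the receiver `j` that got the sequence `y`. -/
def score (t : Fin n → Table M K V) (v₀ : V) (j : Fin 2) (y : Fin n → Bool)
    (s : Fin (n + 1) → M.State) (m' : Fin (K (other j))) : ℝ :=
  ∏ k, S.ratio j k (s k.castSucc) (aux t v₀ s k.castSucc)
    (sentBit (t k).1 (other j) m' (s k.castSucc) (aux t v₀ s k.castSucc)) (y k)

lemma score_nonneg (t : Fin n → Table M K V) (v₀ : V) (j : Fin 2) (y : Fin n → Bool)
    (s : Fin (n + 1) → M.State) (m' : Fin (K (other j))) : 0 ≤ S.score t v₀ j y s m' :=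
  Finset.prod_nonneg fun _ _ => S.ratio_nonneg _ _ _ _ _ _

lemma score_congr (t : Fin n → Table M K V) (v₀ : V) (j : Fin 2) (y : Fin n → Bool)
    {s s' : Fin (n + 1) → M.State} (h : ∀ k : Fin n, s k.castSucc = s' k.castSucc)
    (m' : Fin (K (other j))) : S.score t v₀ j y s m' = S.score t v₀ j y s' m' := by
  refine Finset.prod_congr rfl fun k _ => ?_
  have hk : ∀ j ≤ k.castSucc, s j = s' j := by
    intro j hj
    have hj' : (j : ℕ) < n := lt_of_le_of_lt (Fin.le_def.mp hj) k.isLt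
    exact h ⟨j, hj'⟩
  rw [aux_congr t v₀ k.castSucc hk, h k]

open Classical in
/-- The code given by a sequence of tables. The decoder looks for the only message whose
likelihood ratio reaches the threshold. -/
def code (s₀ : M.State) (v₀ : V) (hK : ∀ i, 0 < K i) (γ : Fin 2 → ℝ) (t : Fin n → Table M K V) :
    M.Code n K where
  enc i k m _ s := sentBit (t k).1 i m (s (Fin.last k)) (aux t v₀ (extend s₀ s) k.castSucc)
  enc_empty i k m y s h := by simp [sentBit, h]
  dec j y _ s := if h : ∃! m', γ j ≤ S.score t v₀ j y (extend s₀ s) m' then h.choose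
    else ⟨0, hK _⟩

lemma code_sent (s₀ : M.State) (v₀ : V) (hK : ∀ i, 0 < K i) (γ : Fin 2 → ℝ)
    (t : Fin n → Table M K V) (m : ∀ i, Fin (K i)) (y : Fin 2 → Fin n → Bool)
    (s : Fin (n + 1) → M.State) (k : Fin n) (i : Fin 2) :
    (S.code s₀ v₀ hK γ t).sent m y s k i =
      sentBit (t k).1 i (m i) (s k.castSucc) (aux t v₀ s k.castSucc) := by
  have h : aux t v₀ (extend s₀ (Fin.take (k + 1) (by omega) s)) k.castSucc =
      aux t v₀ s k.castSucc := by
    refine aux_congr t v₀ _ fun j hj => ?_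
    have hj' : (j : ℕ) < k + 1 := Nat.lt_succ_of_le (Fin.le_def.mp hj)
    simp only [extend, hj', dif_pos]
    rfl
  change sentBit (t k).1 i (m i) _ (aux t v₀ (extend s₀ (Fin.take (k + 1) _ s)) k.castSucc) = _
  rw [h]
  rfl

lemma exists_of_isError (s₀ : M.State) (v₀ : V) (hK : ∀ i, 0 < K i) (γ : Fin 2 → ℝ)
    (t : Fin n → Table M K V) (m : ∀ i, Fin (K i)) (y : Fin 2 → Fin n → Bool)
    (s : Fin (n + 1) → M.State) (h : (S.code s₀ v₀ hK γ t).IsError m y s) :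
    ∃ j, K (other j) ≠ 1 ∧ (S.score t v₀ j (y j) s (m (other j)) < γ j ∨
      ∃ m', m' ≠ m (other j) ∧ γ j ≤ S.score t v₀ j (y j) s m') := by
  classical
  obtain ⟨j, hj⟩ := h
  refine ⟨j, fun hK1 => ?_, ?_⟩
  · have : Subsingleton (Fin (K (other j))) := by rw [hK1]; infer_instance
    exact hj (Subsingleton.elim _ _)
  by_contra hcon
  push Not at hcon
  have hs : ∀ k : Fin n, (extend s₀ (fun k : Fin n => s k.castSucc) : Fin (n + 1) → M.State)
      k.castSucc = s k.castSucc := by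
    intro k
    simp [extend]
  have hu : ∃! m', γ j ≤ S.score t v₀ j (y j) (extend s₀ fun k : Fin n => s k.castSucc) m' := by
    simp_rw [S.score_congr t v₀ j (y j) hs]
    refine ⟨m (other j), hcon.1, fun m' hm' => ?_⟩
    by_contra hne
    exact absurd hm' (not_le.mpr (hcon.2 m' hne))
  apply hj
  change (if h : ∃! m', γ j ≤ S.score t v₀ j (y j) (extend s₀ fun k : Fin n => s k.castSucc) m'
    then h.choose else ⟨0, hK _⟩) = _
  rw [dif_pos hu]
  by_contra hne
  have : γ j ≤ S.score t v₀ j (y j) (extend s₀ fun k : Fin n => s k.castSucc) hu.choose :=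
    hu.choose_spec.1
  rw [S.score_congr t v₀ j (y j) hs] at this
  exact absurd this (not_le.mpr (hcon.2 _ hne))

/-- Upper bound for the indicator of the event that the receiver `j` fails. -/
def failBound (γ : Fin 2 → ℝ) (t : Fin n → Table M K V) (v₀ : V) (m : ∀ i, Fin (K i)) (j : Fin 2)
    (y : Fin n → Bool) (s : Fin (n + 1) → M.State) : ℝ :=
  if K (other j) = 1 then 0 else
    (if S.score t v₀ j y s (m (other j)) < γ j then 1 else 0) +
      ∑ m' ∈ Finset.univ.erase (m (other j)), S.score t v₀ j y s m' / γ j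

open Classical in
lemma indicator_isError_le (s₀ : M.State) (v₀ : V) (hK : ∀ i, 0 < K i) (γ : Fin 2 → ℝ)
    (hγ : ∀ j, 0 < γ j) (t : Fin n → Table M K V) (m : ∀ i, Fin (K i))
    (y : Fin 2 → Fin n → Bool) (s : Fin (n + 1) → M.State) :
    (if (S.code s₀ v₀ hK γ t).IsError m y s then (1 : ℝ) else 0) ≤
      ∑ j, S.failBound γ t v₀ m j (y j) s := by
  have hsum : ∀ j, 0 ≤ ∑ m' ∈ Finset.univ.erase (m (other j)),
      S.score t v₀ j (y j) s m' / γ j := fun j =>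
    Finset.sum_nonneg fun m' _ => div_nonneg (S.score_nonneg _ _ _ _ _ _) (hγ j).le
  have h0 : ∀ j, 0 ≤ S.failBound γ t v₀ m j (y j) s := by
    intro j
    unfold failBound
    split_ifs
    · exact le_rfl
    · exact add_nonneg zero_le_one (hsum j)
    · exact add_nonneg le_rfl (hsum j)
  split_ifs with h
  · obtain ⟨j, hj1, hj⟩ := S.exists_of_isError s₀ v₀ hK γ t m y s h
    refine le_trans ?_ (Finset.single_le_sum (fun i _ => h0 i) (Finset.mem_univ j))
    unfold failBound
    rw [if_neg hj1]
    rcases hj with hj | ⟨m', hm', hj⟩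
    · rw [if_pos hj]
      linarith [hsum j]
    · have h1 : 1 ≤ S.score t v₀ j (y j) s m' / γ j := (one_le_div (hγ j)).mpr hj
      have h2 := Finset.single_le_sum
        (fun m'' _ => div_nonneg (S.score_nonneg t v₀ j (y j) s m'') (hγ j).le)
        (Finset.mem_erase.mpr ⟨hm', Finset.mem_univ m'⟩)
      have h3 : (0 : ℝ) ≤ if S.score t v₀ j (y j) s (m (other j)) < γ j then 1 else 0 := by
        split_ifs <;> norm_num
      linarith
  · exact Finset.sum_nonneg fun j _ => h0 j

/-- A path of the joint chain is a sequence of tables together with the received symbols and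
the states; the initial state is fixed. -/
lemma sum_pathProb [DecidableEq V] (s₀ : M.State) (v₀ : V) (hK : ∀ i, 0 < K i) (γ : Fin 2 → ℝ)
    (m : ∀ i, Fin (K i))
    (F : (Fin n → Table M K V) → (Fin 2 → Fin n → Bool) → (Fin (n + 1) → M.State) → ℝ) :
    ∑ t : Fin n → Table M K V, (∏ k, S.tableProb K k (t k)) *
      ∑ y : Fin 2 → Fin n → Bool, ∑ s : Fin (n + 1) → M.State,
        (S.code s₀ v₀ hK γ t).pathProb s₀ m y s * F t y s =
    ∑ a : Fin n → Noise M K V, pathWeight move (S.noiseProb K m) (s₀, v₀) a *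
      F (fun k => (a k).1) (fun i k => (a k).2.1 i) (fun k => (traj move (s₀, v₀) a k).1) := by
  have hs : ∀ G : (Fin (n + 1) → M.State) → ℝ, (∀ s, s 0 ≠ s₀ → G s = 0) →
      ∑ s, G s = ∑ s' : Fin n → M.State, G (Fin.cons s₀ s') := by
    intro G hG
    rw [sum_fin_succ, Finset.sum_eq_single s₀]
    · intro b _ hb
      exact Finset.sum_eq_zero fun s' _ => hG _ (by simpa using hb)
    · simp
  have htr : ∀ (a : Fin n → Noise M K V) (k : Fin (n + 1)), traj move (s₀, v₀) a k =
      ((Fin.cons s₀ (fun k => (a k).2.2) : Fin (n + 1) → M.State) k,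
        aux (fun k => (a k).1) v₀ (Fin.cons s₀ fun k => (a k).2.2) k) := by
    intro a k
    induction k using Fin.induction with
    | zero => rfl
    | succ k ih =>
      rw [traj_succ, ih, aux_succ]
      simp only [move, Fin.cons_succ]
  have step : ∀ t : Fin n → Table M K V, (∏ k, S.tableProb K k (t k)) *
      ∑ y : Fin 2 → Fin n → Bool, ∑ s : Fin (n + 1) → M.State,
        (S.code s₀ v₀ hK γ t).pathProb s₀ m y s * F t y s =
      ∑ b : Fin n → (Fin 2 → Bool) × M.State,
        pathWeight move (S.noiseProb K m) (s₀, v₀) (fun k => (t k, b k)) *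
        F t (fun i k => (b k).1 i)
          (fun k => (traj move (s₀, v₀) (fun k => ((t k, b k) : Noise M K V)) k).1) := by
    intro t
    let E : (Fin n → (Fin 2 → Bool) × M.State) ≃ (Fin 2 → Fin n → Bool) × (Fin n → M.State) :=
      (Equiv.arrowProdEquivProdArrow (Fin n) _ _).trans
        (Equiv.prodCongr (Equiv.piComm _) (Equiv.refl _))
    have h1 : ∀ y : Fin 2 → Fin n → Bool, ∑ s : Fin (n + 1) → M.State,
        (S.code s₀ v₀ hK γ t).pathProb s₀ m y s * F t y s =
        ∑ s' : Fin n → M.State, (S.code s₀ v₀ hK γ t).pathProb s₀ m y (Fin.cons s₀ s') *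
          F t y (Fin.cons s₀ s') :=
      fun y => hs _ fun s h => by simp [Code.pathProb, h]
    simp_rw [h1]
    rw [← Fintype.sum_prod_type', ← E.sum_comp, Finset.mul_sum]
    refine Finset.sum_congr rfl fun b _ => ?_
    rw [← mul_assoc]
    have hE : (E b).2 = fun k => (b k).2 := rfl
    have hE1 : (E b).1 = fun i k => (b k).1 i := rfl
    simp only [hE, hE1, htr]
    congr 1
    simp only [Code.pathProb, Fin.cons_zero, if_true, one_mul, pathWeight, noiseProb]
    rw [← Finset.prod_mul_distrib]
    refine Finset.prod_congr rfl fun k _ => ?_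
    rw [htr]
    congr 1
    have hc : (S.code s₀ v₀ hK γ t).sent m (fun i k => (b k).1 i)
        (Fin.cons s₀ fun k => (b k).2) k = _ := funext fun i => S.code_sent s₀ v₀ hK γ t m _ _ k i
    rw [hc, Fin.cons_succ]
  simp_rw [step]
  rw [← Fintype.sum_prod_type', ← (Equiv.arrowProdEquivProdArrow (Fin n) _ _).sum_comp]
  rfl

end RandomCode

end Scheme
end Model

lemma sum_sub_telescope {n : ℕ} (g : Fin (n + 1) → ℝ) :
    ∑ k : Fin n, (g k.succ - g k.castSucc) = g (Fin.last n) - g 0 := by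
  have h1 := Fin.sum_univ_succ g
  have h2 := Fin.sum_univ_castSucc g
  rw [Finset.sum_sub_distrib]
  linarith

namespace Model
variable {M : Model}
namespace Scheme

/-! ### Average probability of error -/

section Average

variable {n : ℕ} {V : Type} {K : Fin 2 → ℕ}

lemma aux_traj (a : Fin n → Noise M K V) (s₀ : M.State) (v₀ : V) (k : Fin (n + 1)) :
    aux (fun k => (a k).1) v₀ (fun k => (traj move (s₀, v₀) a k).1) k =
      (traj move (s₀, v₀) a k).2 := by
  induction k using Fin.induction with
  | zero => rfl
  | succ k ih => rw [aux_succ, ih]; rfl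

variable [Fintype V] [DecidableEq V] (S : M.Scheme n V)

omit [DecidableEq V] in
lemma score_traj (a : Fin n → Noise M K V) (s₀ : M.State) (v₀ : V) (j : Fin 2)
    (m' : Fin (K (other j))) :
    S.score (fun k => (a k).1) v₀ j (fun k => (a k).2.1 j) (fun k => (traj move (s₀, v₀) a k).1) m' =
      ∏ k, S.ratio j k (traj move (s₀, v₀) a k.castSucc).1 (traj move (s₀, v₀) a k.castSucc).2
        (sentBit (a k).1.1 (other j) m' (traj move (s₀, v₀) a k.castSucc).1
          (traj move (s₀, v₀) a k.castSucc).2) ((a k).2.1 j) := by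
  unfold score
  simp_rw [aux_traj]

/-- A message that was not sent rarely has a large likelihood ratio, by Markov's inequality. -/
lemma sum_pathWeight_mul_score_le_one (m : ∀ i, Fin (K i)) (s₀ : M.State) (v₀ : V) (j : Fin 2)
    (m' : Fin (K (other j))) (hm : m' ≠ m (other j)) :
    ∑ a : Fin n → Noise M K V, pathWeight move (S.noiseProb K m) (s₀, v₀) a *
      S.score (fun k => (a k).1) v₀ j (fun k => (a k).2.1 j)
        (fun k => (traj move (s₀, v₀) a k).1) m' ≤ 1 := by
  have h := sum_pathWeight_le_one (move (n := n) (M := M) (K := K) (V := V))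
    (fun k w a => S.noiseProb K m k w a *
      S.ratio j k w.1 w.2 (sentBit a.1.1 (other j) m' w.1 w.2) (a.2.1 j))
    (fun k w a => mul_nonneg (S.noiseProb_nonneg K m k w a) (S.ratio_nonneg _ _ _ _ _ _))
    (fun k w => S.sum_noiseProb_mul_ratio_le_one K m j m' hm k w) (s₀, v₀)
  refine le_trans (le_of_eq (Finset.sum_congr rfl fun a _ => ?_)) h
  rw [score_traj]
  unfold pathWeight
  rw [← Finset.prod_mul_distrib]

omit [DecidableEq V] in
/-- Positive probability of a table and of the channel outputs, in terms of one-step laws. -/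
lemma pos_of_noiseProb_pos (m : ∀ i, Fin (K i)) (k : Fin n) (w : M.State × V) (a : Noise M K V)
    (h : 0 < S.noiseProb K m k w a) :
    0 < (∏ i, bern (S.ρ k w.1 w.2 i) (sentBit a.1.1 i (m i) w.1 w.2)) ∧
    0 < M.kernel w.1 (fun i => sentBit a.1.1 i (m i) w.1 w.2) a.2.1 a.2.2 ∧
    0 < S.κ k w.1 w.2 a.2.2 (a.1.2 (w.1, w.2, a.2.2)) := by
  have hT : S.tableProb K k a.1 ≠ 0 := left_ne_zero_of_mul h.ne'
  have hk : M.kernel w.1 (fun i => sentBit a.1.1 i (m i) w.1 w.2) a.2.1 a.2.2 ≠ 0 :=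
    right_ne_zero_of_mul h.ne'
  have hb := Finset.prod_ne_zero_iff.mp (left_ne_zero_of_mul hT)
  have hκ := Finset.prod_ne_zero_iff.mp (right_ne_zero_of_mul hT)
  refine ⟨lt_of_le_of_ne (S.prod_bern_nonneg k w.1 w.2 _) (Finset.prod_ne_zero_iff.mpr ?_).symm,
    lt_of_le_of_ne (M.kernel_nonneg _ _ _ _) hk.symm,
    lt_of_le_of_ne (S.κ_nonneg _ _ _ _ _) (hκ (w.1, w.2, a.2.2) (Finset.mem_univ _)).symm⟩
  intro i _
  by_cases h0 : (w.1 i : ℕ) = 0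
  · rw [S.ρ_empty k w.1 w.2 i h0]
    simp [sentBit, h0, bern]
  · have := hb (⟨i, m i⟩, w.1, w.2) (Finset.mem_univ _)
    simpa [sentBit, h0] using this

omit [DecidableEq V] in
lemma ratio_pos_of_noiseProb_pos (m : ∀ i, Fin (K i)) (k : Fin n) (w : M.State × V)
    (a : Noise M K V) (h : 0 < S.noiseProb K m k w a) (j : Fin 2) :
    0 < S.ratio j k w.1 w.2 (sentBit a.1.1 (other j) (m (other j)) w.1 w.2) (a.2.1 j) := by
  obtain ⟨hb, hk, -⟩ := S.pos_of_noiseProb_pos m k w a h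
  have hP : 0 < M.P (other j) j (sentBit a.1.1 (other j) (m (other j)) w.1 w.2) (a.2.1 j) := by
    refine lt_of_le_of_ne (M.P_nonneg _ _ _ _) fun h0 => hk.ne' ?_
    exact Finset.prod_eq_zero (Finset.mem_univ j) (by rw [← h0, zero_mul])
  have hb' : 0 < bern (S.ρ k w.1 w.2 (other j))
      (sentBit a.1.1 (other j) (m (other j)) w.1 w.2) := by
    refine lt_of_le_of_ne (bern_nonneg (S.ρ_nonneg _ _ _ _) (S.ρ_le_one _ _ _ _) _) fun h0 => hb.ne' ?_
    exact Finset.prod_eq_zero (Finset.mem_univ (other j)) h0.symm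
  refine div_pos hP (lt_of_lt_of_le (mul_pos hb' hP) ?_)
  exact Finset.single_le_sum (f := fun x => bern (S.ρ k w.1 w.2 (other j)) x *
    M.P (other j) j x (a.2.1 j)) (fun x _ => mul_nonneg
      (bern_nonneg (S.ρ_nonneg _ _ _ _) (S.ρ_le_one _ _ _ _) _) (M.P_nonneg _ _ _ _))
    (Finset.mem_univ _)

variable (Inv : Fin (n + 1) → M.State → V → Prop) (Φ : Fin 2 → M.State → V → ℝ)
  (c : Fin 2 → Fin n → ℝ) (C : ℝ)

/-- A scheme whose log-likelihood ratios have, up to a potential `Φ`, conditional means at least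
`c` at the situations that can occur. -/
structure HasDrift : Prop where
  step : ∀ k s v x y s' v', Inv k.castSucc s v → 0 < ∏ i, bern (S.ρ k s v i) (x i) →
    0 < M.kernel s x y s' → 0 < S.κ k s v s' v' → Inv k.succ s' v'
  drift : ∀ j k s v, Inv k.castSucc s v → c j k ≤ S.stepMean k s v fun x y s' v' =>
    Real.logb 2 (S.ratio j k s v (x (other j)) (y j)) + Φ j s' v' - Φ j s v
  ratio_le : ∀ j k s v x y, |Real.logb 2 (S.ratio j k s v x y)| ≤ C
  potential_le : ∀ j s v, |Φ j s v| ≤ C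
  rate_le : ∀ j k, |c j k| ≤ C

variable {S Inv Φ c C}

/-- The message that was sent passes the threshold with high probability, by Chebyshev's
inequality. -/
lemma HasDrift.sum_pathWeight_mul_indicator_le (hS : S.HasDrift Inv Φ c C) (m : ∀ i, Fin (K i))
    (s₀ : M.State) (v₀ : V) (h0 : Inv 0 s₀ v₀) (j : Fin 2) {γ t : ℝ} (ht : 0 < t)
    (hγt : Real.logb 2 γ + 2 * C + t ≤ ∑ k, c j k) :
    ∑ a : Fin n → Noise M K V, pathWeight move (S.noiseProb K m) (s₀, v₀) a *
      (if S.score (fun k => (a k).1) v₀ j (fun k => (a k).2.1 j)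
        (fun k => (traj move (s₀, v₀) a k).1) (m (other j)) < γ then 1 else 0) ≤
      n * (4 * C) ^ 2 / t ^ 2 := by
  let lr : Fin n → M.State × V → Noise M K V → ℝ := fun k w a =>
    S.ratio j k w.1 w.2 (sentBit a.1.1 (other j) (m (other j)) w.1 w.2) (a.2.1 j)
  let D : Fin n → M.State × V → Noise M K V → ℝ := fun k w a =>
    c j k - (Real.logb 2 (lr k w a) + Φ j (move k w a).1 (move k w a).2 - Φ j w.1 w.2)
  have hDC : ∀ k w a, |D k w a| ≤ 4 * C := by
    intro k w a
    have h1 := abs_le.mp (hS.ratio_le j k w.1 w.2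
      (sentBit a.1.1 (other j) (m (other j)) w.1 w.2) (a.2.1 j))
    have h2 := abs_le.mp (hS.potential_le j w.1 w.2)
    have h3 := abs_le.mp (hS.potential_le j (move k w a).1 (move k w a).2)
    have h4 := abs_le.mp (hS.rate_le j k)
    simp only [D, lr]
    rw [abs_le]
    constructor <;> linarith [h1.1, h1.2, h2.1, h2.2, h3.1, h3.2, h4.1, h4.2]
  have hDm : ∀ (k : Fin n) (w : M.State × V), Inv k.castSucc w.1 w.2 →
      ∑ a, S.noiseProb K m k w a * D k w a ≤ 0 := by
    intro k w hw
    have h1 := S.sum_noiseProb_mul K m k w fun x y s' v' =>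
      Real.logb 2 (S.ratio j k w.1 w.2 (x (other j)) (y j)) + Φ j s' v' - Φ j w.1 w.2
    have h2 := hS.drift j k w.1 w.2 hw
    rw [← h1] at h2
    simp only [D, mul_sub (S.noiseProb K m k w _) (c j k)]
    rw [Finset.sum_sub_distrib, ← Finset.sum_mul, S.sum_noiseProb, one_mul]
    exact sub_nonpos.mpr h2
  have key := sum_pathWeight_mul_sq_le (move (n := n) (M := M) (K := K) (V := V))
    (S.noiseProb K m) (S.noiseProb_nonneg K m) (fun k w => (S.sum_noiseProb K m k w).le)
    (fun k w => Inv k w.1 w.2)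
    (fun k w a hw ha => by
      obtain ⟨hb, hk, hκ⟩ := S.pos_of_noiseProb_pos m k w a ha
      exact hS.step k w.1 w.2 _ _ _ _ hw hb hk hκ) D (4 * C) hDC hDm (s₀, v₀) h0 0
  rw [max_self, zero_pow two_ne_zero, zero_add] at key
  rw [le_div_iff₀ (by positivity), Finset.sum_mul]
  refine le_trans (Finset.sum_le_sum fun a _ => ?_) key
  rw [mul_assoc]
  rcases (pathWeight_nonneg move (S.noiseProb K m) (S.noiseProb_nonneg K m) (s₀, v₀) a).eq_or_lt
    with hp | hp
  · rw [← hp, zero_mul, zero_mul]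
  refine mul_le_mul_of_nonneg_left ?_ hp.le
  split_ifs with hsc
  swap
  · rw [zero_mul]; positivity
  rw [one_mul, zero_add]
  have hfac : ∀ k, 0 < S.noiseProb K m k (traj move (s₀, v₀) a k.castSucc) (a k) := fun k =>
    lt_of_le_of_ne (S.noiseProb_nonneg K m _ _ _)
      (Finset.prod_ne_zero_iff.mp hp.ne' k (Finset.mem_univ k)).symm
  have hlr : ∀ k, 0 < lr k (traj move (s₀, v₀) a k.castSucc) (a k) := fun k =>
    S.ratio_pos_of_noiseProb_pos m k _ _ (hfac k) j
  rw [score_traj] at hsc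
  have hlog : ∑ k, Real.logb 2 (lr k (traj move (s₀, v₀) a k.castSucc) (a k)) < Real.logb 2 γ := by
    have h1 := Real.logb_lt_logb one_lt_two (Finset.prod_pos fun k _ => hlr k) hsc
    rwa [Real.logb_prod _ _ fun k _ => (hlr k).ne'] at h1
  have htel := sum_sub_telescope fun k => Φ j (traj move (s₀, v₀) a k).1 (traj move (s₀, v₀) a k).2
  have hsumD : ∑ k, D k (traj move (s₀, v₀) a k.castSucc) (a k) = ∑ k, c j k -
      ∑ k, Real.logb 2 (lr k (traj move (s₀, v₀) a k.castSucc) (a k)) -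
      (Φ j (traj move (s₀, v₀) a (Fin.last n)).1 (traj move (s₀, v₀) a (Fin.last n)).2 -
        Φ j s₀ v₀) := by
    simp only [D, Finset.sum_sub_distrib, Finset.sum_add_distrib]
    simp only [Finset.sum_sub_distrib, traj_succ, traj_zero] at htel
    linarith
  have hΦ1 := abs_le.mp (hS.potential_le j s₀ v₀)
  have hΦ2 := abs_le.mp (hS.potential_le j (traj move (s₀, v₀) a (Fin.last n)).1
    (traj move (s₀, v₀) a (Fin.last n)).2)
  have hge : t ≤ ∑ k, D k (traj move (s₀, v₀) a k.castSucc) (a k) := by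
    rw [hsumD]
    linarith [hΦ1.1, hΦ2.2]
  exact pow_le_pow_left₀ ht.le (hge.trans (le_max_right _ _)) 2

/-- Some sequence of tables is at least as good as the average over all of them. -/
theorem HasDrift.exists_code (hS : S.HasDrift Inv Φ c C) (s₀ : M.State) (v₀ : V)
    (h0 : Inv 0 s₀ v₀) (hK : ∀ i, 0 < K i) (γ t : Fin 2 → ℝ) (hγ : ∀ j, 0 < γ j)
    (ht : ∀ j, 0 < t j)
    (hγt : ∀ j, K (other j) ≠ 1 → Real.logb 2 (γ j) + 2 * C + t j ≤ ∑ k, c j k) :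
    ∃ code : M.Code n K, code.errorProb s₀ ≤
      ∑ j, if K (other j) = 1 then 0 else n * (4 * C) ^ 2 / t j ^ 2 + K (other j) / γ j := by
  set B : ℝ := ∑ j, if K (other j) = 1 then 0 else
    n * (4 * C) ^ 2 / t j ^ 2 + K (other j) / γ j with hB
  have hm : ∀ m : ∀ i, Fin (K i), ∑ T : Fin n → Table M K V, (∏ k, S.tableProb K k (T k)) *
      ∑ y : Fin 2 → Fin n → Bool, ∑ s : Fin (n + 1) → M.State,
        (S.code s₀ v₀ hK γ T).pathProb s₀ m y s *
          ∑ j, S.failBound γ T v₀ m j (y j) s ≤ B := by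
    intro m
    rw [S.sum_pathProb s₀ v₀ hK γ m fun T y s => ∑ j, S.failBound γ T v₀ m j (y j) s]
    simp_rw [Finset.mul_sum]
    rw [Finset.sum_comm]
    refine Finset.sum_le_sum fun j _ => ?_
    unfold failBound
    split_ifs with hj
    · simp
    simp_rw [mul_add]
    rw [Finset.sum_add_distrib]
    refine add_le_add (hS.sum_pathWeight_mul_indicator_le m s₀ v₀ h0 j (ht j) (hγt j hj)) ?_
    simp_rw [Finset.mul_sum]
    rw [Finset.sum_comm]
    have hone : ∀ m' ∈ Finset.univ.erase (m (other j)),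
        ∑ a : Fin n → Noise M K V, pathWeight move (S.noiseProb K m) (s₀, v₀) a *
          (S.score (fun k => (a k).1) v₀ j (fun k => (a k).2.1 j)
            (fun k => (traj move (s₀, v₀) a k).1) m' / γ j) ≤ 1 / γ j := by
      intro m' hm'
      simp_rw [← mul_div_assoc]
      rw [← Finset.sum_div]
      exact div_le_div_of_nonneg_right (S.sum_pathWeight_mul_score_le_one m s₀ v₀ j m'
        (Finset.ne_of_mem_erase hm')) (hγ j).le
    refine le_trans (Finset.sum_le_card_nsmul _ _ _ hone) ?_
    rw [nsmul_eq_mul, mul_one_div]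
    refine div_le_div_of_nonneg_right ?_ (hγ j).le
    exact_mod_cast (Finset.card_le_univ _).trans (by simp)
  have hpos : 0 < ∏ i, (K i : ℝ) := Finset.prod_pos fun i _ => Nat.cast_pos.mpr (hK i)
  have havg : ∑ T : Fin n → Table M K V, (∏ k, S.tableProb K k (T k)) *
      (S.code s₀ v₀ hK γ T).errorProb s₀ ≤ B := by
    have h1 : ∀ T : Fin n → Table M K V, (∏ k, S.tableProb K k (T k)) *
        (S.code s₀ v₀ hK γ T).errorProb s₀ ≤
        (∑ m : ∀ i, Fin (K i), (∏ k, S.tableProb K k (T k)) *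
          ∑ y : Fin 2 → Fin n → Bool, ∑ s : Fin (n + 1) → M.State,
            (S.code s₀ v₀ hK γ T).pathProb s₀ m y s *
              ∑ j, S.failBound γ T v₀ m j (y j) s) / ∏ i, (K i : ℝ) := by
      intro T
      unfold Code.errorProb
      rw [← mul_div_assoc, ← Finset.mul_sum]
      refine div_le_div_of_nonneg_right (mul_le_mul_of_nonneg_left ?_
        (Finset.prod_nonneg fun k _ => S.tableProb_nonneg K _ _)) hpos.le
      refine Finset.sum_le_sum fun m _ => Finset.sum_le_sum fun y _ => Finset.sum_le_sum fun s _ =>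
        mul_le_mul_of_nonneg_left (S.indicator_isError_le s₀ v₀ hK γ hγ T m y s) ?_
      refine mul_nonneg (by split_ifs <;> norm_num)
        (Finset.prod_nonneg fun k _ => M.kernel_nonneg _ _ _ _)
    refine le_trans (Finset.sum_le_sum fun T _ => h1 T) ?_
    rw [← Finset.sum_div, Finset.sum_comm, div_le_iff₀ hpos]
    refine le_trans (Finset.sum_le_card_nsmul _ _ B fun m _ => hm m) ?_
    rw [nsmul_eq_mul, mul_comm]
    simp
  have hone : ∑ T : Fin n → Table M K V, ∏ k, S.tableProb K k (T k) = 1 := by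
    rw [← Fintype.prod_sum fun k T => S.tableProb K k T]
    exact Finset.prod_eq_one fun k _ => S.sum_tableProb K k s₀ v₀
  by_contra hcon
  push Not at hcon
  have hex : ∃ T : Fin n → Table M K V, (∏ k, S.tableProb K k (T k)) ≠ 0 := by
    by_contra hz
    push Not at hz
    simp [hz] at hone
  have : B < ∑ T : Fin n → Table M K V, (∏ k, S.tableProb K k (T k)) *
      (S.code s₀ v₀ hK γ T).errorProb s₀ := by
    rw [← one_mul B, ← hone, Finset.sum_mul]
    have hnn : ∀ T : Fin n → Table M K V, 0 ≤ ∏ k, S.tableProb K k (T k) := fun T =>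
      Finset.prod_nonneg fun k _ => S.tableProb_nonneg K _ _
    obtain ⟨T₀, hT₀⟩ := hex
    refine Finset.sum_lt_sum (fun T _ => mul_le_mul_of_nonneg_left (hcon _).le (hnn T))
      ⟨T₀, Finset.mem_univ _, ?_⟩
    exact mul_lt_mul_of_pos_left (hcon _) (lt_of_le_of_ne (hnn T₀) hT₀.symm)
  linarith

end Average

end Scheme
end Model

namespace Model
variable {M : Model}

/-! ### Achievable rates from schemes -/

/-- Rates below the mean drifts of schemes of all large lengths, with common bounds, are
achievable. A node of rate 0 has a single message, and its drift does not matter. -/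
theorem achievable_of_hasDrift {V : Type} [Fintype V] [DecidableEq V] (s₀ : M.State)
    (R : Fin 2 → ℝ) (hR : ∀ i, 0 ≤ R i) {C δ : ℝ} (hδ : 0 < δ)
    (h : ∃ N : ℕ, ∀ n, N ≤ n → ∃ (S : M.Scheme n V) (Inv : Fin (n + 1) → M.State → V → Prop)
      (Φ : Fin 2 → M.State → V → ℝ) (c : Fin 2 → Fin n → ℝ) (v₀ : V),
      S.HasDrift Inv Φ c C ∧ Inv 0 s₀ v₀ ∧
        ∀ j, R (other j) = 0 ∨ n * (R (other j) + 2 * δ) ≤ ∑ k, c j k) :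
    M.Achievable s₀ R := by
  refine ⟨hR, fun ε hε => ?_⟩
  obtain ⟨N, hN⟩ := h
  have hlim : Tendsto (fun n : ℕ => 2 * (64 * C ^ 2 / δ ^ 2 * (1 / (n : ℝ)) +
      2 * ((2 : ℝ) ^ (-δ)) ^ n)) atTop (𝓝 (2 * (64 * C ^ 2 / δ ^ 2 * 0 + 2 * 0))) := by
    refine ((tendsto_one_div_atTop_nhds_zero_nat.const_mul _).add
      ((tendsto_pow_atTop_nhds_zero_of_lt_one (by positivity) ?_).const_mul 2)).const_mul 2
    exact Real.rpow_lt_one_of_one_lt_of_neg one_lt_two (by linarith)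
  simp only [mul_zero, add_zero] at hlim
  obtain ⟨N₁, hN₁⟩ := eventually_atTop.mp (hlim.eventually (gt_mem_nhds hε))
  obtain ⟨N₂, hN₂⟩ := exists_nat_ge (4 * C / δ)
  refine ⟨max (max N N₁) (max N₂ 1), fun n hn => ?_⟩
  have hnN : N ≤ n := le_trans (le_trans (le_max_left _ _) (le_max_left _ _)) hn
  have hnN₁ : N₁ ≤ n := le_trans (le_trans (le_max_right _ _) (le_max_left _ _)) hn
  have hnN₂ : N₂ ≤ n := le_trans (le_trans (le_max_left _ _) (le_max_right _ _)) hn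
  have hn1 : 1 ≤ n := le_trans (le_trans (le_max_right _ _) (le_max_right _ _)) hn
  have hn0 : (0 : ℝ) < n := by exact_mod_cast hn1
  obtain ⟨S, Inv, Φ, c, v₀, hS, hInv, hc⟩ := hN n hnN
  have hnC : 4 * C ≤ n * δ := by
    have : 4 * C / δ ≤ n := hN₂.trans (by exact_mod_cast hnN₂)
    rwa [div_le_iff₀ hδ] at this
  have hK : ∀ i, 0 < ⌈(2 : ℝ) ^ ((n : ℝ) * R i)⌉₊ := fun i => Nat.ceil_pos.mpr (by positivity)
  obtain ⟨code, hcode⟩ := hS.exists_code (K := fun i => ⌈(2 : ℝ) ^ ((n : ℝ) * R i)⌉₊) s₀ v₀ hInv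
    hK (fun j => 2 ^ ((n : ℝ) * (R (other j) + δ))) (fun _ => n * δ / 2)
    (fun j => by positivity) (fun j => by positivity) (by
      intro j hj
      rcases hc j with h0 | h1
      · exact absurd (by simp [h0]) hj
      · rw [Real.logb_rpow (by norm_num) (by norm_num)]
        nlinarith)
  refine ⟨code, hcode.trans (le_trans (Finset.sum_le_card_nsmul _ _
    (64 * C ^ 2 / δ ^ 2 * (1 / (n : ℝ)) + 2 * ((2 : ℝ) ^ (-δ)) ^ n) fun j _ => ?_) ?_)⟩
  · have hnn : 0 ≤ 64 * C ^ 2 / δ ^ 2 * (1 / (n : ℝ)) + 2 * ((2 : ℝ) ^ (-δ)) ^ n := by positivity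
    split_ifs
    · exact hnn
    refine add_le_add (le_of_eq ?_) ?_
    · field_simp
      ring
    · have h1 : (1 : ℝ) ≤ 2 ^ ((n : ℝ) * R (other j)) :=
        Real.one_le_rpow one_le_two (mul_nonneg hn0.le (hR _))
      have h2 : (⌈(2 : ℝ) ^ ((n : ℝ) * R (other j))⌉₊ : ℝ) ≤ 2 * 2 ^ ((n : ℝ) * R (other j)) := by
        have := (Nat.ceil_lt_add_one (a := (2 : ℝ) ^ ((n : ℝ) * R (other j))) (by positivity)).le
        linarith
      rw [div_le_iff₀ (by positivity), ← Real.rpow_natCast, ← Real.rpow_mul (by norm_num), mul_assoc,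
        ← Real.rpow_add (by norm_num)]
      refine h2.trans (le_of_eq ?_)
      congr 2
      ring
  · rw [Finset.card_univ, Fintype.card_fin, nsmul_eq_mul]
    exact_mod_cast (hN₁ n hnN₁).le

end Model

/-! ### Conditional laws on finite sets -/

section CondLaw

variable {Ω A B : Type*} [Fintype Ω] [DecidableEq A] [DecidableEq B]

/-- Law of `g` given `f = a`, under the weights `w`; the point mass at `b₀` if `f = a` has
weight 0. -/
def condLaw (w : Ω → ℝ) (f : Ω → A) (g : Ω → B) (b₀ : B) (a : A) (b : B) : ℝ :=
  if ∑ o, (if f o = a then w o else 0) = 0 then (if b = b₀ then 1 else 0)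
  else (∑ o, if f o = a ∧ g o = b then w o else 0) / ∑ o, if f o = a then w o else 0

variable {w : Ω → ℝ} (f : Ω → A) (g : Ω → B) (b₀ : B)

lemma condLaw_nonneg (hw : ∀ o, 0 ≤ w o) (a : A) (b : B) : 0 ≤ condLaw w f g b₀ a b := by
  unfold condLaw
  split_ifs
  · norm_num
  · norm_num
  · refine div_nonneg (Finset.sum_nonneg fun o _ => ?_) (Finset.sum_nonneg fun o _ => ?_) <;>
      split_ifs <;> first | exact hw o | exact le_rfl

lemma sum_condLaw [Fintype B] (a : A) : ∑ b, condLaw w f g b₀ a b = 1 := by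
  unfold condLaw
  split_ifs with h
  · simp
  · rw [← Finset.sum_div, Finset.sum_comm, div_eq_one_iff_eq h]
    refine Finset.sum_congr rfl fun o _ => ?_
    by_cases ho : f o = a <;> simp [ho]

lemma weight_mul_condLaw (hw : ∀ o, 0 ≤ w o) (a : A) (b : B) :
    (∑ o, if f o = a then w o else 0) * condLaw w f g b₀ a b =
      ∑ o, if f o = a ∧ g o = b then w o else 0 := by
  unfold condLaw
  by_cases h : ∑ o, (if f o = a then w o else 0) = 0
  · rw [h, zero_mul]
    symm
    refine Finset.sum_eq_zero fun o _ => ?_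
    have h1 := (Finset.sum_eq_zero_iff_of_nonneg fun o _ => by
      split_ifs <;> first | exact hw o | exact le_rfl).mp h o (Finset.mem_univ o)
    by_cases ho : f o = a
    · rw [if_pos ho] at h1
      simp [h1]
    · simp [ho]
  · rw [if_neg h, mul_div_cancel₀ _ h]

lemma sum_mul_condLaw [Fintype A] [Fintype B] (hw : ∀ o, 0 ≤ w o) (G : A → B → ℝ) :
    ∑ o, w o * ∑ b, condLaw w f g b₀ (f o) b * G (f o) b = ∑ o, w o * G (f o) (g o) := by
  calc _ = ∑ a, ∑ o, (if f o = a then w o else 0) * ∑ b, condLaw w f g b₀ a b * G a b := by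
        rw [Finset.sum_comm]
        refine Finset.sum_congr rfl fun o _ => ?_
        simp only [ite_mul, zero_mul, Finset.sum_ite_eq, Finset.mem_univ, if_true]
    _ = ∑ a, ∑ b, (∑ o, if f o = a ∧ g o = b then w o else 0) * G a b := by
        refine Finset.sum_congr rfl fun a _ => ?_
        rw [← Finset.sum_mul, Finset.mul_sum]
        refine Finset.sum_congr rfl fun b _ => ?_
        rw [← mul_assoc, weight_mul_condLaw f g b₀ hw]
    _ = ∑ a, ∑ b, ∑ o, if f o = a then (if g o = b then w o * G a b else 0) else 0 := by
        refine Finset.sum_congr rfl fun a _ => Finset.sum_congr rfl fun b _ => ?_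
        rw [Finset.sum_mul]
        refine Finset.sum_congr rfl fun o _ => ?_
        by_cases h1 : f o = a <;> by_cases h2 : g o = b <;> simp [h1, h2]
    _ = _ := by
        have : ∀ a, ∑ b, ∑ o, (if f o = a then (if g o = b then w o * G a b else 0) else 0) =
            ∑ o, if f o = a then w o * G a (g o) else 0 := by
          intro a
          rw [Finset.sum_comm]
          refine Finset.sum_congr rfl fun o _ => ?_
          by_cases h1 : f o = a <;> simp [h1]
        simp_rw [this]
        rw [Finset.sum_comm]
        simp

lemma exists_of_condLaw_pos (hw : ∀ o, 0 ≤ w o) {o : Ω} {b : B} (ho : 0 < w o)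
    (h : 0 < condLaw w f g b₀ (f o) b) : ∃ o', 0 < w o' ∧ f o' = f o ∧ g o' = b := by
  have hpos : 0 < ∑ o', if f o' = f o then w o' else 0 := by
    refine lt_of_lt_of_le (by simpa using ho) (Finset.single_le_sum
      (f := fun o' => if f o' = f o then w o' else 0) (fun o' _ => ?_) (Finset.mem_univ o))
    split_ifs <;> first | exact hw o' | exact le_rfl
  have h1 := mul_pos hpos h
  rw [weight_mul_condLaw f g b₀ hw] at h1
  obtain ⟨o', -, ho'⟩ := Finset.exists_ne_zero_of_sum_ne_zero h1.ne'
  split_ifs at ho' with hc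
  · exact ⟨o', lt_of_le_of_ne (hw o') (Ne.symm ho'), hc.1, hc.2⟩
  · exact absurd rfl ho'

end CondLaw

namespace Model
variable (M : Model)

/-! ### The chain of energy states and its stationary laws -/

/-- Probability that the nodes send `o.1` and harvest `o.2` in state `s`. -/
def stepProb (p : Fin 2 → M.State → ℝ) (s : M.State) (o : (Fin 2 → Bool) × (Fin 2 → Bool)) : ℝ :=
  (∏ i, bern (p i s) (o.1 i)) * M.harvestProb o.1 o.2

variable {M} {p : Fin 2 → M.State → ℝ}

lemma IsTransmission.stepProb_nonneg (hp : M.IsTransmission p) (s : M.State)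
    (o : (Fin 2 → Bool) × (Fin 2 → Bool)) : 0 ≤ M.stepProb p s o :=
  mul_nonneg (Finset.prod_nonneg fun _ _ => bern_nonneg (hp.nonneg _ _) (hp.le_one _ _) _)
    (M.harvestProb_nonneg _ _)

lemma sum_stepProb_mul (p : Fin 2 → M.State → ℝ) (s : M.State)
    (F : (Fin 2 → Bool) → (Fin 2 → Bool) → ℝ) :
    ∑ o, M.stepProb p s o * F o.1 o.2 =
      ∑ x : Fin 2 → Bool, (∏ i, bern (p i s) (x i)) * ∑ h, M.harvestProb x h * F x h := by
  rw [Fintype.sum_prod_type]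
  refine Finset.sum_congr rfl fun x _ => ?_
  rw [Finset.mul_sum]
  exact Finset.sum_congr rfl fun h _ => mul_assoc _ _ _

lemma sum_stepProb (p : Fin 2 → M.State → ℝ) (s : M.State) : ∑ o, M.stepProb p s o = 1 := by
  have h := sum_stepProb_mul p s fun _ _ => 1
  simp only [mul_one] at h
  rw [h]
  simp only [sum_harvestProb, mul_one, sum_prod_bern]

lemma transition_eq_sum (p : Fin 2 → M.State → ℝ) (s' s : M.State) :
    M.transition p s' s = ∑ o, M.stepProb p s o *
      if s' = M.nextState s o.1 o.2 then 1 else 0 := by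
  rw [transition_eq]
  exact (sum_stepProb_mul p s fun x h => if s' = M.nextState s x h then 1 else 0).symm

lemma sum_transition_mul (p : Fin 2 → M.State → ℝ) (s : M.State) (g : M.State → ℝ) :
    ∑ s', M.transition p s' s * g s' =
      ∑ o, M.stepProb p s o * g (M.nextState s o.1 o.2) := by
  simp_rw [transition_eq_sum, Finset.sum_mul]
  rw [Finset.sum_comm]
  refine Finset.sum_congr rfl fun o _ => ?_
  simp

lemma IsTransmission.transition_nonneg (hp : M.IsTransmission p) (s' s : M.State) :
    0 ≤ M.transition p s' s := by
  rw [transition_eq_sum]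
  refine Finset.sum_nonneg fun o _ => mul_nonneg (hp.stepProb_nonneg s o) ?_
  split_ifs <;> norm_num

lemma IsTransmission.transition_pos (hp : M.IsTransmission p) {s : M.State}
    {o : (Fin 2 → Bool) × (Fin 2 → Bool)} (h : 0 < M.stepProb p s o) :
    0 < M.transition p (M.nextState s o.1 o.2) s := by
  rw [transition_eq_sum]
  refine lt_of_lt_of_le (by simpa using h) (Finset.single_le_sum
    (f := fun o' => M.stepProb p s o' *
      if M.nextState s o.1 o.2 = M.nextState s o'.1 o'.2 then 1 else 0)
    (fun o' _ => mul_nonneg (hp.stepProb_nonneg s o') ?_) (Finset.mem_univ o))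
  split_ifs <;> norm_num

variable (M) in
/-- Probability laws on the energy states that the transition matrix preserves. -/
structure IsStationary (p : Fin 2 → M.State → ℝ) (μ : M.State → ℝ) : Prop where
  nonneg : ∀ s, 0 ≤ μ s
  sum_eq_one : ∑ s, μ s = 1
  mulVec_eq : (M.transition p).mulVec μ = μ

lemma IsStationary.sum_mul {μ : M.State → ℝ} (hμ : M.IsStationary p μ) (g : M.State → ℝ) :
    ∑ s, μ s * ∑ o, M.stepProb p s o * g (M.nextState s o.1 o.2) = ∑ s, μ s * g s := by
  conv_rhs => rw [← hμ.mulVec_eq]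
  simp_rw [← sum_transition_mul, Matrix.mulVec, dotProduct, Finset.mul_sum, Finset.sum_mul]
  rw [Finset.sum_comm]
  refine Finset.sum_congr rfl fun s _ => Finset.sum_congr rfl fun s' _ => by ring

/-- Stationary laws charge the successors of the states that they charge. -/
lemma IsStationary.pos_of_pos {μ : M.State → ℝ} (hp : M.IsTransmission p)
    (hμ : M.IsStationary p μ) {s s' : M.State} (hs : 0 < μ s) (h : 0 < M.transition p s' s) :
    0 < μ s' := by
  rw [← hμ.mulVec_eq]
  exact lt_of_lt_of_le (mul_pos h hs) (Finset.single_le_sum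
    (f := fun t => M.transition p s' t * μ t)
    (fun t _ => mul_nonneg (hp.transition_nonneg _ _) (hμ.nonneg t)) (Finset.mem_univ s))

/-- Discounted value of the reward `I`: the equation `h = I + (1 - ε) Pᵀ h` has a solution. -/
lemma IsTransmission.exists_discounted (hp : M.IsTransmission p) {ε : ℝ} (hε : 0 < ε) (hε1 : ε ≤ 1)
    (I : M.State → ℝ) : ∃ h : M.State → ℝ, ∀ s,
      h s = I s + (1 - ε) * ∑ o, M.stepProb p s o * h (M.nextState s o.1 o.2) := by
  let T : (M.State → ℝ) →ₗ[ℝ] (M.State → ℝ) :=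
    { toFun := fun h s => h s - (1 - ε) * ∑ o, M.stepProb p s o * h (M.nextState s o.1 o.2)
      map_add' := fun a b => by
        funext s
        simp only [Pi.add_apply, mul_add, Finset.sum_add_distrib]
        ring
      map_smul' := fun r a => by
        funext s
        simp only [Pi.smul_apply, smul_eq_mul, RingHom.id_apply, mul_left_comm _ r,
          ← Finset.mul_sum]
        ring }
  have hinj : Function.Injective T := by
    rw [← LinearMap.ker_eq_bot, LinearMap.ker_eq_bot']
    intro h hh
    obtain ⟨s, -, hs⟩ := Finset.exists_max_image Finset.univ (fun s => |h s|)
      ⟨fun _ => 0, Finset.mem_univ _⟩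
    have h1 : h s = (1 - ε) * ∑ o, M.stepProb p s o * h (M.nextState s o.1 o.2) :=
      sub_eq_zero.mp (congrFun hh s)
    have h2 : |∑ o, M.stepProb p s o * h (M.nextState s o.1 o.2)| ≤ |h s| := by
      refine (Finset.abs_sum_le_sum_abs _ _).trans ?_
      calc _ ≤ ∑ o, M.stepProb p s o * |h s| := by
            refine Finset.sum_le_sum fun o _ => ?_
            rw [abs_mul, abs_of_nonneg (hp.stepProb_nonneg s o)]
            exact mul_le_mul_of_nonneg_left (hs _ (Finset.mem_univ _)) (hp.stepProb_nonneg s o)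
        _ = |h s| := by rw [← Finset.sum_mul, sum_stepProb, one_mul]
    have h3 : |h s| ≤ (1 - ε) * |h s| := by
      conv_lhs => rw [h1, abs_mul, abs_of_nonneg (sub_nonneg.mpr hε1)]
      exact mul_le_mul_of_nonneg_left h2 (sub_nonneg.mpr hε1)
    have h4 : |h s| ≤ 0 := by nlinarith
    funext s'
    exact abs_eq_zero.mp (le_antisymm ((hs s' (Finset.mem_univ _)).trans h4) (abs_nonneg _))
  obtain ⟨h, hh⟩ := (LinearMap.injective_iff_surjective.mp hinj) I
  refine ⟨h, fun s => ?_⟩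
  have : h s - (1 - ε) * ∑ o, M.stepProb p s o * h (M.nextState s o.1 o.2) = I s := congrFun hh s
  linarith

/-- A stationary mean of the discounted value. -/
lemma IsStationary.mul_sum_discounted {μ : M.State → ℝ} (hμ : M.IsStationary p μ) {ε : ℝ}
    {I h : M.State → ℝ} (hh : ∀ s, h s = I s +
      (1 - ε) * ∑ o, M.stepProb p s o * h (M.nextState s o.1 o.2)) :
    ε * ∑ s, μ s * h s = ∑ s, μ s * I s := by
  have h1 : ∑ s, μ s * h s = ∑ s, μ s * I s + (1 - ε) * ∑ s, μ s * h s := by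
    conv_lhs => enter [2, s]; rw [hh s]
    rw [← hμ.sum_mul h, Finset.mul_sum, ← Finset.sum_add_distrib]
    exact Finset.sum_congr rfl fun s _ => by ring
  linarith

end Model

namespace Model
variable (M : Model)

/-! ### Mean log-likelihood ratios -/

/-- Log-likelihood ratio at the receiver `j`, in bits, of the sent symbol `x` and the received
symbol `y`, if the sent symbol has the law `Bern(r)`. -/
def logRatio (j : Fin 2) (r : ℝ) (x y : Bool) : ℝ :=
  Real.logb 2 (M.P (other j) j x y / ∑ x', bern r x' * M.P (other j) j x' y)

/-- Mutual information, in bits, between the symbol sent to `j`, with law `Bern(r)`, and the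
received symbol. -/
def info (j : Fin 2) (r : ℝ) : ℝ :=
  ∑ x, bern r x * ∑ y, M.P (other j) j x y * M.logRatio j r x y

lemma rate_eq_info (p : Fin 2 → M.State → ℝ) (i : Fin 2) (s : M.State) :
    M.rate p i s = M.info (other i) (p i s) := by
  unfold rate mutualInfo info logRatio
  rw [other_other]
  refine Finset.sum_congr rfl fun x _ => ?_
  rw [Finset.mul_sum]
  refine Finset.sum_congr rfl fun y _ => ?_
  rw [← Finset.mul_sum, sum_P, mul_one]
  by_cases hx : bern (p i s) x = 0
  · simp [hx]
  · rw [mul_div_mul_left _ _ hx, mul_assoc]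

lemma logRatio_of_bern_eq_one {j : Fin 2} {r : ℝ} {x : Bool} (h : bern r x = 1) (y : Bool) :
    M.logRatio j r x y = 0 := by
  have h0 : bern r (!x) = 0 := by
    have := sum_bern r
    cases x <;> simp_all
  have h1 : ∑ x', bern r x' * M.P (other j) j x' y = M.P (other j) j x y := by
    cases x <;> simp_all
  unfold logRatio
  rw [h1]
  by_cases hP : M.P (other j) j x y = 0
  · simp [hP]
  · simp [div_self hP]

lemma info_zero (j : Fin 2) : M.info j 0 = 0 := by
  have := M.logRatio_of_bern_eq_one (j := j) (r := 0) (x := false) (by simp [bern])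
  simp [info, this, bern]

lemma info_one (j : Fin 2) : M.info j 1 = 0 := by
  have := M.logRatio_of_bern_eq_one (j := j) (r := 1) (x := true) (by simp [bern])
  simp [info, this, bern]

variable {M}

namespace Scheme

variable {n : ℕ} {V : Type} [Fintype V] (S : M.Scheme n V)

lemma stepMean_mono (k : Fin n) (s : M.State) (v : V)
    {F G : (Fin 2 → Bool) → (Fin 2 → Bool) → M.State → V → ℝ}
    (h : ∀ x y s' v', F x y s' v' ≤ G x y s' v') : S.stepMean k s v F ≤ S.stepMean k s v G := by
  unfold stepMean
  refine Finset.sum_le_sum fun x _ => mul_le_mul_of_nonneg_left ?_ (S.prod_bern_nonneg k s v x)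
  refine Finset.sum_le_sum fun y _ => Finset.sum_le_sum fun s' _ =>
    mul_le_mul_of_nonneg_left ?_ (M.kernel_nonneg s x y s')
  exact Finset.sum_le_sum fun v' _ => mul_le_mul_of_nonneg_left (h _ _ _ _) (S.κ_nonneg _ _ _ _ _)

lemma stepMean_add (k : Fin n) (s : M.State) (v : V)
    (F G : (Fin 2 → Bool) → (Fin 2 → Bool) → M.State → V → ℝ) :
    S.stepMean k s v (fun x y s' v' => F x y s' v' + G x y s' v') =
      S.stepMean k s v F + S.stepMean k s v G := by
  simp only [stepMean, mul_add, Finset.sum_add_distrib]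

lemma stepMean_symbols (k : Fin n) (s : M.State) (v : V) (j : Fin 2) (F : Bool → Bool → ℝ) :
    S.stepMean k s v (fun x y _ _ => F (x (other j)) (y j)) =
      ∑ x, bern (S.ρ k s v (other j)) x * ∑ y, M.P (other j) j x y * F x y := by
  rw [← M.sum_bern_kernel_apply (S.ρ k s v) s j F]
  simp only [stepMean, ← Finset.sum_mul, S.sum_κ, one_mul]

lemma stepMean_state (k : Fin n) (s : M.State) (v : V) (G : M.State → V → ℝ) :
    S.stepMean k s v (fun _ _ s' v' => G s' v') =
      ∑ x : Fin 2 → Bool, (∏ i, bern (S.ρ k s v i) (x i)) * ∑ h, M.harvestProb x h *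
        ∑ v', S.κ k s v (M.nextState s x h) v' * G (M.nextState s x h) v' := by
  unfold stepMean
  refine Finset.sum_congr rfl fun x _ => ?_
  congr 1
  rw [Finset.sum_comm]
  simp_rw [← Finset.sum_mul, sum_kernel_output, Finset.sum_mul]
  rw [Finset.sum_comm]
  refine Finset.sum_congr rfl fun h _ => ?_
  simp

lemma stepMean_const (k : Fin n) (s : M.State) (v : V) (r : ℝ) :
    S.stepMean k s v (fun _ _ _ _ => r) = r := by
  rw [S.stepMean_symbols k s v 0 (fun _ _ => r)]
  simp only [← Finset.sum_mul, sum_P, one_mul, sum_bern]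

lemma stepMean_drift (k : Fin n) (s : M.State) (v : V) (j : Fin 2) (G : M.State → V → ℝ) (g : ℝ) :
    S.stepMean k s v (fun x y s' v' =>
        Real.logb 2 (S.ratio j k s v (x (other j)) (y j)) + G s' v' - g) =
      M.info j (S.ρ k s v (other j)) +
        (∑ x : Fin 2 → Bool, (∏ i, bern (S.ρ k s v i) (x i)) * ∑ h, M.harvestProb x h *
          ∑ v', S.κ k s v (M.nextState s x h) v' * G (M.nextState s x h) v') - g := by
  simp only [sub_eq_add_neg]
  rw [S.stepMean_add k s v (fun x y s' v' =>
      Real.logb 2 (S.ratio j k s v (x (other j)) (y j)) + G s' v') (fun _ _ _ _ => -g),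
    S.stepMean_add k s v (fun x y _ _ => Real.logb 2 (S.ratio j k s v (x (other j)) (y j)))
      (fun _ _ s' v' => G s' v'), stepMean_const, stepMean_state,
    S.stepMean_symbols k s v j fun a b => Real.logb 2 (S.ratio j k s v a b)]
  rfl

end Scheme

/-! ### Simulation of a stationary chain by buffers with more energy -/

/-- A way of following the transmission probabilities `p` from a virtual state `v` while the
buffers are in a state `u`. Only the active nodes ever transmit under `p`, and they can do so as
long as they have at least the virtual energy. Otherwise the nodes send fixed symbols `travel u v`,
which bring the buffers closer to domination of `v`, as measured by `time`. The levels record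
energy that cannot be regained. -/
structure Simulation (p : Fin 2 → M.State → ℝ) where
  active : Fin 2 → Prop
  silent : ∀ i, ¬ active i → ∀ s, p i s = 0
  level : M.State → ℕ
  level_le : ∀ u v : M.State, (∀ i, active i → (v i : ℕ) ≤ u i) → level v ≤ level u
  travel : M.State → M.State → Fin 2 → Bool
  travel_empty : ∀ (u v : M.State) i, (u i : ℕ) = 0 → travel u v i = false
  time : M.State → M.State → ℝ
  time_nonneg : ∀ u v, 0 ≤ time u v
  travel_level : ∀ (u v : M.State) h, ¬ (∀ i, active i → (v i : ℕ) ≤ u i) → level v ≤ level u →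
    0 < M.harvestProb (travel u v) h → level v ≤ level (M.nextState u (travel u v) h)
  travel_time : ∀ u v : M.State, ¬ (∀ i, active i → (v i : ℕ) ≤ u i) → level v ≤ level u →
    ∑ h, M.harvestProb (travel u v) h * time (M.nextState u (travel u v) h) v ≤ time u v - 1

namespace Simulation

variable {p : Fin 2 → M.State → ℝ} (A : Simulation p)

/-- The active nodes have at least the energy of the virtual state `v`. -/
def Dom (u v : M.State) : Prop := ∀ i, A.active i → (v i : ℕ) ≤ u i

/-- Domination is preserved if the same symbols are sent and harvested. -/
lemma Dom.nextState {A : Simulation p} {u v : M.State} (h : A.Dom u v) (x y : Fin 2 → Bool) :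
    A.Dom (M.nextState u x y) (M.nextState v x y) := by
  intro i hi
  have := h i hi
  rw [nextState_val, nextState_val]
  omega

open Classical in
/-- Transmission probabilities. -/
def sendProb (u v : M.State) (i : Fin 2) : ℝ :=
  if A.Dom u v then p i v else if A.travel u v i then 1 else 0

open Classical in
/-- Next virtual state, without restarts: if the virtual chain is followed, its next state has
the conditional law given what is seen of the harvested energy. -/
def follow (u v u' v' : M.State) : ℝ :=
  if A.Dom u v then condLaw (M.stepProb p v) (fun o => M.nextState u o.1 o.2)
    (fun o => M.nextState v o.1 o.2) v u' v'
  else if v' = v then 1 else 0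

open Classical in
/-- Probability of a restart of the virtual chain: sure at the end of a stage, otherwise `ε` while
the chain is followed. -/
def restartProb (ε : ℝ) (final : Bool) (u v : M.State) : ℝ :=
  if final then 1 else if A.Dom u v then ε else 0

open Classical in
/-- The remaining time of travel, which is 0 if the virtual state is dominated. -/
def wait (u v : M.State) : ℝ := if A.Dom u v then 0 else A.time u v

lemma wait_nonneg (u v : M.State) : 0 ≤ A.wait u v := by
  unfold wait
  split_ifs
  · exact le_rfl
  · exact A.time_nonneg u v

lemma wait_le_time (u v : M.State) : A.wait u v ≤ A.time u v := by
  unfold wait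
  split_ifs
  · exact A.time_nonneg u v
  · exact le_rfl

/-- The scheme that follows the virtual chain, with restarts from the laws `μ k`. -/
def scheme (hp : M.IsTransmission p) {n : ℕ} (μ : Fin n → M.State → ℝ) (hμ : ∀ k s, 0 ≤ μ k s)
    (hμ1 : ∀ k, ∑ s, μ k s = 1) (final : Fin n → Bool) {ε : ℝ} (hε : 0 ≤ ε) (hε1 : ε ≤ 1) :
    M.Scheme n M.State where
  ρ _ u v i := A.sendProb u v i
  κ k u v u' v' := (1 - A.restartProb ε (final k) u v) * A.follow u v u' v' +
    A.restartProb ε (final k) u v * μ k v'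
  ρ_nonneg k u v i := by
    unfold sendProb
    split_ifs
    · exact hp.nonneg i v
    · norm_num
    · norm_num
  ρ_le_one k u v i := by
    unfold sendProb
    split_ifs
    · exact hp.le_one i v
    · norm_num
    · norm_num
  ρ_empty k u v i h := by
    unfold sendProb
    split_ifs with h1 h2
    · by_cases hi : A.active i
      · exact hp.empty i v (Nat.le_zero.mp (h ▸ h1 i hi))
      · exact A.silent i hi v
    · rw [A.travel_empty u v i h] at h2
      exact absurd h2 (by decide)
    · rfl
  κ_nonneg k u v u' v' := by
    have h1 : 0 ≤ A.restartProb ε (final k) u v ∧ A.restartProb ε (final k) u v ≤ 1 := by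
      unfold restartProb
      split_ifs <;> constructor <;> first | assumption | norm_num
    have h2 : 0 ≤ A.follow u v u' v' := by
      unfold follow
      split_ifs
      · exact condLaw_nonneg _ _ _ (hp.stepProb_nonneg v) _ _
      · norm_num
      · norm_num
    have h3 := hμ k v'
    have h4 := sub_nonneg.mpr h1.2
    have h5 := h1.1
    positivity
  sum_κ k u v u' := by
    have h2 : ∑ v', A.follow u v u' v' = 1 := by
      unfold follow
      split_ifs
      · exact sum_condLaw _ _ _ _
      · simp
    rw [Finset.sum_add_distrib, ← Finset.mul_sum, ← Finset.mul_sum, h2, hμ1]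
    ring

end Simulation

end Model

namespace Model
variable {M : Model}

lemma exists_of_kernel_pos {s s' : M.State} {x y : Fin 2 → Bool} (h : 0 < M.kernel s x y s') :
    ∃ z, 0 < M.harvestProb x z ∧ s' = M.nextState s x z := by
  have h1 : 0 < ∑ y, M.kernel s x y s' := lt_of_lt_of_le h
    (Finset.single_le_sum (f := fun y => M.kernel s x y s') (fun y _ => M.kernel_nonneg s x y s')
      (Finset.mem_univ y))
  rw [sum_kernel_output] at h1
  obtain ⟨z, -, hz⟩ := Finset.exists_ne_zero_of_sum_ne_zero h1.ne'
  refine ⟨z, lt_of_le_of_ne (M.harvestProb_nonneg x z) (left_ne_zero_of_mul hz).symm, ?_⟩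
  by_contra hne
  exact hz (by rw [if_neg hne, mul_zero])

namespace Simulation

variable {p : Fin 2 → M.State → ℝ} (A : Simulation p)

lemma eq_travel_of_prod_pos {u v : M.State} (hd : ¬ A.Dom u v) {x : Fin 2 → Bool}
    (h : 0 < ∏ i, bern (A.sendProb u v i) (x i)) : x = A.travel u v := by
  funext i
  have h1 := Finset.prod_ne_zero_iff.mp h.ne' i (Finset.mem_univ i)
  rw [sendProb, if_neg hd] at h1
  cases hx : x i <;> cases ht : A.travel u v i <;> simp_all [bern]

/-- Deterministic symbols: the mean over the transmitted symbols is one value. -/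
lemma sum_prod_sendProb_mul_of_not_dom {u v : M.State} (hd : ¬ A.Dom u v)
    (F : (Fin 2 → Bool) → ℝ) :
    ∑ x : Fin 2 → Bool, (∏ i, bern (A.sendProb u v i) (x i)) * F x = F (A.travel u v) := by
  rw [Finset.sum_eq_single (A.travel u v)]
  · have : ∏ i, bern (A.sendProb u v i) (A.travel u v i) = 1 := by
      refine Finset.prod_eq_one fun i _ => ?_
      rw [sendProb, if_neg hd]
      cases ht : A.travel u v i <;> simp [bern]
    rw [this, one_mul]
  · intro x _ hx
    have : ∏ i, bern (A.sendProb u v i) (x i) = 0 := by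
      by_contra hne
      refine hx (A.eq_travel_of_prod_pos hd (lt_of_le_of_ne ?_ (Ne.symm hne)))
      refine Finset.prod_nonneg fun i _ => ?_
      rw [sendProb, if_neg hd]
      split_ifs <;> exact bern_nonneg (by norm_num) (by norm_num) _
    rw [this, zero_mul]
  · simp

variable {π : M.State → ℝ} {n : ℕ} {μ : Fin n → M.State → ℝ}

/-- At the times `k` at which the level changes, a stage ends. -/
def stageEnd (T : Fin (n + 1) → ℕ) (k : Fin n) : Bool := decide (T k.succ ≠ T k.castSucc)

/-- The virtual state is charged by `π` and has the level of the stage, and the buffers have at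
least this level. -/
def InStage (π : M.State → ℝ) (T : Fin (n + 1) → ℕ) (k : Fin (n + 1)) (u v : M.State) : Prop :=
  0 < π v ∧ A.level v = T k ∧ T k ≤ A.level u

lemma inStage_step (hp : M.IsTransmission p) (hμ : ∀ k, M.IsStationary p (μ k))
    (T : Fin (n + 1) → ℕ) (hπ : M.IsStationary p π)
    (hlev : ∀ v v', 0 < π v → 0 < M.transition p v' v → A.level v' = A.level v)
    (hμT : ∀ k v, 0 < μ k v → 0 < π v ∧ A.level v = T k.succ)
    (hT : ∀ k : Fin n, T k.succ ≤ T k.castSucc) {ε : ℝ} (hε : 0 ≤ ε) (hε1 : ε ≤ 1) (k : Fin n)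
    (u v : M.State) (x y : Fin 2 → Bool) (u' v' : M.State)
    (hI : A.InStage π T k.castSucc u v) (hx : 0 < ∏ i, bern (A.sendProb u v i) (x i))
    (hk : 0 < M.kernel u x y u')
    (hκ : 0 < (A.scheme hp μ (fun k => (hμ k).nonneg) (fun k => (hμ k).sum_eq_one)
      (stageEnd T) hε hε1).κ k u v u' v') :
    A.InStage π T k.succ u' v' := by
  obtain ⟨hv, hlv, hlu⟩ := hI
  obtain ⟨z, hz, rfl⟩ := exists_of_kernel_pos hk
  have hpz : A.Dom u v → 0 < M.stepProb p v (x, z) := by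
    intro hd
    refine mul_pos ?_ hz
    have : ∀ i, A.sendProb u v i = p i v := fun i => if_pos hd
    simpa only [this] using hx
  have hlu' : T k.castSucc ≤ A.level (M.nextState u x z) := by
    by_cases hd : A.Dom u v
    · rw [← hlv, ← hlev v _ hv (hp.transition_pos (hpz hd))]
      exact A.level_le _ _ (hd.nextState x z)
    · have hx' := A.eq_travel_of_prod_pos hd hx
      subst hx'
      rw [← hlv]
      exact A.travel_level u v z hd (hlv.trans_le hlu) hz
  have hκ' : 0 < (1 - A.restartProb ε (stageEnd T k) u v) *
      A.follow u v (M.nextState u x z) v' + A.restartProb ε (stageEnd T k) u v * μ k v' := hκ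
  by_cases hμ0 : A.restartProb ε (stageEnd T k) u v * μ k v' = 0
  swap
  · have h1 : 0 < μ k v' := lt_of_le_of_ne ((hμ k).nonneg v') (right_ne_zero_of_mul hμ0).symm
    exact ⟨(hμT k v' h1).1, (hμT k v' h1).2, (hT k).trans hlu'⟩
  rw [hμ0, add_zero] at hκ'
  have hfin : stageEnd T k = false := by
    by_contra hf
    rw [Bool.not_eq_false] at hf
    simp [restartProb, hf] at hκ'
  have hTk : T k.succ = T k.castSucc := by simpa [stageEnd] using hfin
  have hf : A.follow u v (M.nextState u x z) v' ≠ 0 := right_ne_zero_of_mul hκ'.ne'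
  rw [InStage, hTk]
  unfold follow at hf
  split_ifs at hf with hd hvv
  · obtain ⟨o, ho, -, rfl⟩ := exists_of_condLaw_pos (fun o => M.nextState u o.1 o.2)
      (fun o => M.nextState v o.1 o.2) v (hp.stepProb_nonneg v) (hpz hd)
      (lt_of_le_of_ne (condLaw_nonneg _ _ _ (hp.stepProb_nonneg v) _ _) (Ne.symm hf))
    have htr := hp.transition_pos ho
    exact ⟨hπ.pos_of_pos hp hv htr, (hlev v _ hv htr).trans hlv, hlu'⟩
  · rw [hvv]
    exact ⟨hv, hlv, hlu'⟩
  · exact absurd rfl hf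

/-- One-step drift of the potential while the virtual chain is followed. -/
lemma drift_of_dom (hp : M.IsTransmission p) {u v : M.State} (hd : A.Dom u v)
    {ν : M.State → ℝ} (hν : M.IsStationary p ν)
    (j : Fin 2) {ε Γ W : ℝ} (hε : 0 ≤ ε) (hΓ : 0 ≤ Γ) (hW : ∀ u v, A.wait u v ≤ W)
    {h : M.State → ℝ} (hh : ∀ s, h s = M.info j (p (other j) s) +
      (1 - ε) * ∑ o, M.stepProb p s o * h (M.nextState s o.1 o.2)) :
    ∑ s, ν s * M.info j (p (other j) s) - ε * Γ * W ≤
      M.info j (A.sendProb u v (other j)) +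
        (∑ x : Fin 2 → Bool, (∏ i, bern (A.sendProb u v i) (x i)) * ∑ z, M.harvestProb x z *
          ∑ v', ((1 - ε) * A.follow u v (M.nextState u x z) v' + ε * ν v') *
            (h v' - Γ * A.wait (M.nextState u x z) v')) - (h v - Γ * A.wait u v) := by
  have hs : ∀ i, A.sendProb u v i = p i v := fun i => if_pos hd
  simp only [hs]
  have hw0 : A.wait u v = 0 := if_pos hd
  have hf : ∀ u' v', A.follow u v u' v' = condLaw (M.stepProb p v)
      (fun o => M.nextState u o.1 o.2) (fun o => M.nextState v o.1 o.2) v u' v' :=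
    fun u' v' => if_pos hd
  have hfollow := sum_mul_condLaw (fun o => M.nextState u o.1 o.2) (fun o => M.nextState v o.1 o.2)
    v (hp.stepProb_nonneg v) (fun u' v' => h v' - Γ * A.wait u' v')
  have hdom : ∀ o : (Fin 2 → Bool) × (Fin 2 → Bool),
      A.wait (M.nextState u o.1 o.2) (M.nextState v o.1 o.2) = 0 :=
    fun o => if_pos (hd.nextState o.1 o.2)
  simp only [hdom, mul_zero, sub_zero] at hfollow
  have hrestart : ∑ s, ν s * h s - Γ * W ≤ ∑ o, M.stepProb p v o * ∑ v', ν v' *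
      (h v' - Γ * A.wait (M.nextState u o.1 o.2) v') := by
    have h1 : ∀ u', ∑ s, ν s * h s - Γ * W ≤ ∑ v', ν v' * (h v' - Γ * A.wait u' v') := by
      intro u'
      have : ∑ v', ν v' * (h v' - Γ * W) = ∑ s, ν s * h s - Γ * W := by
        simp only [mul_sub, Finset.sum_sub_distrib, ← Finset.sum_mul, hν.sum_eq_one, one_mul]
      rw [← this]
      refine Finset.sum_le_sum fun v' _ => mul_le_mul_of_nonneg_left ?_ (hν.nonneg v')
      have := mul_le_mul_of_nonneg_left (hW u' v') hΓ
      linarith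
    calc _ = ∑ o, M.stepProb p v o * (∑ s, ν s * h s - Γ * W) := by
          rw [← Finset.sum_mul, sum_stepProb, one_mul]
      _ ≤ _ := Finset.sum_le_sum fun o _ =>
          mul_le_mul_of_nonneg_left (h1 _) (hp.stepProb_nonneg v o)
  have hsum : (∑ x : Fin 2 → Bool, (∏ i, bern (p i v) (x i)) * ∑ z, M.harvestProb x z *
      ∑ v', ((1 - ε) * A.follow u v (M.nextState u x z) v' + ε * ν v') *
        (h v' - Γ * A.wait (M.nextState u x z) v')) =
      (1 - ε) * ∑ o, M.stepProb p v o * h (M.nextState v o.1 o.2) +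
      ε * ∑ o, M.stepProb p v o * ∑ v', ν v' *
        (h v' - Γ * A.wait (M.nextState u o.1 o.2) v') := by
    rw [← sum_stepProb_mul p v fun x z =>
      ∑ v', ((1 - ε) * A.follow u v (M.nextState u x z) v' + ε * ν v') *
        (h v' - Γ * A.wait (M.nextState u x z) v'), ← hfollow, Finset.mul_sum, Finset.mul_sum,
      ← Finset.sum_add_distrib]
    refine Finset.sum_congr rfl fun o _ => ?_
    simp only [hf, add_mul, Finset.sum_add_distrib, Finset.mul_sum, mul_add]
    congr 1 <;> exact Finset.sum_congr rfl fun v' _ => by ring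
  rw [hsum, hw0]
  have h2 := hν.mul_sum_discounted hh
  have h3 := hh v
  nlinarith [mul_le_mul_of_nonneg_left hrestart hε]

/-- One-step drift of the potential while the buffers are brought to domination. -/
lemma drift_of_not_dom {u v : M.State} (hd : ¬ A.Dom u v) (hl : A.level v ≤ A.level u)
    (ν : M.State → ℝ) (j : Fin 2) {Γ : ℝ} (hΓ : 0 ≤ Γ) (h : M.State → ℝ) :
    Γ ≤ M.info j (A.sendProb u v (other j)) +
        (∑ x : Fin 2 → Bool, (∏ i, bern (A.sendProb u v i) (x i)) * ∑ z, M.harvestProb x z *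
          ∑ v', ((1 - 0) * A.follow u v (M.nextState u x z) v' + 0 * ν v') *
            (h v' - Γ * A.wait (M.nextState u x z) v')) - (h v - Γ * A.wait u v) := by
  have hinfo : M.info j (A.sendProb u v (other j)) = 0 := by
    rw [sendProb, if_neg hd]
    split_ifs
    · exact M.info_one j
    · exact M.info_zero j
  have hf : ∀ u' v', A.follow u v u' v' = if v' = v then 1 else 0 := fun u' v' => if_neg hd
  have hw : A.wait u v = A.time u v := if_neg hd
  rw [A.sum_prod_sendProb_mul_of_not_dom hd, hinfo, hw]
  simp only [hf, sub_zero, one_mul, zero_mul, add_zero, ite_mul, Finset.sum_ite_eq',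
    Finset.mem_univ, if_true]
  have h1 : ∑ z, M.harvestProb (A.travel u v) z *
      (h v - Γ * A.wait (M.nextState u (A.travel u v) z) v) =
      h v - Γ * ∑ z, M.harvestProb (A.travel u v) z *
        A.wait (M.nextState u (A.travel u v) z) v := by
    simp only [mul_sub, Finset.sum_sub_distrib, ← Finset.sum_mul, sum_harvestProb, one_mul,
      Finset.mul_sum]
    congr 1
    exact Finset.sum_congr rfl fun z _ => by ring
  have h2 : ∑ z, M.harvestProb (A.travel u v) z * A.wait (M.nextState u (A.travel u v) z) v ≤
      A.time u v - 1 :=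
    le_trans (Finset.sum_le_sum fun z _ => mul_le_mul_of_nonneg_left (A.wait_le_time _ _)
      (M.harvestProb_nonneg _ _)) (A.travel_time u v hd hl)
  rw [h1]
  nlinarith [mul_le_mul_of_nonneg_left h2 hΓ]

end Simulation

end Model

namespace Model
variable {M : Model}

lemma IsStationary.abs_sum_mul_le {p : Fin 2 → M.State → ℝ} {μ : M.State → ℝ}
    (hμ : M.IsStationary p μ) {I : M.State → ℝ} {C : ℝ} (hI : ∀ s, |I s| ≤ C) :
    |∑ s, μ s * I s| ≤ C := by
  refine (Finset.abs_sum_le_sum_abs _ _).trans ?_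
  calc _ ≤ ∑ s, μ s * C := by
        refine Finset.sum_le_sum fun s _ => ?_
        rw [abs_mul, abs_of_nonneg (hμ.nonneg s)]
        exact mul_le_mul_of_nonneg_left (hI s) (hμ.nonneg s)
    _ = C := by rw [← Finset.sum_mul, hμ.sum_eq_one, one_mul]

namespace Simulation

variable {p : Fin 2 → M.State → ℝ} (A : Simulation p)

/-- The scheme has, at each time, almost the mean information of the stationary law of the
stage; the end of a stage costs a constant `D`. -/
theorem hasDrift {n : ℕ} {μ : Fin n → M.State → ℝ} {π : M.State → ℝ} (hp : M.IsTransmission p)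
    (hμ : ∀ k, M.IsStationary p (μ k)) (T : Fin (n + 1) → ℕ) (hπ : M.IsStationary p π)
    (hlev : ∀ v v', 0 < π v → 0 < M.transition p v' v → A.level v' = A.level v)
    (hμT : ∀ k v, 0 < μ k v → 0 < π v ∧ A.level v = T k.succ)
    (hT : ∀ k : Fin n, T k.succ ≤ T k.castSucc) {ε : ℝ} (hε : 0 ≤ ε) (hε1 : ε ≤ 1)
    {h : Fin 2 → M.State → ℝ} (hh : ∀ j s, h j s = M.info j (p (other j) s) +
      (1 - ε) * ∑ o, M.stepProb p s o * h j (M.nextState s o.1 o.2))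
    {Γ W C₁ C₂ D C : ℝ} {L : ℕ} (hΓ : 0 ≤ Γ) (hI : ∀ j s, |M.info j (p (other j) s)| ≤ Γ)
    (hW : ∀ u v, A.wait u v ≤ W)
    (hC₁ : ∀ j u v x y, |M.logRatio j (A.sendProb u v (other j)) x y| ≤ C₁)
    (hC₂ : ∀ j u v, |h j v - Γ * A.wait u v| ≤ C₂) (hD : Γ + C₁ + 2 * C₂ ≤ D)
    (hL : ∀ k, T k ≤ L) (h1C : C₁ ≤ C) (h2C : C₂ ≤ C) (h3C : Γ + ε * Γ * W + D * L ≤ C) :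
    (A.scheme hp μ (fun k => (hμ k).nonneg) (fun k => (hμ k).sum_eq_one)
      (stageEnd T) hε hε1).HasDrift (A.InStage π T) (fun j u v => h j v - Γ * A.wait u v)
      (fun j k => ∑ s, μ k s * M.info j (p (other j) s) - ε * Γ * W -
        D * (T k.castSucc - T k.succ)) C := by
  have hW0 : 0 ≤ W := (A.wait_nonneg (fun _ => 0) (fun _ => 0)).trans (hW _ _)
  have hC₁0 : 0 ≤ C₁ := (abs_nonneg _).trans (hC₁ 0 (fun _ => 0) (fun _ => 0) true true)
  have hC₂0 : 0 ≤ C₂ := (abs_nonneg _).trans (hC₂ 0 (fun _ => 0) (fun _ => 0))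
  have hεΓW : 0 ≤ ε * Γ * W := by positivity
  have hD0 : 0 ≤ D := by linarith
  refine ⟨fun k u v x y u' v' hI hx hk hκ => A.inStage_step hp hμ T hπ hlev hμT hT hε hε1 k u v x y
    u' v' hI hx hk hκ, ?_, fun j k u v x y => (hC₁ j u v x y).trans h1C,
    fun j u v => (hC₂ j u v).trans h2C, ?_⟩
  · intro j k u v hst
    have hr := (hμ k).abs_sum_mul_le (hI j)
    by_cases hfin : T k.succ = T k.castSucc
    · have hend : stageEnd T k = false := by simp [stageEnd, hfin]
      rw [Scheme.stepMean_drift]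
      simp only [hfin, sub_self, mul_zero, sub_zero, scheme, hend, restartProb, Bool.false_eq_true,
        if_false]
      by_cases hd : A.Dom u v
      · simp only [if_pos hd]
        exact A.drift_of_dom hp hd (hμ k) j hε hΓ hW (hh j)
      · simp only [if_neg hd]
        refine le_trans ?_ (A.drift_of_not_dom hd (hst.2.1.trans_le hst.2.2) (μ k) j hΓ (h j))
        linarith [(abs_le.mp hr).2]
    · have hlt : (T k.succ : ℝ) + 1 ≤ T k.castSucc := by
        exact_mod_cast lt_of_le_of_ne (hT k) hfin
      have hc : ∑ s, μ k s * M.info j (p (other j) s) - ε * Γ * W -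
          D * (T k.castSucc - T k.succ) ≤ -(C₁ + 2 * C₂) := by
        have : D * 1 ≤ D * ((T k.castSucc : ℝ) - T k.succ) :=
          mul_le_mul_of_nonneg_left (by linarith) hD0
        linarith [(abs_le.mp hr).2]
      refine hc.trans ?_
      rw [← Scheme.stepMean_const (A.scheme hp μ (fun k => (hμ k).nonneg)
        (fun k => (hμ k).sum_eq_one) (stageEnd T) hε hε1) k u v (-(C₁ + 2 * C₂))]
      refine Scheme.stepMean_mono _ k u v fun x y u' v' => ?_
      have e1 := abs_le.mp (hC₁ j u v (x (other j)) (y j))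
      have e2 := abs_le.mp (hC₂ j u v)
      have e3 := abs_le.mp (hC₂ j u' v')
      change -(C₁ + 2 * C₂) ≤ M.logRatio j (A.sendProb u v (other j)) (x (other j)) (y j) +
        (h j v' - Γ * A.wait u' v') - (h j v - Γ * A.wait u v)
      linarith [e1.1, e2.2, e3.1]
  · intro j k
    have hr := abs_le.mp ((hμ k).abs_sum_mul_le (hI j))
    have h1 : (T k.castSucc : ℝ) - T k.succ ≤ L := by
      have : (T k.castSucc : ℝ) ≤ L := by exact_mod_cast hL _
      have : (0 : ℝ) ≤ T k.succ := Nat.cast_nonneg _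
      linarith
    have h2 : (0 : ℝ) ≤ (T k.castSucc : ℝ) - T k.succ := by
      have : (T k.succ : ℝ) ≤ T k.castSucc := by exact_mod_cast hT k
      linarith
    have h3 := mul_le_mul_of_nonneg_left h1 hD0
    have h4 := mul_nonneg hD0 h2
    rw [abs_le]
    constructor <;> linarith [hr.1, hr.2]

end Simulation

/-! ### Stages of decreasing level -/

section Stages

variable (π : M.State → ℝ) (ℓ : M.State → ℕ) (L : ℕ)

/-- Mass that `π` gives to the levels at least `t`. -/
def tailMass (t : ℕ) : ℝ := ∑ s, if t ≤ ℓ s then π s else 0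

/-- The law `π`, conditioned on level `t`. -/
def levelLaw (t : ℕ) (s : M.State) : ℝ :=
  if ℓ s = t then π s / ∑ s', (if ℓ s' = t then π s' else 0) else 0

open Classical in
/-- The level at time `k` out of `n`, a quantile of the law of the level: level `t` takes a
fraction of the time equal to its probability, and high levels come first. -/
def stageLevel (n k : ℕ) : ℕ :=
  Nat.findGreatest (fun t => (k : ℝ) < (n + 1) * tailMass π ℓ t) L

variable {π ℓ L} {p : Fin 2 → M.State → ℝ}

lemma tailMass_antitone (hπ : ∀ s, 0 ≤ π s) : Antitone (tailMass π ℓ) := by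
  intro a b hab
  refine Finset.sum_le_sum fun s _ => ?_
  split_ifs with h1 h2 <;> first | exact le_rfl | exact hπ s | exact absurd (hab.trans h1) h2

lemma tailMass_sub (t : ℕ) :
    tailMass π ℓ t - tailMass π ℓ (t + 1) = ∑ s, if ℓ s = t then π s else 0 := by
  unfold tailMass
  rw [← Finset.sum_sub_distrib]
  refine Finset.sum_congr rfl fun s _ => ?_
  split_ifs <;> first | omega | simp

lemma stageLevel_le (n k : ℕ) : stageLevel π ℓ L n k ≤ L := Nat.findGreatest_le L

lemma stageLevel_succ_le (n k : ℕ) : stageLevel π ℓ L n (k + 1) ≤ stageLevel π ℓ L n k := by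
  refine Nat.findGreatest_mono_left (fun t ht => ?_) L
  push_cast at ht
  linarith

lemma lt_tailMass_stageLevel (hπ : M.IsStationary p π) {n k : ℕ} (hk : k ≤ n) :
    (k : ℝ) < (n + 1) * tailMass π ℓ (stageLevel π ℓ L n k) := by
  classical
  refine Nat.findGreatest_spec (P := fun t => (k : ℝ) < (n + 1) * tailMass π ℓ t) (Nat.zero_le L) ?_
  have : tailMass π ℓ 0 = 1 := by simp [tailMass, hπ.sum_eq_one]
  rw [this, mul_one]
  exact_mod_cast Nat.lt_succ_of_le hk

lemma le_stageLevel_iff (hπ : M.IsStationary p π) {n k t : ℕ} (hk : k ≤ n) (ht : t ≤ L) :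
    t ≤ stageLevel π ℓ L n k ↔ (k : ℝ) < (n + 1) * tailMass π ℓ t := by
  classical
  constructor
  · intro h
    exact (lt_tailMass_stageLevel hπ hk).trans_le
      (mul_le_mul_of_nonneg_left (tailMass_antitone hπ.nonneg h) (by positivity))
  · intro h
    exact Nat.le_findGreatest ht h

lemma mass_stageLevel_pos (hπ : M.IsStationary p π) (hL : ∀ s, ℓ s ≤ L) {n k : ℕ} (hk : k ≤ n) :
    0 < ∑ s, if ℓ s = stageLevel π ℓ L n k then π s else 0 := by
  rw [← tailMass_sub, sub_pos]
  have h1 := lt_tailMass_stageLevel (ℓ := ℓ) (L := L) hπ hk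
  have h2 : (n + 1) * tailMass π ℓ (stageLevel π ℓ L n k + 1) ≤ k := by
    rcases (stageLevel_le (π := π) (ℓ := ℓ) (L := L) n k).eq_or_lt with h | h
    · have : tailMass π ℓ (stageLevel π ℓ L n k + 1) = 0 := by
        refine Finset.sum_eq_zero fun s _ => if_neg ?_
        have := hL s
        omega
      rw [this, mul_zero]
      positivity
    · by_contra hcon
      push Not at hcon
      have := (le_stageLevel_iff (ℓ := ℓ) hπ hk (Nat.succ_le_of_lt h)).mpr hcon
      omega
  have h3 : (0 : ℝ) < n + 1 := by positivity
  exact lt_of_mul_lt_mul_left (h2.trans_lt h1) h3.le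

lemma levelLaw_pos {t : ℕ} (hπ : M.IsStationary p π) {s : M.State} (h : 0 < levelLaw π ℓ t s) :
    0 < π s ∧ ℓ s = t := by
  unfold levelLaw at h
  split_ifs at h with hs
  · refine ⟨lt_of_le_of_ne (hπ.nonneg s) fun h0 => ?_, hs⟩
    rw [← h0, zero_div] at h
    exact lt_irrefl _ h
  · exact absurd h (lt_irrefl _)

/-- The restriction of a stationary law to a level that the chain preserves is stationary. -/
lemma isStationary_levelLaw (hp : M.IsTransmission p) (hπ : M.IsStationary p π)
    (hlev : ∀ v v', 0 < π v → 0 < M.transition p v' v → ℓ v' = ℓ v) {t : ℕ}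
    (ht : 0 < ∑ s, if ℓ s = t then π s else 0) : M.IsStationary p (levelLaw π ℓ t) := by
  refine ⟨fun s => ?_, ?_, ?_⟩
  · unfold levelLaw
    split_ifs
    · exact div_nonneg (hπ.nonneg s) ht.le
    · exact le_rfl
  · have : ∀ s, levelLaw π ℓ t s =
        (if ℓ s = t then π s else 0) / ∑ s', if ℓ s' = t then π s' else 0 := by
      intro s
      unfold levelLaw
      split_ifs <;> simp
    simp_rw [this]
    rw [← Finset.sum_div, div_self ht.ne']
  · funext s'
    have h1 : ∀ s, M.transition p s' s * levelLaw π ℓ t s =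
        if ℓ s' = t then M.transition p s' s * π s / ∑ s', (if ℓ s' = t then π s' else 0)
        else 0 := by
      intro s
      by_cases h0 : M.transition p s' s * π s = 0
      · have : M.transition p s' s * levelLaw π ℓ t s = 0 := by
          unfold levelLaw
          split_ifs
          · rw [← mul_div_assoc, h0, zero_div]
          · rw [mul_zero]
        rw [this, h0, zero_div, ite_self]
      · have hl := hlev s s' (lt_of_le_of_ne (hπ.nonneg s) (right_ne_zero_of_mul h0).symm)
          (lt_of_le_of_ne (hp.transition_nonneg _ _) (left_ne_zero_of_mul h0).symm)
        unfold levelLaw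
        rw [hl]
        split_ifs
        · rw [mul_div_assoc]
        · rw [mul_zero]
    rw [Matrix.mulVec, dotProduct]
    simp_rw [h1]
    have h2 : ∑ s, M.transition p s' s * π s = π s' := congrFun hπ.mulVec_eq s'
    unfold levelLaw
    split_ifs
    · rw [← Finset.sum_div, h2]
    · simp

end Stages

end Model

namespace Model
variable {M : Model}

section Stages

variable {π : M.State → ℝ} {ℓ : M.State → ℕ} {L : ℕ} {p : Fin 2 → M.State → ℝ}

lemma mass_mul_sum_levelLaw (hπ : M.IsStationary p π) (I : M.State → ℝ) (t : ℕ) :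
    (∑ s, if ℓ s = t then π s else 0) * ∑ s, levelLaw π ℓ t s * I s =
      ∑ s, if ℓ s = t then π s * I s else 0 := by
  have hnn : ∀ s ∈ (Finset.univ : Finset M.State), 0 ≤ if ℓ s = t then π s else 0 := fun s _ => by
    split_ifs <;> first | exact hπ.nonneg s | exact le_rfl
  by_cases h : ∑ s, (if ℓ s = t then π s else 0) = 0
  · rw [h, zero_mul]
    symm
    refine Finset.sum_eq_zero fun s _ => ?_
    have := (Finset.sum_eq_zero_iff_of_nonneg hnn).mp h s (Finset.mem_univ s)
    split_ifs at this ⊢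
    · rw [this, zero_mul]
    · rfl
  · rw [Finset.mul_sum]
    refine Finset.sum_congr rfl fun s _ => ?_
    unfold levelLaw
    split_ifs
    · rw [← mul_assoc, mul_div_cancel₀ _ h]
    · simp

lemma tailMass_nonneg (hπ : M.IsStationary p π) (t : ℕ) : 0 ≤ tailMass π ℓ t :=
  Finset.sum_nonneg fun s _ => by split_ifs <;> first | exact hπ.nonneg s | exact le_rfl

lemma tailMass_le_one (hπ : M.IsStationary p π) (t : ℕ) : tailMass π ℓ t ≤ 1 := by
  rw [← hπ.sum_eq_one]
  refine Finset.sum_le_sum fun s _ => ?_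
  split_ifs <;> first | exact hπ.nonneg s | exact le_rfl

/-- The number of times with level at least `t` is `n * tailMass t`, up to 1. -/
lemma abs_card_le_stageLevel_sub (hπ : M.IsStationary p π) (hL : ∀ s, ℓ s ≤ L) (n t : ℕ) :
    |(∑ k : Fin n, if t ≤ stageLevel π ℓ L n (k + 1) then (1 : ℝ) else 0) -
      n * tailMass π ℓ t| ≤ 1 := by
  by_cases ht : t ≤ L
  swap
  · have h1 : tailMass π ℓ t = 0 := Finset.sum_eq_zero fun s _ => if_neg (by have := hL s; omega)
    have h2 : ∀ k : Fin n, (if t ≤ stageLevel π ℓ L n (k + 1) then (1 : ℝ) else 0) = 0 := fun k =>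
      if_neg (by have := stageLevel_le (π := π) (ℓ := ℓ) (L := L) n (k + 1); omega)
    simp [h1, h2]
  have hG0 := tailMass_nonneg (ℓ := ℓ) hπ t
  have hG1 := tailMass_le_one (ℓ := ℓ) hπ t
  set x : ℝ := (n + 1) * tailMass π ℓ t with hx
  have hx0 : 0 ≤ x := by positivity
  have hxn : x ≤ n + 1 := by rw [hx]; nlinarith
  have hceil : ⌈x⌉₊ ≤ n + 1 := Nat.ceil_le.mpr (by exact_mod_cast hxn)
  have hcard : (∑ k : Fin n, if t ≤ stageLevel π ℓ L n (k + 1) then (1 : ℝ) else 0) =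
      ((⌈x⌉₊ - 1 : ℕ) : ℝ) := by
    have h1 : ∀ k : Fin n, (if t ≤ stageLevel π ℓ L n (k + 1) then (1 : ℝ) else 0) =
        if (k : ℕ) ∈ Finset.range (⌈x⌉₊ - 1) then 1 else 0 := by
      intro k
      have h2 : t ≤ stageLevel π ℓ L n (k + 1) ↔ (k : ℕ) ∈ Finset.range (⌈x⌉₊ - 1) := by
        rw [le_stageLevel_iff hπ k.isLt ht, ← hx, ← Nat.lt_ceil, Finset.mem_range]
        omega
      simp only [h2]
    simp_rw [h1]
    rw [Fin.sum_univ_eq_sum_range (fun k => if k ∈ Finset.range (⌈x⌉₊ - 1) then (1 : ℝ) else 0) n,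
      Finset.sum_ite_mem, Finset.inter_eq_right.mpr (Finset.range_subset_range.mpr (by omega))]
    simp
  rw [hcard]
  have h3 := Nat.le_ceil x
  have h4 := Nat.ceil_lt_add_one hx0
  have h5 : (⌈x⌉₊ : ℝ) ≤ ((⌈x⌉₊ - 1 : ℕ) : ℝ) + 1 := by
    exact_mod_cast (by omega : ⌈x⌉₊ ≤ ⌈x⌉₊ - 1 + 1)
  have h6 : ((⌈x⌉₊ - 1 : ℕ) : ℝ) ≤ x := by
    rcases Nat.eq_zero_or_pos ⌈x⌉₊ with h | h
    · simp [h, hx0]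
    · rw [Nat.cast_sub h]
      push_cast
      linarith
  rw [abs_le]
  constructor <;> nlinarith

/-- The sum of the stage means is `n` times the mean under `π`, up to a constant. -/
lemma le_sum_stageLevel (hπ : M.IsStationary p π) (hL : ∀ s, ℓ s ≤ L) (I : M.State → ℝ) (n : ℕ) :
    n * ∑ s, π s * I s - 2 * ∑ t ∈ Finset.range (L + 1), |∑ s, levelLaw π ℓ t s * I s| ≤
      ∑ k : Fin n, ∑ s, levelLaw π ℓ (stageLevel π ℓ L n (k + 1)) s * I s := by
  set r : ℕ → ℝ := fun t => ∑ s, levelLaw π ℓ t s * I s with hr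
  set N : ℕ → ℝ := fun t => ∑ k : Fin n, if t ≤ stageLevel π ℓ L n (k + 1) then (1 : ℝ) else 0
    with hN
  have h1 : ∑ k : Fin n, r (stageLevel π ℓ L n (k + 1)) =
      ∑ t ∈ Finset.range (L + 1), (N t - N (t + 1)) * r t := by
    have h2 : ∀ t, N t - N (t + 1) =
        ∑ k : Fin n, if stageLevel π ℓ L n (k + 1) = t then (1 : ℝ) else 0 := by
      intro t
      simp only [hN]
      rw [← Finset.sum_sub_distrib]
      refine Finset.sum_congr rfl fun k _ => ?_
      split_ifs <;> first | omega | simp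
    simp_rw [h2, Finset.sum_mul]
    rw [Finset.sum_comm (s := Finset.range (L + 1))]
    refine Finset.sum_congr rfl fun k _ => ?_
    simp only [ite_mul, one_mul, zero_mul]
    rw [Finset.sum_ite_eq, if_pos]
    exact Finset.mem_range.mpr (Nat.lt_succ_of_le (stageLevel_le _ _))
  have h3 : ∑ s, π s * I s = ∑ t ∈ Finset.range (L + 1),
      (tailMass π ℓ t - tailMass π ℓ (t + 1)) * r t := by
    simp_rw [tailMass_sub, hr, mass_mul_sum_levelLaw hπ]
    rw [Finset.sum_comm (s := Finset.range (L + 1))]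
    refine Finset.sum_congr rfl fun s _ => ?_
    rw [Finset.sum_ite_eq, if_pos]
    exact Finset.mem_range.mpr (Nat.lt_succ_of_le (hL s))
  have h4 : ∀ t, n * ((tailMass π ℓ t - tailMass π ℓ (t + 1)) * r t) - 2 * |r t| ≤
      (N t - N (t + 1)) * r t := by
    intro t
    have e1 := abs_le.mp (abs_card_le_stageLevel_sub hπ hL n t)
    have e2 := abs_le.mp (abs_card_le_stageLevel_sub hπ hL n (t + 1))
    have e3 : |(N t - N (t + 1)) - n * (tailMass π ℓ t - tailMass π ℓ (t + 1))| ≤ 2 := by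
      rw [abs_le]
      simp only [hN]
      constructor <;> linarith [e1.1, e1.2, e2.1, e2.2]
    have e4 := mul_le_mul_of_nonneg_right e3 (abs_nonneg (r t))
    rw [← abs_mul] at e4
    have e5 := (abs_le.mp e4).1
    linarith
  rw [h1, h3, Finset.mul_sum, Finset.mul_sum, ← Finset.sum_sub_distrib]
  exact Finset.sum_le_sum fun t _ => h4 t

end Stages

/-- The mean information under a stationary law lies in the capacity region if the stationary
chain can be simulated from `s₀`. -/
theorem Simulation.mem_capacityRegion {p : Fin 2 → M.State → ℝ} (A : Simulation p)
    (hp : M.IsTransmission p) {π : M.State → ℝ} (hπ : M.IsStationary p π)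
    (hlev : ∀ v v', 0 < π v → 0 < M.transition p v' v → A.level v' = A.level v) (s₀ : M.State)
    (hs₀ : ∀ v, 0 < π v → A.level v ≤ A.level s₀) (R : Fin 2 → ℝ) (hR : ∀ i, 0 ≤ R i)
    (hRle : ∀ i, R i ≤ ∑ s, π s * M.rate p i s) : R ∈ M.capacityRegion s₀ := by
  rw [capacityRegion, Metric.mem_closure_iff]
  intro η hη
  set δ : ℝ := η / 8 with hδ
  have hδ0 : 0 < δ := by positivity
  refine ⟨fun i => max 0 (R i - 4 * δ), ?_, ?_⟩
  swap
  · refine lt_of_le_of_lt ((dist_pi_le_iff (by positivity : 0 ≤ 4 * δ)).mpr fun i => ?_)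
      (by rw [hδ]; linarith : 4 * δ < η)
    rw [Real.dist_eq, abs_le]
    have := hR i
    rcases le_total 0 (R i - 4 * δ) with h | h
    · rw [max_eq_right h]
      constructor <;> linarith
    · rw [max_eq_left h]
      constructor <;> linarith
  have bdd : ∀ {ι : Type} [Finite ι] (f : ι → ℝ), ∃ C, 0 ≤ C ∧ ∀ a, |f a| ≤ C := by
    intro ι _ f
    obtain ⟨C, hC⟩ := (Set.finite_range fun a => |f a|).bddAbove
    exact ⟨max 0 C, le_max_left _ _, fun a => (hC ⟨a, rfl⟩).trans (le_max_right _ _)⟩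
  obtain ⟨Γ, hΓ, hI⟩ := bdd fun a : Fin 2 × M.State => M.info a.1 (p (other a.1) a.2)
  obtain ⟨W, hW0, hW⟩ := bdd fun a : M.State × M.State => A.wait a.1 a.2
  obtain ⟨C₁, hC₁0, hC₁⟩ := bdd fun a : Fin 2 × M.State × M.State × Bool × Bool =>
    M.logRatio a.1 (A.sendProb a.2.1 a.2.2.1 (other a.1)) a.2.2.2.1 a.2.2.2.2
  obtain ⟨L, hL⟩ : ∃ L, ∀ s, A.level s ≤ L := by
    obtain ⟨L, hL⟩ := (Set.finite_range A.level).bddAbove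
    exact ⟨L, fun s => hL ⟨s, rfl⟩⟩
  set ε : ℝ := min 1 (δ / (Γ * W + 1)) with hε
  have hΓW : 0 ≤ Γ * W := mul_nonneg hΓ hW0
  have hε0 : 0 < ε := lt_min one_pos (by positivity)
  have hε1 : ε ≤ 1 := min_le_left _ _
  have hεΓW : ε * Γ * W ≤ δ := by
    have h1 : ε * (Γ * W + 1) ≤ δ := by
      rw [← le_div_iff₀ (by positivity)]
      exact min_le_right _ _
    nlinarith
  have hex : ∀ j : Fin 2, ∃ h : M.State → ℝ, ∀ s, h s = M.info j (p (other j) s) +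
      (1 - ε) * ∑ o, M.stepProb p s o * h (M.nextState s o.1 o.2) :=
    fun j => hp.exists_discounted hε0 hε1 _
  choose h hh using hex
  obtain ⟨C₂, hC₂0, hC₂⟩ := bdd fun a : Fin 2 × M.State × M.State =>
    h a.1 a.2.2 - Γ * A.wait a.2.1 a.2.2
  obtain ⟨K, hK0, hK⟩ := bdd fun j : Fin 2 => 2 * ∑ t ∈ Finset.range (L + 1),
    |∑ s, levelLaw π A.level t s * M.info j (p (other j) s)|
  set D : ℝ := Γ + C₁ + 2 * C₂ with hD
  have hD0 : 0 ≤ D := by positivity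
  have hDL : 0 ≤ D * L := by positivity
  have hεΓW0 : 0 ≤ ε * Γ * W := by positivity
  refine achievable_of_hasDrift (V := M.State) (C := C₁ + C₂ + (Γ + ε * Γ * W + D * L)) s₀ _
    (fun i => le_max_left _ _) hδ0 ?_
  obtain ⟨N, hN⟩ := exists_nat_ge ((K + D * L) / δ)
  refine ⟨N, fun n hn => ?_⟩
  set T : Fin (n + 1) → ℕ := fun k => stageLevel π A.level L n k with hT
  have hmass : ∀ k : Fin (n + 1), 0 < ∑ s, if A.level s = T k then π s else 0 := fun k =>
    mass_stageLevel_pos hπ hL (Nat.lt_succ_iff.mp k.isLt)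
  obtain ⟨v₀, -, hv₀⟩ := Finset.exists_ne_zero_of_sum_ne_zero (hmass 0).ne'
  have hv₀' : A.level v₀ = T 0 ∧ 0 < π v₀ := by
    split_ifs at hv₀ with h0
    · exact ⟨h0, lt_of_le_of_ne (hπ.nonneg v₀) (Ne.symm hv₀)⟩
    · exact absurd rfl hv₀
  have hμ : ∀ k : Fin n, M.IsStationary p (levelLaw π A.level (T k.succ)) := fun k =>
    isStationary_levelLaw hp hπ hlev (hmass k.succ)
  refine ⟨_, _, _, _, v₀, A.hasDrift (μ := fun k => levelLaw π A.level (T k.succ)) hp hμ T hπ hlev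
    (fun k v hv => levelLaw_pos hπ hv) (fun k => stageLevel_succ_le n k) hε0.le hε1 hh hΓ
    (fun j s => hI (j, s)) (fun u v => (le_abs_self _).trans (hW (u, v)))
    (fun j u v x y => hC₁ (j, u, v, x, y)) (fun j u v => hC₂ (j, u, v)) hD.ge
    (fun k => stageLevel_le n k) (by linarith) (by linarith) (by linarith),
    ⟨hv₀'.2, hv₀'.1, hv₀'.1 ▸ hs₀ v₀ hv₀'.2⟩, fun j => ?_⟩
  rcases le_total (R (other j) - 4 * δ) 0 with h0 | h0
  · exact Or.inl (max_eq_left h0)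
  right
  rw [max_eq_right h0]
  have hr := hRle (other j)
  simp_rw [rate_eq_info, other_other] at hr
  have hsum := le_sum_stageLevel hπ hL (fun s => M.info j (p (other j) s)) n
  have hKj := (le_abs_self _).trans (hK j)
  have htel := sum_sub_telescope fun k => -(T k : ℝ)
  have hT0 : (T 0 : ℝ) ≤ L := by exact_mod_cast stageLevel_le (L := L) n _
  have hTn : (0 : ℝ) ≤ T (Fin.last n) := Nat.cast_nonneg _
  have hc : ∑ k : Fin n, (∑ s, levelLaw π A.level (T k.succ) s * M.info j (p (other j) s) -
      ε * Γ * W - D * ((T k.castSucc : ℝ) - T k.succ)) =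
      ∑ k : Fin n, ∑ s, levelLaw π A.level (stageLevel π A.level L n (k + 1)) s *
        M.info j (p (other j) s) - n * (ε * Γ * W) - D * (T 0 - T (Fin.last n)) := by
    have e1 : ∑ k : Fin n, ((T k.castSucc : ℝ) - T k.succ) = T 0 - T (Fin.last n) := by
      rw [show (T 0 : ℝ) - T (Fin.last n) = -(T (Fin.last n) : ℝ) - -(T 0 : ℝ) by ring, ← htel]
      exact Finset.sum_congr rfl fun k _ => by ring
    rw [Finset.sum_sub_distrib, Finset.sum_sub_distrib, ← Finset.mul_sum (a := D), e1]
    simp [hT]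
  rw [hc]
  have hn0 : (0 : ℝ) ≤ n := Nat.cast_nonneg n
  have hnδ : K + D * L ≤ n * δ := by
    rw [← div_le_iff₀ hδ0]
    exact hN.trans (by exact_mod_cast hn)
  have e2 : D * (T 0 - T (Fin.last n)) ≤ D * L := mul_le_mul_of_nonneg_left (by linarith) hD0
  have e3 := mul_le_mul_of_nonneg_left hεΓW hn0
  have e4 := mul_le_mul_of_nonneg_left hr hn0
  nlinarith

end Model

namespace Model
variable {M : Model}

/-! ### Energy balance of stationary laws -/

variable (M) in
/-- Probability that Node `i` harvests a unit if the other node sends `b`. -/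
def gain (i : Fin 2) (b : Bool) : ℝ := M.Q (other i) i b true

lemma gain_nonneg (i : Fin 2) (b : Bool) : 0 ≤ M.gain i b := M.Q_nonneg _ _ _ _

lemma Q_false_eq (i : Fin 2) (b : Bool) : M.Q (other i) i b false = 1 - M.gain i b := by
  have := M.sum_Q (other i) i b
  rw [Fintype.sum_bool] at this
  unfold gain
  linarith

lemma gain_le_one (i : Fin 2) (b : Bool) : M.gain i b ≤ 1 := by
  have h1 := M.Q_nonneg (other i) i b false
  rw [Q_false_eq] at h1
  linarith

lemma sum_harvestProb_mul_apply (x : Fin 2 → Bool) (i : Fin 2) (F : Bool → ℝ) :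
    ∑ h, M.harvestProb x h * F (h i) =
      M.gain i (x (other i)) * F true + (1 - M.gain i (x (other i))) * F false := by
  have h := sum_prod_mul_apply (fun i b => M.Q (other i) i (x (other i)) b)
    (fun i => M.sum_Q _ _ _) i F
  rw [Fintype.sum_bool, Q_false_eq] at h
  exact h

variable {p : Fin 2 → M.State → ℝ} {π : M.State → ℝ}

lemma exists_of_transition_pos {s s' : M.State} (hp : M.IsTransmission p)
    (h : 0 < M.transition p s' s) : ∃ o, 0 < M.stepProb p s o ∧ s' = M.nextState s o.1 o.2 := by
  rw [transition_eq_sum] at h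
  obtain ⟨o, -, ho⟩ := Finset.exists_ne_zero_of_sum_ne_zero h.ne'
  refine ⟨o, lt_of_le_of_ne (hp.stepProb_nonneg s o) (left_ne_zero_of_mul ho).symm, ?_⟩
  by_contra hne
  exact ho (by rw [if_neg hne, mul_zero])

/-- A node that transmits has energy. -/
lemma toNat_le_of_stepProb_pos (hp : M.IsTransmission p) {s : M.State}
    {o : (Fin 2 → Bool) × (Fin 2 → Bool)} (h : 0 < M.stepProb p s o) (i : Fin 2) :
    (o.1 i).toNat ≤ s i := by
  by_contra hcon
  push Not at hcon
  have hx : o.1 i = true := by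
    by_contra hf
    rw [Bool.not_eq_true] at hf
    simp [hf] at hcon
  have hs : (s i : ℕ) = 0 := by simpa [hx] using hcon
  have h1 := Finset.prod_ne_zero_iff.mp (left_ne_zero_of_mul h.ne') i (Finset.mem_univ i)
  rw [hx, hp.empty i s hs] at h1
  exact h1 (by simp [bern])

/-- In the stationary mean, a node does not send more than it harvests. -/
lemma IsStationary.sum_mul_send_le (hp : M.IsTransmission p) (hπ : M.IsStationary p π) (i : Fin 2) :
    ∑ s, π s * p i s ≤ ∑ s, π s *
      (M.gain i true * p (other i) s + M.gain i false * (1 - p (other i) s)) := by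
  have h1 := hπ.sum_mul fun s => ((s i : ℕ) : ℝ)
  have h2 : ∀ s, ∑ o, M.stepProb p s o * ((M.nextState s o.1 o.2 i : ℕ) : ℝ) ≤ (s i : ℕ) - p i s +
      (M.gain i true * p (other i) s + M.gain i false * (1 - p (other i) s)) := by
    intro s
    have hx : ∑ o, M.stepProb p s o * ((o.1 i).toNat : ℝ) = p i s := by
      rw [sum_stepProb_mul p s fun x _ => ((x i).toNat : ℝ)]
      simp_rw [← Finset.sum_mul, sum_harvestProb, one_mul]
      rw [sum_prod_mul_apply (fun i b => bern (p i s) b) (fun i => sum_bern _) i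
        fun b => (b.toNat : ℝ)]
      simp [bern]
    have hh : ∑ o, M.stepProb p s o * ((o.2 i).toNat : ℝ) =
        M.gain i true * p (other i) s + M.gain i false * (1 - p (other i) s) := by
      rw [sum_stepProb_mul p s fun _ h => ((h i).toNat : ℝ)]
      simp_rw [sum_harvestProb_mul_apply _ i fun b => (b.toNat : ℝ)]
      rw [sum_prod_mul_apply (fun i b => bern (p i s) b) (fun i => sum_bern _) (other i) fun b =>
        M.gain i b * (true.toNat : ℝ) + (1 - M.gain i b) * (false.toNat : ℝ)]
      simp [bern]
      ring
    rw [← hx, ← hh]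
    have h3 : ((s i : ℕ) : ℝ) = ∑ o, M.stepProb p s o * ((s i : ℕ) : ℝ) := by
      rw [← Finset.sum_mul, sum_stepProb, one_mul]
    rw [h3, ← Finset.sum_sub_distrib, ← Finset.sum_add_distrib]
    refine Finset.sum_le_sum fun o _ => ?_
    rw [← mul_sub, ← mul_add]
    rcases (hp.stepProb_nonneg s o).eq_or_lt with h0 | h0
    · rw [← h0, zero_mul, zero_mul]
    refine mul_le_mul_of_nonneg_left ?_ h0.le
    have h4 := toNat_le_of_stepProb_pos hp h0 i
    rw [← Nat.cast_sub h4, ← Nat.cast_add]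
    exact_mod_cast min_le_right _ _
  have h5 : ∑ s, π s * ((s i : ℕ) : ℝ) ≤ ∑ s, π s * ((s i : ℕ) - p i s +
      (M.gain i true * p (other i) s + M.gain i false * (1 - p (other i) s))) := by
    rw [← h1]
    exact Finset.sum_le_sum fun s _ => mul_le_mul_of_nonneg_left (h2 s) (hπ.nonneg s)
  simp only [mul_add, mul_sub, Finset.sum_add_distrib, Finset.sum_sub_distrib] at h5 ⊢
  linarith

lemma IsStationary.eq_zero_of_sum_nonpos (hp : M.IsTransmission p) (hπ : M.IsStationary p π)
    {i : Fin 2} (h : ∑ s, π s * p i s ≤ 0) {s : M.State} (hs : 0 < π s) : p i s = 0 := by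
  have hnn : ∀ s ∈ (Finset.univ : Finset M.State), 0 ≤ π s * p i s := fun s _ =>
    mul_nonneg (hπ.nonneg s) (hp.nonneg i s)
  have := (Finset.sum_eq_zero_iff_of_nonneg hnn).mp (le_antisymm h (Finset.sum_nonneg hnn)) s
    (Finset.mem_univ s)
  exact (mul_eq_zero.mp this).resolve_left hs.ne'

/-- Stationarity depends only on the transmission probabilities in charged states. -/
lemma IsStationary.congr {p' : Fin 2 → M.State → ℝ} (hπ : M.IsStationary p π)
    (h : ∀ s, 0 < π s → ∀ i, p' i s = p i s) : M.IsStationary p' π := by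
  refine ⟨hπ.nonneg, hπ.sum_eq_one, ?_⟩
  funext s'
  refine (Finset.sum_congr rfl fun s _ => ?_).trans (congrFun hπ.mulVec_eq s')
  change M.transition p' s' s * π s = M.transition p s' s * π s
  rcases (hπ.nonneg s).eq_or_lt with h0 | h0
  · rw [← h0, mul_zero, mul_zero]
  · congr 1
    unfold transition
    simp only [h s h0]

/-- The limit law of the chain started at `s₀` is stationary. -/
lemma isStationary_of_tendsto (hp : M.IsTransmission p) {s₀ : M.State}
    (hπ : Tendsto (fun k : ℕ => (M.transition p ^ k).mulVec (Pi.single s₀ 1)) atTop (𝓝 π)) :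
    M.IsStationary p π := by
  have hsucc : ∀ k : ℕ, (M.transition p ^ (k + 1)).mulVec (Pi.single s₀ 1) =
      (M.transition p).mulVec ((M.transition p ^ k).mulVec (Pi.single s₀ 1)) := by
    intro k
    rw [pow_succ', Matrix.mulVec_mulVec]
  refine ⟨fun s => ?_, ?_, ?_⟩
  · refine ge_of_tendsto' (tendsto_pi_nhds.mp hπ s) fun k => ?_
    induction k generalizing s with
    | zero =>
      rw [pow_zero, Matrix.one_mulVec, Pi.single_apply]
      split_ifs <;> norm_num
    | succ k ih =>
      rw [hsucc]
      exact Finset.sum_nonneg fun s' _ => mul_nonneg (hp.transition_nonneg _ _) (ih s')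
  · have h1 : ∀ k : ℕ, ∑ s, (M.transition p ^ k).mulVec (Pi.single s₀ 1) s = 1 := by
      intro k
      induction k with
      | zero =>
        rw [pow_zero, Matrix.one_mulVec]
        simp
      | succ k ih =>
        rw [hsucc]
        refine Eq.trans ?_ ih
        generalize (M.transition p ^ k).mulVec (Pi.single s₀ 1) = f
        simp only [Matrix.mulVec, dotProduct]
        rw [Finset.sum_comm]
        refine Finset.sum_congr rfl fun s _ => ?_
        rw [← Finset.sum_mul]
        have := sum_transition_mul p s fun _ => 1
        simp only [mul_one, sum_stepProb] at this
        rw [this, one_mul]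
    have h2 := tendsto_finsetSum Finset.univ fun s _ => tendsto_pi_nhds.mp hπ s
    simp_rw [h1] at h2
    exact (tendsto_nhds_unique h2 tendsto_const_nhds)
  · have h1 : Tendsto (fun k : ℕ => (M.transition p ^ (k + 1)).mulVec (Pi.single s₀ 1)) atTop
        (𝓝 ((M.transition p).mulVec π)) := by
      simp_rw [hsucc]
      exact ((Continuous.matrix_mulVec continuous_const continuous_id).tendsto π).comp hπ
    exact tendsto_nhds_unique h1 (hπ.comp (tendsto_add_atTop_nat 1))

/-- A function of the state that never increases stays below its initial value. -/
lemma level_le_of_tendsto (hp : M.IsTransmission p) {s₀ : M.State}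
    (hπ : Tendsto (fun k : ℕ => (M.transition p ^ k).mulVec (Pi.single s₀ 1)) atTop (𝓝 π))
    {ℓ : M.State → ℕ} (hℓ : ∀ s s', 0 < M.transition p s' s → ℓ s' ≤ ℓ s) {v : M.State}
    (hv : 0 < π v) : ℓ v ≤ ℓ s₀ := by
  by_contra hcon
  push Not at hcon
  have h1 : ∀ (k : ℕ) v, ℓ s₀ < ℓ v → (M.transition p ^ k).mulVec (Pi.single s₀ 1) v = 0 := by
    intro k
    induction k with
    | zero =>
      intro v hv
      rw [pow_zero, Matrix.one_mulVec, Pi.single_apply, if_neg]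
      rintro rfl
      exact lt_irrefl _ hv
    | succ k ih =>
      intro v hv
      rw [pow_succ', ← Matrix.mulVec_mulVec]
      refine Finset.sum_eq_zero fun s _ => ?_
      change M.transition p v s * _ = 0
      by_cases h0 : M.transition p v s = 0
      · rw [h0, zero_mul]
      · have := hℓ s v (lt_of_le_of_ne (hp.transition_nonneg _ _) (Ne.symm h0))
        rw [ih s (by omega), mul_zero]
  have h2 := tendsto_pi_nhds.mp hπ v
  simp_rw [fun k => h1 k v hcon] at h2
  exact hv.ne (tendsto_nhds_unique tendsto_const_nhds h2)

end Model

namespace Model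
variable {M : Model} {p : Fin 2 → M.State → ℝ} {π : M.State → ℝ}

/-! ### Regaining energy -/

namespace Simulation

open Classical in
/-- If every active node gains energy while the other node is silent, silence of both nodes fills
the buffers of the active nodes. -/
def ofSilence (act : Fin 2 → Prop) (hp : ∀ i, ¬ act i → ∀ s, p i s = 0)
    (hg : ∀ i, act i → 0 < M.gain i false) : Simulation p where
  active := act
  silent := hp
  level _ := 0
  level_le _ _ _ := le_rfl
  travel _ _ _ := false
  travel_empty _ _ _ _ := rfl
  time u _ := ∑ i, if act i then ((M.B i : ℝ) - (u i : ℕ)) / M.gain i false else 0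
  time_nonneg u v := by
    refine Finset.sum_nonneg fun i _ => ?_
    split_ifs with h
    · refine div_nonneg (sub_nonneg.mpr ?_) (hg i h).le
      exact_mod_cast Nat.lt_succ_iff.mp (u i).isLt
    · exact le_rfl
  travel_level _ _ _ _ _ _ := le_rfl
  travel_time u v hd _ := by
    push Not at hd
    obtain ⟨i₀, hi₀, hlt⟩ := hd
    have hmean : ∀ i, act i → ∑ h, M.harvestProb (fun _ => false) h *
        (((M.B i : ℝ) - (M.nextState u (fun _ => false) h i : ℕ)) / M.gain i false) =
        if (u i : ℕ) < M.B i then ((M.B i : ℝ) - (u i : ℕ)) / M.gain i false - 1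
        else ((M.B i : ℝ) - (u i : ℕ)) / M.gain i false := by
      intro i hi
      have h1 : ∀ h : Fin 2 → Bool, ((M.nextState u (fun _ => false) h i : ℕ) : ℝ) =
          ((min (M.B i) (u i + (h i).toNat) : ℕ) : ℝ) := fun h => rfl
      simp_rw [h1]
      rw [sum_harvestProb_mul_apply (fun _ => false) i fun b =>
        ((M.B i : ℝ) - ((min (M.B i) (u i + b.toNat) : ℕ) : ℝ)) / M.gain i false]
      have hg0 := (hg i hi).ne'
      have hu : (u i : ℕ) ≤ M.B i := Nat.lt_succ_iff.mp (u i).isLt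
      split_ifs with hlt'
      · rw [Bool.toNat_true, Bool.toNat_false, min_eq_right hlt', min_eq_right (by omega)]
        push_cast
        field_simp
        ring
      · have : (u i : ℕ) = M.B i := by omega
        rw [this]
        simp
    have hle : ∀ i, (∑ h, M.harvestProb (fun _ => false) h *
        if act i then ((M.B i : ℝ) - (M.nextState u (fun _ => false) h i : ℕ)) / M.gain i false
        else 0) ≤ (if act i then ((M.B i : ℝ) - (u i : ℕ)) / M.gain i false else 0) -
          if i = i₀ then 1 else 0 := by
      intro i
      by_cases hi : act i
      · simp only [if_pos hi]
        rw [hmean i hi]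
        by_cases hii : i = i₀
        · subst hii
          rw [if_pos (lt_of_lt_of_le hlt (Nat.lt_succ_iff.mp (v i).isLt)), if_pos rfl]
        · rw [if_neg hii]
          split_ifs <;> linarith
      · simp only [if_neg hi, mul_zero, Finset.sum_const_zero]
        rw [if_neg (fun h : i = i₀ => hi (h ▸ hi₀)), sub_zero]
    simp_rw [Finset.mul_sum]
    rw [Finset.sum_comm]
    refine (Finset.sum_le_sum fun i _ => hle i).trans (le_of_eq ?_)
    rw [Finset.sum_sub_distrib]
    simp

/-- If Node `j` gains energy while the other node is silent, and its transmissions may give energy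
to the other node, then both buffers are filled if Node `j` transmits whenever it can, until the
buffer of the other node is full, and is silent from then on. -/
def ofSupply (j : Fin 2) (hj : 0 < M.gain j false) (hB : 1 ≤ M.B j)
    (ho : 0 < M.gain (other j) true) : Simulation p where
  active _ := True
  silent _ h := absurd trivial h
  level _ := 0
  level_le _ _ _ := le_rfl
  travel u _ k := decide (k = j ∧ (u (other j) : ℕ) < M.B (other j) ∧ 1 ≤ (u j : ℕ))
  travel_empty u v k h := by
    rw [decide_eq_false_iff_not]
    rintro ⟨rfl, -, h1⟩
    omega
  time u _ := ((M.B (other j) : ℝ) - (u (other j) : ℕ)) / (M.gain j false * M.gain (other j) true) +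
    ((M.B j : ℝ) - (u j : ℕ)) / M.gain j false
  time_nonneg u v := by
    have h1 : ∀ i, 0 ≤ (M.B i : ℝ) - (u i : ℕ) := fun i =>
      sub_nonneg.mpr (by exact_mod_cast Nat.lt_succ_iff.mp (u i).isLt)
    exact add_nonneg (div_nonneg (h1 _) (mul_pos hj ho).le) (div_nonneg (h1 _) hj.le)
  travel_level _ _ _ _ _ _ := le_rfl
  travel_time u v hd _ := by
    push Not at hd
    obtain ⟨i₀, -, hlt⟩ := hd
    have hu : ∀ i, (u i : ℕ) ≤ M.B i := fun i => Nat.lt_succ_iff.mp (u i).isLt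
    have hfull : (u (other j) : ℕ) < M.B (other j) ∨ (u j : ℕ) < M.B j := by
      have := lt_of_lt_of_le hlt (Nat.lt_succ_iff.mp (v i₀).isLt)
      rcases eq_or_eq_other j i₀ with rfl | rfl
      · exact Or.inr this
      · exact Or.inl this
    have hj0 := hj.ne'
    have ho0 := ho.ne'
    simp only [mul_add, Finset.sum_add_distrib]
    by_cases hsend : (u (other j) : ℕ) < M.B (other j) ∧ 1 ≤ (u j : ℕ)
    · -- a unit is sent; its mean gain at the other node pays for the unit and for the time
      have hx : (fun k => decide (k = j ∧ (u (other j) : ℕ) < M.B (other j) ∧ 1 ≤ (u j : ℕ))) =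
          fun k => decide (k = j) := by
        funext k
        simp [hsend]
      rw [hx]
      have e1 : ∀ h : Fin 2 → Bool,
          ((M.nextState u (fun k => decide (k = j)) h (other j) : ℕ) : ℝ) =
          ((u (other j) : ℕ) : ℝ) + (h (other j)).toNat := by
        intro h
        rw [nextState_val]
        have : (h (other j)).toNat ≤ 1 := Bool.toNat_le _
        simp only [other_ne, decide_false, Bool.toNat_false, Nat.sub_zero]
        rw [min_eq_right (by omega)]
        push_cast
        ring
      have e2 : ∀ h : Fin 2 → Bool, ((M.nextState u (fun k => decide (k = j)) h j : ℕ) : ℝ) =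
          ((u j : ℕ) : ℝ) - 1 + (h j).toNat := by
        intro h
        rw [nextState_val]
        have : (h j).toNat ≤ 1 := Bool.toNat_le _
        have := hu j
        simp only [decide_true, Bool.toNat_true]
        rw [min_eq_right (by omega), Nat.cast_add, Nat.cast_sub hsend.2]
        simp
      simp_rw [e1, e2]
      rw [sum_harvestProb_mul_apply _ (other j) fun b => ((M.B (other j) : ℝ) -
          (((u (other j) : ℕ) : ℝ) + b.toNat)) / (M.gain j false * M.gain (other j) true),
        sum_harvestProb_mul_apply _ j fun b => ((M.B j : ℝ) -
          (((u j : ℕ) : ℝ) - 1 + b.toNat)) / M.gain j false]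
      simp only [other_other, other_ne, decide_true, decide_false, Bool.toNat_true,
        Bool.toNat_false]
      refine le_of_eq ?_
      field_simp
      push_cast
      ring
    · have hx : (fun k => decide (k = j ∧ (u (other j) : ℕ) < M.B (other j) ∧ 1 ≤ (u j : ℕ))) =
          fun _ => false := by
        funext k
        simp only [hsend, and_false, decide_false]
      have huj : (u j : ℕ) < M.B j := by
        rcases hfull with h | h
        · by_contra hc
          exact hsend ⟨h, by omega⟩
        · exact h
      rw [hx]
      have e1 : ∀ h : Fin 2 → Bool, ((u (other j) : ℕ) : ℝ) ≤
          ((M.nextState u (fun _ => false) h (other j) : ℕ) : ℝ) := by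
        intro h
        rw [nextState_val]
        have := hu (other j)
        simp only [Bool.toNat_false, Nat.sub_zero]
        exact_mod_cast le_min this (Nat.le_add_right _ _)
      have e2 : ∀ h : Fin 2 → Bool, ((M.nextState u (fun _ => false) h j : ℕ) : ℝ) =
          ((u j : ℕ) : ℝ) + (h j).toNat := by
        intro h
        rw [nextState_val]
        have : (h j).toNat ≤ 1 := Bool.toNat_le _
        simp only [Bool.toNat_false, Nat.sub_zero]
        rw [min_eq_right (by omega), Nat.cast_add]
      have f1 : ∑ h, M.harvestProb (fun _ => false) h * (((M.B (other j) : ℝ) -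
          (M.nextState u (fun _ => false) h (other j) : ℕ)) /
            (M.gain j false * M.gain (other j) true)) ≤
          ((M.B (other j) : ℝ) - (u (other j) : ℕ)) / (M.gain j false * M.gain (other j) true) := by
        calc _ ≤ ∑ h, M.harvestProb (fun _ => false) h * (((M.B (other j) : ℝ) -
              (u (other j) : ℕ)) / (M.gain j false * M.gain (other j) true)) := by
              refine Finset.sum_le_sum fun h _ => mul_le_mul_of_nonneg_left ?_
                (M.harvestProb_nonneg _ _)
              exact div_le_div_of_nonneg_right (by linarith [e1 h]) (mul_pos hj ho).le
          _ = _ := by rw [← Finset.sum_mul, sum_harvestProb, one_mul]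
      simp_rw [e2]
      rw [sum_harvestProb_mul_apply _ j fun b => ((M.B j : ℝ) -
          (((u j : ℕ) : ℝ) + b.toNat)) / M.gain j false]
      have f2 : M.gain j false * (((M.B j : ℝ) - (((u j : ℕ) : ℝ) + true.toNat)) / M.gain j false) +
          (1 - M.gain j false) * (((M.B j : ℝ) - (((u j : ℕ) : ℝ) + false.toNat)) / M.gain j false)
          = ((M.B j : ℝ) - (u j : ℕ)) / M.gain j false - 1 := by
        simp only [Bool.toNat_true, Bool.toNat_false]
        field_simp
        push_cast
        ring
      rw [f2]
      linarith

end Simulation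

/-! ### Noiseless exchange of energy -/

/-- Every unit that is sent is harvested by the other node, and there is no other source. -/
def Lossless (M : Model) : Prop := ∀ i, M.gain i false = 0 ∧ M.gain i true = 1

lemma Lossless.eq_of_harvestProb_pos (hM : M.Lossless) {x h : Fin 2 → Bool}
    (hh : 0 < M.harvestProb x h) (i : Fin 2) : h i = x (other i) := by
  have h1 := Finset.prod_ne_zero_iff.mp hh.ne' i (Finset.mem_univ i)
  by_contra hne
  refine h1 ?_
  cases hx : x (other i) <;> cases hi : h i <;> rw [hx, hi] at hne
  · exact absurd rfl hne
  · exact (hM i).1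
  · rw [Q_false_eq, (hM i).2, sub_self]
  · exact absurd rfl hne

/-- Total energy of both buffers. -/
def totalEnergy (s : M.State) : ℕ := ∑ i, (s i : ℕ)

lemma Lossless.totalEnergy_nextState_le (hM : M.Lossless) {s : M.State} {x h : Fin 2 → Bool}
    (hx : ∀ i, (x i).toNat ≤ s i) (hh : 0 < M.harvestProb x h) :
    totalEnergy (M.nextState s x h) ≤ totalEnergy s := by
  have h0 := hM.eq_of_harvestProb_pos hh 0
  have h1 := hM.eq_of_harvestProb_pos hh 1
  have e0 : other 0 = 1 := rfl
  have e1 : other 1 = 0 := rfl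
  rw [e0] at h0
  rw [e1] at h1
  unfold totalEnergy
  rw [Fin.sum_univ_two, Fin.sum_univ_two, nextState_val, nextState_val, h0, h1]
  have := hx 0
  have := hx 1
  omega

variable (M) in
/-- The nodes that have energy send it if the other node lacks energy. -/
def handOver (u v : M.State) (k : Fin 2) : Bool :=
  decide ((u (other k) : ℕ) < v (other k) ∧ 1 ≤ (u k : ℕ))

lemma Lossless.handOver_step (hM : M.Lossless) {u v : M.State} {h : Fin 2 → Bool}
    (hd : ¬ ∀ i, True → (v i : ℕ) ≤ u i) (hl : totalEnergy v ≤ totalEnergy u)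
    (hh : 0 < M.harvestProb (M.handOver u v) h) :
    totalEnergy (M.nextState u (M.handOver u v) h) = totalEnergy u ∧
      (∑ i, ((v i : ℕ) - (M.nextState u (M.handOver u v) h i : ℕ))) + 1 ≤
        ∑ i, ((v i : ℕ) - (u i : ℕ)) := by
  have h0 := hM.eq_of_harvestProb_pos hh 0
  have h1 := hM.eq_of_harvestProb_pos hh 1
  have e0 : other 0 = 1 := rfl
  have e1 : other 1 = 0 := rfl
  rw [e0] at h0
  rw [e1] at h1
  have hv0 := Nat.lt_succ_iff.mp (v 0).isLt
  have hv1 := Nat.lt_succ_iff.mp (v 1).isLt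
  have hu0 := Nat.lt_succ_iff.mp (u 0).isLt
  have hu1 := Nat.lt_succ_iff.mp (u 1).isLt
  unfold totalEnergy at hl ⊢
  simp only [Fin.sum_univ_two, nextState_val] at hl ⊢
  rw [h0, h1]
  have k0 : M.handOver u v 0 = decide ((u 1 : ℕ) < v 1 ∧ 1 ≤ (u 0 : ℕ)) := rfl
  have k1 : M.handOver u v 1 = decide ((u 0 : ℕ) < v 0 ∧ 1 ≤ (u 1 : ℕ)) := rfl
  have hd' : ¬ ((v 0 : ℕ) ≤ u 0 ∧ (v 1 : ℕ) ≤ u 1) := fun hc => hd fun i _ => by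
    fin_cases i
    · exact hc.1
    · exact hc.2
  rcases Nat.lt_or_ge (u 0 : ℕ) (v 0) with hlt | hge
  · have f1 : ((u 0 : ℕ) < v 0 ∧ 1 ≤ (u 1 : ℕ)) := ⟨hlt, by omega⟩
    have f2 : ¬ ((u 1 : ℕ) < v 1 ∧ 1 ≤ (u 0 : ℕ)) := by omega
    rw [k0, k1, decide_eq_true f1, decide_eq_false f2, Bool.toNat_true, Bool.toNat_false]
    omega
  · have f1 : ((u 1 : ℕ) < v 1 ∧ 1 ≤ (u 0 : ℕ)) := by omega
    have f2 : ¬ ((u 0 : ℕ) < v 0 ∧ 1 ≤ (u 1 : ℕ)) := by omega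
    rw [k0, k1, decide_eq_true f1, decide_eq_false f2, Bool.toNat_true, Bool.toNat_false]
    omega

/-- In a lossless exchange, a node with more energy than required hands it over, unit by unit, to
the node that lacks energy. -/
def Simulation.ofLossless (hM : M.Lossless) : Simulation p where
  active _ := True
  silent _ h := absurd trivial h
  level := totalEnergy
  level_le u v h := Finset.sum_le_sum fun i _ => h i trivial
  travel := M.handOver
  travel_empty u v k h := by
    rw [handOver, decide_eq_false_iff_not]
    rintro ⟨-, h1⟩
    omega
  time u v := ((∑ i, ((v i : ℕ) - (u i : ℕ)) : ℕ) : ℝ)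
  time_nonneg u v := Nat.cast_nonneg _
  travel_level u v h hd hl hh := by rwa [(hM.handOver_step hd hl hh).1]
  travel_time u v hd hl := by
    calc _ ≤ ∑ h, M.harvestProb (M.handOver u v) h *
          (((∑ i, ((v i : ℕ) - (u i : ℕ)) : ℕ) : ℝ) - 1) := by
          refine Finset.sum_le_sum fun h _ => ?_
          rcases (M.harvestProb_nonneg (M.handOver u v) h).eq_or_lt with h0 | h0
          · rw [← h0, zero_mul, zero_mul]
          · refine mul_le_mul_of_nonneg_left (le_sub_iff_add_le.mpr ?_) h0.le
            exact_mod_cast (hM.handOver_step hd hl h0).2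
      _ = _ := by rw [← Finset.sum_mul, sum_harvestProb, one_mul]

/-- A stationary law of a lossless exchange charges no state that can lose energy. -/
lemma Lossless.totalEnergy_eq (hM : M.Lossless) (hp : M.IsTransmission p)
    (hπ : M.IsStationary p π) (v v' : M.State) (hv : 0 < π v) (h : 0 < M.transition p v' v) :
    totalEnergy v' = totalEnergy v := by
  have hle : ∀ s o, 0 < M.stepProb p s o →
      totalEnergy (M.nextState s o.1 o.2) ≤ totalEnergy s := by
    intro s o ho
    refine hM.totalEnergy_nextState_le (toNat_le_of_stepProb_pos hp ho) ?_
    exact lt_of_le_of_ne (M.harvestProb_nonneg _ _) (right_ne_zero_of_mul ho.ne').symm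
  obtain ⟨o, ho, rfl⟩ := exists_of_transition_pos hp h
  refine le_antisymm (hle v o ho) ?_
  by_contra hlt
  push Not at hlt
  have h1 := hπ.sum_mul fun s => (totalEnergy s : ℝ)
  have h2 : ∀ s, ∑ o, M.stepProb p s o * (totalEnergy (M.nextState s o.1 o.2) : ℝ) ≤
      totalEnergy s := by
    intro s
    calc _ ≤ ∑ o, M.stepProb p s o * (totalEnergy s : ℝ) := by
          refine Finset.sum_le_sum fun o _ => ?_
          rcases (hp.stepProb_nonneg s o).eq_or_lt with h0 | h0
          · rw [← h0, zero_mul, zero_mul]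
          · exact mul_le_mul_of_nonneg_left (by exact_mod_cast hle s o h0) h0.le
      _ = _ := by rw [← Finset.sum_mul, sum_stepProb, one_mul]
  have h3 : ∑ o, M.stepProb p v o * (totalEnergy (M.nextState v o.1 o.2) : ℝ) < totalEnergy v := by
    calc _ < ∑ o, M.stepProb p v o * (totalEnergy v : ℝ) := by
          refine Finset.sum_lt_sum (fun o _ => ?_) ⟨o, Finset.mem_univ o, ?_⟩
          · rcases (hp.stepProb_nonneg v o).eq_or_lt with h0 | h0
            · rw [← h0, zero_mul, zero_mul]
            · exact mul_le_mul_of_nonneg_left (by exact_mod_cast hle v o h0) h0.le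
          · exact mul_lt_mul_of_pos_left (by exact_mod_cast hlt) ho
      _ = _ := by rw [← Finset.sum_mul, sum_stepProb, one_mul]
  refine h1.not_lt (Finset.sum_lt_sum (fun s _ => mul_le_mul_of_nonneg_left (h2 s) (hπ.nonneg s))
    ⟨v, Finset.mem_univ v, mul_lt_mul_of_pos_left h3 hv⟩)

/-! ### The capacity region -/

/-- If the nodes outside `act` never transmit in states charged by `π`, and the other nodes gain
energy in silence, then the mean information is in the capacity region. -/
lemma mem_capacityRegion_of_silence (act : Fin 2 → Prop) (hp : M.IsTransmission p)
    (hπ : M.IsStationary p π) (hact : ∀ i, ¬ act i → ∀ s, 0 < π s → p i s = 0)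
    (hg : ∀ i, act i → 0 < M.gain i false) (s₀ : M.State) (R : Fin 2 → ℝ) (hR : ∀ i, 0 ≤ R i)
    (hRle : ∀ i, R i ≤ ∑ s, π s * M.rate p i s) : R ∈ M.capacityRegion s₀ := by
  classical
  let p' : Fin 2 → M.State → ℝ := fun i s => if act i then p i s else 0
  have hp' : M.IsTransmission p' := by
    refine ⟨fun i s => ?_, fun i s => ?_, fun i s hs => ?_⟩ <;> simp only [p'] <;> split_ifs
    · exact hp.nonneg i s
    · exact le_rfl
    · exact hp.le_one i s
    · exact zero_le_one
    · exact hp.empty i s hs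
    · rfl
  have heq : ∀ s, 0 < π s → ∀ i, p' i s = p i s := by
    intro s hs i
    simp only [p']
    split_ifs with h
    · rfl
    · exact (hact i h s hs).symm
  refine (Simulation.ofSilence (p := p') act (fun i hi s => if_neg hi) hg).mem_capacityRegion hp'
    (hπ.congr heq) (fun _ _ _ _ => rfl) s₀ (fun _ _ => le_rfl) R hR fun i => ?_
  refine (hRle i).trans (le_of_eq (Finset.sum_congr rfl fun s _ => ?_))
  rcases (hπ.nonneg s).eq_or_lt with h0 | h0
  · rw [← h0, zero_mul, zero_mul]
  · rw [rate_eq_info, rate_eq_info, heq s h0]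

theorem mem_capacityRegion_of_tendsto (hp : M.IsTransmission p) (s₀ : M.State)
    (hπ : Tendsto (fun k : ℕ => (M.transition p ^ k).mulVec (Pi.single s₀ 1)) atTop (𝓝 π))
    (R : Fin 2 → ℝ) (hR : ∀ i, 0 ≤ R i) (hRle : ∀ i, R i ≤ ∑ s, π s * M.rate p i s) :
    R ∈ M.capacityRegion s₀ := by
  have hst := isStationary_of_tendsto hp hπ
  have hnn : ∀ i, 0 ≤ ∑ s, π s * p i s := fun i =>
    Finset.sum_nonneg fun s _ => mul_nonneg (hst.nonneg s) (hp.nonneg i s)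
  have hbal : ∀ i, M.gain i false = 0 →
      ∑ s, π s * p i s ≤ M.gain i true * ∑ s, π s * p (other i) s := by
    intro i hi
    refine (hst.sum_mul_send_le hp i).trans (le_of_eq ?_)
    rw [Finset.mul_sum]
    exact Finset.sum_congr rfl fun s _ => by rw [hi]; ring
  by_cases hall : ∀ i, 0 < M.gain i false
  · exact mem_capacityRegion_of_silence (fun _ => True) hp hst (fun _ h => absurd trivial h)
      (fun i _ => hall i) s₀ R hR hRle
  push Not at hall
  obtain ⟨i, hi⟩ := hall
  replace hi : M.gain i false = 0 := le_antisymm hi (gain_nonneg i false)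
  rcases (gain_nonneg (M := M) (other i) false).eq_or_lt with hj | hj
  · by_cases hM : M.Lossless
    · exact (Simulation.ofLossless (p := p) hM).mem_capacityRegion hp hst
        (hM.totalEnergy_eq hp hst) s₀
        (fun v hv => level_le_of_tendsto hp hπ (fun s s' h => by
          obtain ⟨o, ho, rfl⟩ := exists_of_transition_pos hp h
          refine hM.totalEnergy_nextState_le (toNat_le_of_stepProb_pos hp ho) ?_
          exact lt_of_le_of_ne (M.harvestProb_nonneg _ _) (right_ne_zero_of_mul ho.ne').symm) hv)
        R hR hRle
    · -- energy is lost and never replaced, hence nothing is sent in the stationary regime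
      have hzero : ∀ k, ∑ s, π s * p k s ≤ 0 := by
        have h1 := hbal i hi
        have h2 := hbal (other i) hj.symm
        rw [other_other] at h2
        have g1 := gain_le_one (M := M) i true
        have g2 := gain_le_one (M := M) (other i) true
        have g3 := gain_nonneg (M := M) i true
        have g4 := gain_nonneg (M := M) (other i) true
        have n1 := hnn i
        have n2 := hnn (other i)
        have hlt : M.gain i true < 1 ∨ M.gain (other i) true < 1 := by
          by_contra hcon
          push Not at hcon
          refine hM fun k => ?_
          rcases eq_or_eq_other i k with rfl | rfl
          · exact ⟨hi, le_antisymm g1 hcon.1⟩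
          · exact ⟨hj.symm, le_antisymm g2 hcon.2⟩
        have hboth : ∑ s, π s * p i s ≤ 0 ∧ ∑ s, π s * p (other i) s ≤ 0 := by
          rcases hlt with h | h
          · have : ∑ s, π s * p (other i) s ≤ 0 := by nlinarith
            exact ⟨by nlinarith, this⟩
          · have : ∑ s, π s * p i s ≤ 0 := by nlinarith
            exact ⟨this, by nlinarith⟩
        intro k
        rcases eq_or_eq_other i k with rfl | rfl
        · exact hboth.1
        · exact hboth.2
      exact mem_capacityRegion_of_silence (fun _ => False) hp hst
        (fun k _ s hs => hst.eq_zero_of_sum_nonpos hp (hzero k) hs) (fun _ h => h.elim)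
        s₀ R hR hRle
  · by_cases hsup : 0 < M.gain i true ∧ 1 ≤ M.B (other i)
    · exact (Simulation.ofSupply (p := p) (other i) hj hsup.2
        (by rw [other_other]; exact hsup.1)).mem_capacityRegion hp hst (fun _ _ _ _ => rfl) s₀
        (fun _ _ => le_rfl) R hR hRle
    · -- Node `i` has no source of energy, hence it is silent in the stationary regime
      have hzero : ∑ s, π s * p i s ≤ 0 := by
        refine (hbal i hi).trans (le_of_eq ?_)
        by_cases hg : 0 < M.gain i true
        · have hB : M.B (other i) = 0 := by
            by_contra hB
            exact hsup ⟨hg, Nat.one_le_iff_ne_zero.mpr hB⟩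
          have : ∀ s, p (other i) s = 0 := fun s => hp.empty _ s (by
            have := (s (other i)).isLt
            omega)
          simp [this]
        · rw [le_antisymm (not_lt.mp hg) (gain_nonneg i true), zero_mul]
      refine mem_capacityRegion_of_silence (fun k => k = other i) hp hst (fun k hk s hs => ?_)
        (fun k hk => hk ▸ hj) s₀ R hR hRle
      rcases eq_or_eq_other i k with rfl | rfl
      · exact hst.eq_zero_of_sum_nonpos hp hzero hs
      · exact absurd rfl hk

end Model

/-! ### Mutual information of a binary channel -/

lemma H_eq (t : ℝ) : H t = -(t * Real.log t + (1 - t) * Real.log (1 - t)) / Real.log 2 := by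
  rw [H, Real.binEntropy_eq_negMulLog_add_negMulLog_one_sub, Real.negMulLog, Real.negMulLog]
  ring

namespace Model

variable {M : Model}

/-- Mutual information is the output entropy minus the mean conditional entropy. -/
theorem rate_eq {p : Fin 2 → M.State → ℝ} (hp : M.IsTransmission p) (i : Fin 2) (s : M.State) :
    M.rate p i s =
      H ((1 - p i s) * M.P i (other i) false true + p i s * M.P i (other i) true true) -
        (p i s * H (M.P i (other i) true true) + (1 - p i s) * H (M.P i (other i) false true)) := by
  rw [rate_eq_info, info]
  simp only [logRatio, other_other]
  set q : Bool → ℝ := fun y => ∑ x', bern (p i s) x' * M.P i (other i) x' y with hq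
  -- the logarithm of a quotient splits unless the term is 0
  have hterm : ∀ x y, bern (p i s) x * (M.P i (other i) x y *
      Real.logb 2 (M.P i (other i) x y / q y)) =
      (bern (p i s) x * (M.P i (other i) x y * Real.log (M.P i (other i) x y)) -
        bern (p i s) x * M.P i (other i) x y * Real.log (q y)) / Real.log 2 := by
    intro x y
    have hb := bern_nonneg (hp.nonneg i s) (hp.le_one i s)
    rcases (hb x).eq_or_lt with h0 | h0
    · rw [← h0]; simp
    rcases (M.P_nonneg i (other i) x y).eq_or_lt with h1 | h1
    · rw [← h1]; simp
    have hqy : 0 < q y := lt_of_lt_of_le (mul_pos h0 h1) (Finset.single_le_sum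
      (f := fun x' => bern (p i s) x' * M.P i (other i) x' y)
      (fun x' _ => mul_nonneg (hb x') (M.P_nonneg _ _ _ _)) (Finset.mem_univ x))
    rw [Real.logb, Real.log_div h1.ne' hqy.ne']
    ring
  have hP : ∀ x, M.P i (other i) x false = 1 - M.P i (other i) x true := by
    intro x
    have := M.sum_P i (other i) x
    rw [Fintype.sum_bool] at this
    linarith
  have hqt : q true = (1 - p i s) * M.P i (other i) false true +
      p i s * M.P i (other i) true true := by
    simp [hq, bern]
    ring
  have hqf : q false = 1 - q true := by
    rw [hqt]
    simp [hq, bern, hP]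
    ring
  have hsum : ∑ x, bern (p i s) x * ∑ y, M.P i (other i) x y *
      Real.logb 2 (M.P i (other i) x y / q y) =
      ∑ x, ∑ y, (bern (p i s) x * (M.P i (other i) x y * Real.log (M.P i (other i) x y)) -
        bern (p i s) x * M.P i (other i) x y * Real.log (q y)) / Real.log 2 :=
    Finset.sum_congr rfl fun x _ => by
      rw [Finset.mul_sum]
      exact Finset.sum_congr rfl fun y _ => hterm x y
  refine hsum.trans ?_
  simp only [Fintype.sum_bool]
  rw [← hqt, H_eq, H_eq, H_eq, hqf, hP, hP]
  have hbt : bern (p i s) true = p i s := rfl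
  have hbf : bern (p i s) false = 1 - p i s := rfl
  rw [hbt, hbf]
  have hl : Real.log 2 ≠ 0 := (Real.log_pos one_lt_two).ne'
  field_simp
  rw [show (1 : ℝ) - q true = (1 - p i s) * (1 - M.P i (other i) false true) +
    p i s * (1 - M.P i (other i) true true) by rw [hqt]; ring]
  rw [hqt]
  ring

end Model
end EnergyExchange
end

theorem proposition3 (M : EnergyExchange.Model) (s₀ : M.State)
    (p : Fin 2 → M.State → ℝ) (hp : M.IsTransmission p)
    (π : M.State → ℝ)
    (hπ : Filter.Tendsto (fun k : ℕ => (M.transition p ^ k).mulVec (Pi.single s₀ 1))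
      Filter.atTop (nhds π)) :
    (∀ R : Fin 2 → ℝ, (∀ i, 0 ≤ R i) → (∀ i, R i ≤ ∑ s, π s * M.rate p i s) →
      R ∈ M.capacityRegion s₀) ∧
    (∀ i s, M.rate p i s =
      EnergyExchange.H ((1 - p i s) * M.P i (EnergyExchange.other i) false true +
          p i s * M.P i (EnergyExchange.other i) true true) -
        (p i s * EnergyExchange.H (M.P i (EnergyExchange.other i) true true) +
          (1 - p i s) * EnergyExchange.H (M.P i (EnergyExchange.other i) false true))) :=
  ⟨fun R hR hRle => EnergyExchange.Model.mem_capacityRegion_of_tendsto hp s₀ hπ R hR hRle,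
    fun i s => EnergyExchange.Model.rate_eq hp i s⟩
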